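/- **Conventions.** Let $K$ be an algebraically closed field. Algebras are finite-dimensional basic $K$-algebras $A$ with a complete family of primitive orthogonal idempotents $(e_i)_{i\in Q_0}$, where $(Q_0,\le)$ is a finite partially ordered set; modules are finite-dimensional left modules. Put $P(i)=Ae_i$, $S(i)=\operatorname{top}P(i)$, $I(i)=\operatorname{Hom}_K(e_iA,K)$, $[M:S(j)]=\dim_K e_jM$. The standard module $\Delta(i)$ is the largest factor module of $P(i)$, and the costandard module $\nabla(i)$ the largest submodule of $I(i)$, with no composition factor $S(k)$, $k\not\le i$. A module is $\Delta$-good (resp. $\nabla$-good) if it has a filtration whose subquotients are standard (resp. costandard) modules; $(M:\Delta(k))$, $(M:\nabla(k))$ are the numbers of subquotients isomorphic to $\Delta(k)$, $\nabla(k)$. $(A,\le)$ is *quasi-hereditary* if for all $i$: $[\Delta(i):S(i)]=1$, and $P(i)$ is $\Delta$-good with $(P(i):\Delta(i))=1$ and $(P(i):\Delta(k))=0$ for $k\not\ge i$. It is *1-quasi-hereditary* if moreover (1) $\le$ has a smallest element $b$ and a largest element $t$; (2) $[\Delta(i):S(j)]=(P(j):\Delta(i))=1$ for $j\le i$; (3)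 $\operatorname{soc}P(i)\cong\operatorname{top}I(i)\cong S(b)$ for all $i$; (4) for all $i$ there are an injective homomorphism $\Delta(i)\to\Delta(t)$ and a surjective one $\nabla(t)\to\nabla(i)$. For $i\in Q_0$ let $A(i)=A/A\bigl(\sum_{j\not\le i}e_j\bigr)A$, with vertices $\{j\le i\}$. For quasi-hereditary $A$, $T(i)$ denotes the indecomposable module that is $\Delta$-good and $\nabla$-good with $(T(i):\Delta(i))=(T(i):\nabla(i))=[T(i):S(i)]=1$ and $(T(i):\Delta(j))=(T(i):\nabla(j))=[T(i):S(j)]=0$ for $j\not\le i$. The Ringel dual of $A$ is $R(A)=\operatorname{End}_A(\bigoplus_iT(i))^{op}$, whose idempotents are the projections to the $T(i)$, with the opposite order $\ge$. **The algebra.** Let $q\in K$, $q\ne1$. Let $Q$ be the quiver with vertices $1,\dots,6$ and one arrow in each direction between $1,2$; $2,3$; $3,5$; $5,6$; $1,4$; $4,5$. Write $(i_1i_2\dots i_m)$ for the path $i_1\to i_2\to\dots\to i_m$; paths are composed like maps, so $(i_1\dots i_m)=(i_{m-1}i_m)\cdots(i_1i_2)$. Let $A=KQ/\mathcal I$, where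 $\mathcal I$ is generated by the relations $$(1235)=(145),\quad (5321)=(541),\quad (212)=(232),\quad (323)=(353),\quad (535)=(565)=(545),\quad (656)=0,$$ $$(412)=(4532),\quad (214)=(2354),\quad (414)=q\,(45654).$$ Order the vertices by $1<2<3<5<6$, $1<4<5$. **Statement.** 1. $A$ is a finite-dimensional basic algebra and is 1-quasi-hereditary. 2. The algebras $A(i)$ are basic, and $A(i)$ is 1-quasi-hereditary for $i=1,2,3,4,6$. For $i=1,2,3$, $A(i)$ is isomorphic to the Auslander algebra $\mathcal A_i$ of $K[x]/(x^i)$, and $A(4)\cong\mathcal A_2$; here $\mathcal A_m=\operatorname{End}_B\bigl(\bigoplus_{0\le i<m}(x^i)\bigr)$ with $B=K[x]/(x^m)$. 3. In $P_{A(5)}(1)$ the elements $p_1=(14541)$ and $p_2=(141)-(12321)$ are linearly independent, $(12)p_1=(14)p_1=(12)p_2=(14)p_2=0$, and each of $p_1$, $p_2$ generates a simple submodule. The socle of $P_{A(5)}(1)$ is not simple; in particular it is not isomorphic to $S(1)$, and $A(5)$ is not 1-quasi-hereditary. 4. For $i=1,2,3,4,6$ the module $T(i)$ is the submodule of $P(1)$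 generated by $t(i)$, where $t(1)=(1456541)$, $t(2)=(14541)$, $t(3)=q\,(12321)-(141)$, $t(4)=(141)-(12321)$, $t(6)=e_1$. The module $T(5)$ is the submodule of $P(1)\oplus P(1)$ generated by $\bigl((121),(141)-(12321)\bigr)$ and $\bigl((141),0\bigr)$. 5. The Ringel dual $(R(A),\ge)$ is not 1-quasi-hereditary. -/

import Mathlib

universe u v

namespace OneQH

noncomputable section

/-! ### Modules: top, socle, indecomposability -/

section Modules

variable (A : Type*) [Ring A] (M : Type*) [AddCommGroup M] [Module A M]

/-- The top `M / rad M`, where `rad M` is the intersection of the maximal submodules. -/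
abbrev HeadMod : Type _ := M ⧸ Module.jacobson A M

/-- The socle: the sum of all simple submodules. -/
def soc : Submodule A M := sSup {N : Submodule A M | IsSimpleModule A N}

/-- `M` is nonzero and is not the direct sum of two nonzero submodules. -/
def IsIndecomposable : Prop :=
  Nontrivial M ∧ ∀ N N' : Submodule A M, IsCompl N N' → N = ⊥ ∨ N' = ⊥

/-- `M` has a finite filtration all of whose subquotients are isomorphic to modules of the family
`Θ`, and `Θ k` is used exactly `d k` times. -/
def HasFiltration {A : Type*} [Ring A] {ι : Type*} (Θ : ι → Type*)
    [∀ i, AddCommGroup (Θ i)] [∀ i, Module A (Θ i)]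
    (M : Type*) [AddCommGroup M] [Module A M] (d : ι → ℕ) : Prop :=
  ∃ (r : ℕ) (F : ℕ → Submodule A M) (lab : ℕ → ι),
    F 0 = ⊥ ∧ F r = ⊤ ∧
    (∀ t < r, F t ≤ F (t + 1) ∧
      Nonempty ((F (t + 1) ⧸ (F t).submoduleOf (F (t + 1))) ≃ₗ[A] Θ (lab t))) ∧
    ∀ k, d k = {t : ℕ | t < r ∧ lab t = k}.ncard

end Modules

/-! ### The left module `D(A) = Hom_K(A, K)` -/

section Dual

variable (K A : Type*) [Field K] [Ring A] [Algebra K A]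

/-- The `K`-dual of the right regular module, a left `A`-module through `(a • f) x = f (x * a)`. -/
def DualReg : Type _ := A →ₗ[K] K

instance : AddCommGroup (DualReg K A) := inferInstanceAs (AddCommGroup (A →ₗ[K] K))

instance : Module K (DualReg K A) := inferInstanceAs (Module K (A →ₗ[K] K))

variable {K A} in
/-- The value of a functional at `x`. -/
def DualReg.ev (f : DualReg K A) (x : A) : K := (show A →ₗ[K] K from f) x

instance : SMul A (DualReg K A) :=
  ⟨fun a f => LinearMap.comp (show A →ₗ[K] K from f) (LinearMap.mulRight K a)⟩

@[simp] theorem DualReg.ev_smul (a : A) (f : DualReg K A) (x : A) :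
    (a • f).ev x = f.ev (x * a) := rfl

@[simp] theorem DualReg.ev_smul_field (c : K) (f : DualReg K A) (x : A) :
    (c • f).ev x = c * f.ev x := rfl

@[simp] theorem DualReg.ev_add (f g : DualReg K A) (x : A) :
    (f + g).ev x = f.ev x + g.ev x := rfl

@[simp] theorem DualReg.ev_zero (x : A) : (0 : DualReg K A).ev x = 0 := rfl

@[simp] theorem DualReg.ev_add_right (f : DualReg K A) (x y : A) :
    f.ev (x + y) = f.ev x + f.ev y := LinearMap.map_add _ x y

@[simp] theorem DualReg.ev_zero_right (f : DualReg K A) : f.ev 0 = 0 := LinearMap.map_zero _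

@[simp] theorem DualReg.ev_smul_right (f : DualReg K A) (c : K) (x : A) :
    f.ev (c • x) = c * f.ev x := LinearMap.map_smul _ c x

theorem DualReg.ext {f g : DualReg K A} (h : ∀ x, f.ev x = g.ev x) : f = g :=
  LinearMap.ext h

instance : Module A (DualReg K A) where
  one_smul f := DualReg.ext K A fun x => by simp
  mul_smul a b f := DualReg.ext K A fun x => by simp [mul_assoc]
  smul_zero a := DualReg.ext K A fun x => by simp
  smul_add a f g := DualReg.ext K A fun x => by simp
  add_smul a b f := DualReg.ext K A fun x => by simp [mul_add]
  zero_smul f := DualReg.ext K A fun x => by simp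

instance : IsScalarTower K A (DualReg K A) :=
  ⟨fun c a f => DualReg.ext K A fun x => by simp⟩

end Dual

/-! ### Algebras with a family of idempotents indexed by a partially ordered set

`e i` is the idempotent of the vertex `i`. All modules are left modules. -/

section Algebras

variable (K : Type*) [Field K] {A : Type*} [Ring A] [Algebra K A] {ι : Type*} (e : ι → A)

/-- The projective module `P(i) = A e_i`. -/
abbrev P (i : ι) : Submodule A A := Submodule.span A {e i}

/-- The simple module `S(i) = top P(i)`. -/
abbrev S (i : ι) : Type _ := HeadMod A (P e i)

/-- The injective module `I(i) = D(e_i A)`: the functionals `f` on `A` with `f x = f (e_i x)`,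
that is, those that vanish on `(1 - e_i) A`. -/
def I (i : ι) : Submodule A (DualReg K A) where
  carrier := {f | ∀ x, f.ev (e i * x) = f.ev x}
  add_mem' {f g} hf hg x := by
    have h1 := hf x
    have h2 := hg x
    simp [h1, h2]
  zero_mem' x := by simp
  smul_mem' a f hf x := by
    have h1 := hf (x * a)
    simpa [mul_assoc] using h1

/-- `[M : S(j)] = dim_K e_j M`. -/
def mult (M : Type*) [AddCommGroup M] [Module K M] [Module A M] [IsScalarTower K A M]
    (j : ι) : ℕ :=
  Module.finrank K (LinearMap.range (Algebra.lsmul K K M (e j) : M →ₗ[K] M))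

/-- `A` is finite dimensional and basic, and `e` is a complete family of pairwise orthogonal
primitive idempotents of it. -/
def IsBasicAlgebra [Fintype ι] : Prop :=
  Module.Finite K A ∧ CompleteOrthogonalIdempotents e ∧
    (∀ i, IsSimpleModule A (S e i)) ∧ ∀ i j, Nonempty (S e i ≃ₗ[A] S e j) → i = j

variable [PartialOrder ι]

/-- The kernel of `P(i) → Δ(i)`: the smallest submodule `N` with `[P(i)/N : S(k)] = 0` for all
`k ≰ i`. -/
def kerDelta (i : ι) : Submodule A (P e i) :=
  sInf {N | ∀ k, ¬ k ≤ i → ∀ x : P e i, e k • x ∈ N}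

/-- The standard module `Δ(i)`. -/
abbrev Delta (i : ι) : Type _ := P e i ⧸ kerDelta e i

/-- The costandard module `∇(i)`: the largest submodule `N` of `I(i)` with `[N : S(k)] = 0` for
all `k ≰ i`. -/
def Nabla (i : ι) : Submodule A (I K e i) :=
  sSup {N | ∀ k, ¬ k ≤ i → ∀ x ∈ N, e k • x = 0}

/-- `(A, ≤)` is quasi-hereditary. -/
def IsQuasiHereditary : Prop :=
  (∀ i, mult K e (Delta e i) i = 1) ∧
  ∀ i, ∃ d : ι → ℕ, HasFiltration (A := A) (Delta e) (P e i) d ∧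
    d i = 1 ∧ ∀ k, ¬ i ≤ k → d k = 0

/-- `(A, ≤)` is 1-quasi-hereditary. Here `b` and `t` are the smallest and the largest vertex. -/
def IsOneQuasiHereditary : Prop :=
  IsQuasiHereditary K e ∧
  ∃ b t : ι, (∀ i, b ≤ i) ∧ (∀ i, i ≤ t) ∧
    (∀ i j, j ≤ i → mult K e (Delta e i) j = 1 ∧
      ∃ d : ι → ℕ, HasFiltration (A := A) (Delta e) (P e j) d ∧ d i = 1) ∧
    (∀ i, Nonempty (soc A (P e i) ≃ₗ[A] S e b) ∧ Nonempty (HeadMod A (I K e i) ≃ₗ[A] S e b)) ∧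
    (∀ i, (∃ f : Delta e i →ₗ[A] Delta e t, Function.Injective f) ∧
      ∃ g : Nabla K e t →ₗ[A] Nabla K e i, Function.Surjective g)

/-- `M` is the indecomposable direct summand `T(i)` of the characteristic tilting module. -/
def IsTilting (i : ι) (M : Type*) [AddCommGroup M] [Module K M] [Module A M]
    [IsScalarTower K A M] : Prop :=
  IsIndecomposable A M ∧
  (∃ d : ι → ℕ, HasFiltration (A := A) (Delta e) M d ∧ d i = 1 ∧ ∀ j, ¬ j ≤ i → d j = 0) ∧
  (∃ d : ι → ℕ, HasFiltration (A := A) (fun j => Nabla K e j) M d ∧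
    d i = 1 ∧ ∀ j, ¬ j ≤ i → d j = 0) ∧
  mult K e M i = 1 ∧ ∀ j, ¬ j ≤ i → mult K e M j = 0

/-- The algebra `R = End_A(⨁ T(i))ᵒᵖ`; it is the Ringel dual of `A` when the `T(i)` are the
summands of the characteristic tilting module. -/
abbrev RingelDual (A : Type*) [Ring A] {ι : Type*} (T : ι → Type*) [∀ i, AddCommGroup (T i)]
    [∀ i, Module A (T i)] : Type _ := (Module.End A (∀ i, T i))ᵐᵒᵖ

/-- The idempotents of `R`: the projections of `⨁ T(i)` to its summands. The vertices carry the
opposite order. -/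
def ringelIdem (A : Type*) [Ring A] {ι : Type*} [DecidableEq ι] (T : ι → Type*)
    [∀ i, AddCommGroup (T i)] [∀ i, Module A (T i)] (i : ιᵒᵈ) : RingelDual A T :=
  MulOpposite.op
    (LinearMap.single A T (OrderDual.ofDual i) ∘ₗ LinearMap.proj (OrderDual.ofDual i))

open Classical in
/-- The relation `ε = 0`, where `ε` is the sum of the `e j` with `j ≰ i`. -/
inductive TruncRel [Fintype ι] (i : ι) : A → A → Prop
  | zero : TruncRel i (∑ j with ¬ j ≤ i, e j) 0

/-- The factor algebra `A(i) = A / A ε A`. -/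
def TruncAlg [Fintype ι] (i : ι) : Type _ := RingQuot (TruncRel e i)

instance [Fintype ι] (i : ι) : Ring (TruncAlg e i) := inferInstanceAs (Ring (RingQuot (TruncRel e i)))

instance [Fintype ι] (i : ι) : Algebra K (TruncAlg e i) :=
  inferInstanceAs (Algebra K (RingQuot (TruncRel e i)))

/-- The projection `A → A(i)`. -/
def truncMk [Fintype ι] (i : ι) : A →ₐ[K] TruncAlg e i := RingQuot.mkAlgHom K (TruncRel e i)

/-- The idempotents of `A(i)`, indexed by the vertices `j ≤ i`. -/
def truncIdem [Fintype ι] (i : ι) (j : {j : ι // j ≤ i}) : TruncAlg e i := truncMk K e i (e j)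

end Algebras

/-! ### Path algebras -/

section PathAlgebra

variable (K : Type u) [Field K] {V : Type} [Fintype V] (adj : V → V → Bool)

/-- The arrows of the quiver with vertex set `V` that has one arrow `i → j` if `adj i j` and no
arrow `i → j` otherwise. -/
abbrev Arrow : Type := {p : V × V // adj p.1 p.2 = true}

/-- The relations that define the path algebra in terms of its generators, the vertices and the
arrows. An arrow `i → j` lies in `e_j · KQ · e_i`. -/
inductive PathRel : FreeAlgebra K (V ⊕ Arrow adj) → FreeAlgebra K (V ⊕ Arrow adj) → Prop
  | idem (i : V) : PathRel
      (FreeAlgebra.ι K (Sum.inl i) * FreeAlgebra.ι K (Sum.inl i)) (FreeAlgebra.ι K (Sum.inl i))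
  | orth (i j : V) (h : i ≠ j) : PathRel
      (FreeAlgebra.ι K (Sum.inl i) * FreeAlgebra.ι K (Sum.inl j)) 0
  | one : PathRel (∑ i : V, FreeAlgebra.ι K (Sum.inl i)) 1
  | source (a : Arrow adj) : PathRel
      (FreeAlgebra.ι K (Sum.inr a) * FreeAlgebra.ι K (Sum.inl a.1.1)) (FreeAlgebra.ι K (Sum.inr a))
  | target (a : Arrow adj) : PathRel
      (FreeAlgebra.ι K (Sum.inl a.1.2) * FreeAlgebra.ι K (Sum.inr a)) (FreeAlgebra.ι K (Sum.inr a))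

/-- The path algebra of the quiver. -/
def PathAlgebra : Type u := RingQuot (PathRel K adj)

instance : Ring (PathAlgebra K adj) := inferInstanceAs (Ring (RingQuot (PathRel K adj)))

instance : Algebra K (PathAlgebra K adj) := inferInstanceAs (Algebra K (RingQuot (PathRel K adj)))

/-- The projection from the free algebra to the path algebra. -/
def pathMk : FreeAlgebra K (V ⊕ Arrow adj) →ₐ[K] PathAlgebra K adj :=
  RingQuot.mkAlgHom K (PathRel K adj)

/-- The trivial path at a vertex. -/
def vertex (i : V) : PathAlgebra K adj :=
  pathMk K adj (FreeAlgebra.ι K (Sum.inl i))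

/-- The arrow `i → j` (and `0` if there is none). -/
def arrow (i j : V) : PathAlgebra K adj :=
  if h : adj i j = true then
    pathMk K adj (FreeAlgebra.ι K (Sum.inr ⟨(i, j), h⟩))
  else 0

/-- The path `(i₁ i₂ … iₘ) = (iₘ₋₁ → iₘ) ⋯ (i₂ → i₃) · (i₁ → i₂)`. -/
def path : List V → PathAlgebra K adj
  | [] => 0
  | [i] => vertex K adj i
  | i :: j :: l => path (j :: l) * arrow K adj i j

end PathAlgebra

/-! ### The algebra with six vertices -/

/-- The vertices `1, …, 6`. -/
inductive Vtx : Type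
  | v1 | v2 | v3 | v4 | v5 | v6
  deriving DecidableEq

open Vtx

instance : Fintype Vtx where
  elems := {v1, v2, v3, v4, v5, v6}
  complete i := by cases i <;> decide

/-- The partial order generated by `1 < 2 < 3 < 5 < 6` and `1 < 4 < 5`. -/
def Vtx.leB : Vtx → Vtx → Bool
  | v1, _ => true
  | v2, v2 | v2, v3 | v2, v5 | v2, v6 => true
  | v3, v3 | v3, v5 | v3, v6 => true
  | v4, v4 | v4, v5 | v4, v6 => true
  | v5, v5 | v5, v6 => true
  | v6, v6 => true
  | _, _ => false

instance : PartialOrder Vtx where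
  le i j := Vtx.leB i j = true
  le_refl := by decide
  le_trans := by decide
  le_antisymm := by decide

instance : DecidableLE Vtx := fun i j => inferInstanceAs (Decidable (Vtx.leB i j = true))

/-- There is one arrow in each direction between neighbours of the partial order:
`1 ⇄ 2 ⇄ 3 ⇄ 5 ⇄ 6` and `1 ⇄ 4 ⇄ 5`. -/
def adj6 : Vtx → Vtx → Bool
  | v1, v2 | v2, v1 | v2, v3 | v3, v2 | v3, v5 | v5, v3 | v5, v6 | v6, v5 => true
  | v1, v4 | v4, v1 | v4, v5 | v5, v4 => true
  | _, _ => false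

section Example

variable {K : Type u} [Field K] (q : K)

/-- The defining relations. -/
inductive Rel6 : PathAlgebra K adj6 → PathAlgebra K adj6 → Prop
  | r1235 : Rel6 (path K adj6 [v1, v2, v3, v5]) (path K adj6 [v1, v4, v5])
  | r5321 : Rel6 (path K adj6 [v5, v3, v2, v1]) (path K adj6 [v5, v4, v1])
  | r212 : Rel6 (path K adj6 [v2, v1, v2]) (path K adj6 [v2, v3, v2])
  | r323 : Rel6 (path K adj6 [v3, v2, v3]) (path K adj6 [v3, v5, v3])
  | r535 : Rel6 (path K adj6 [v5, v3, v5]) (path K adj6 [v5, v6, v5])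
  | r545 : Rel6 (path K adj6 [v5, v4, v5]) (path K adj6 [v5, v6, v5])
  | r656 : Rel6 (path K adj6 [v6, v5, v6]) 0
  | r412 : Rel6 (path K adj6 [v4, v1, v2]) (path K adj6 [v4, v5, v3, v2])
  | r214 : Rel6 (path K adj6 [v2, v1, v4]) (path K adj6 [v2, v3, v5, v4])
  | r414 : Rel6 (path K adj6 [v4, v1, v4]) (q • path K adj6 [v4, v5, v6, v5, v4])

/-- The algebra `A = KQ/I`. -/
def Alg6 : Type u := RingQuot (Rel6 q)

instance : Ring (Alg6 q) := inferInstanceAs (Ring (RingQuot (Rel6 q)))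

instance : Algebra K (Alg6 q) := inferInstanceAs (Algebra K (RingQuot (Rel6 q)))

/-- The projection from the path algebra to `A`. -/
def mk6 : PathAlgebra K adj6 →ₐ[K] Alg6 q := RingQuot.mkAlgHom K (Rel6 q)

/-- The path `(i₁ i₂ … iₘ)`, viewed in `A`. -/
def pth (l : List Vtx) : Alg6 q := mk6 q (path K adj6 l)

/-- The idempotents `e_1, …, e_6` of `A`. -/
def idem6 (i : Vtx) : Alg6 q := pth q [i]

/-- The path `(i₁ i₂ … iₘ)`, viewed in `A(5)`. -/
def pth5 (l : List Vtx) : TruncAlg (idem6 q) v5 := truncMk K (idem6 q) v5 (pth q l)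

/-- The vertex `1` of `A(5)`. -/
def one5 : {j : Vtx // j ≤ v5} := ⟨v1, by decide⟩

/-- The elements `t(i)` of `P(1)` for `i ≠ 5` (the value at `5` is not used). -/
def tGen : Vtx → Alg6 q
  | v1 => pth q [v1, v4, v5, v6, v5, v4, v1]
  | v2 => pth q [v1, v4, v5, v4, v1]
  | v3 => q • pth q [v1, v2, v3, v2, v1] - pth q [v1, v4, v1]
  | v4 => pth q [v1, v4, v1] - pth q [v1, v2, v3, v2, v1]
  | v5 => 0
  | v6 => pth q [v1]

/-- The submodule of `P(1) ⊕ P(1)` generated by `((121), (141) - (12321))` and `((141), 0)`. -/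
def T5 : Submodule (Alg6 q) (Alg6 q × Alg6 q) :=
  Submodule.span (Alg6 q)
    {(pth q [v1, v2, v1], pth q [v1, v4, v1] - pth q [v1, v2, v3, v2, v1]),
      (pth q [v1, v4, v1], 0)}

end Example

/-- The Auslander algebra of `B = K[X]/(X^m)`: the endomorphism algebra of the direct sum of the
ideals `(x^i)`, `0 ≤ i < m`, of `B`. -/
abbrev AuslanderAlgebra (K : Type u) [Field K] (m : ℕ) : Type u :=
  Module.End (Polynomial K ⧸ Ideal.span {(Polynomial.X : Polynomial K) ^ m})
    (∀ i : Fin m, ↥(Ideal.span {(Ideal.Quotient.mk (Ideal.span {(Polynomial.X : Polynomial K) ^ m})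
      Polynomial.X) ^ (i : ℕ)}))

end

end OneQH

open OneQH OneQH.Vtx

/-! For `i, j ≤ k` let p(j,k,i) be the path that climbs from i to k and then descends to j. The
relations turn every valley (down from k to j, then up to l) into a multiple of a peak over some r ≥
k, l, or into 0. Hence these paths span A, and p(m,l,j)p(j,k,i) = γ p(m,r,i) with γ and r depending
on l, j, k only. An explicit representation modelled on P(1) shows that they are independent
(`basis6`). The highest weight structure can be read off from this triangular multiplication: Δ(i)
has the basis p(m,i,i), on which descending arrows act and which ascending arrows kill up to higher
levels; ∇(i) is dual to it; and P(i) is filtered by the Δ(k) with k ≥ i, each once.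

The rest of 1-quasi-heredity comes from bilinear forms. For each j, pair l, k ≥ j by the coefficient
at the top level t of the valley (l,j,k). If the structure constants are symmetric and all these
forms are nondegenerate (`IsFrobenius`), then p(b,t,i) spans the socle of P(i), and I(i) is
generated by the functional dual to p(i,t,b). For t = 6 and j = 1 the decisive block sits at the
vertices 3 and 4; its rows are (1,1) and (1,q), with determinant q - 1. The algebra A(i) keeps the
levels k ≤ i with the same constants (`trunc`). Its forms are nondegenerate for i ≠ 5
(`strConst_nondeg`), but for i = 5 the vertices 3 and 4 give equal columns, and (141) - (12321)
becomes a second socle element of P(1).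

For the T(i), explicit bases are given that are adapted to a standard and to a costandard filtration
(`GradedFamily`). The cyclic ones are indecomposable because P(1) is local; for T(5) the argument
uses that e_5 T(5) is a line.

For the Ringel dual the T(i) are arbitrary modules with the characterizing properties. On T(6) the
path from 1 up to 6 and back acts nontrivially; this embeds P(1), which is also I(1), so that it
splits off and T(6) ≅ P(1) (`exists_generator_v6`). T(5) has two independent vectors at the vertex 1
that are killed by all arrows (`exists_socle_v5`). They give two independent maps T(6) → T(5), which
lie in the socle of the projective R(A)-module at 5 and are fixed by the idempotent at 6. A socle
isomorphic to the simple module at 6, the smallest vertex of the opposite order, has room for only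
one. -/

namespace OneQH

/-! ### Filtrations: dévissage, and construction from adapted families of vectors -/

section Filtrations

/-- Dévissage along the filtration. The map φ is the projection to a subquotient, and `d k ≠ 0`
records that only labels that occur have to be treated. -/
theorem HasFiltration.induction {A : Type*} [Ring A] {ι : Type*} {Θ : ι → Type*}
    [∀ i, AddCommGroup (Θ i)] [∀ i, Module A (Θ i)] {M : Type*} [AddCommGroup M] [Module A M]
    {d : ι → ℕ} (hM : HasFiltration (A := A) Θ M d) (Q : Submodule A M → Prop) (bot : Q ⊥)
    (step : ∀ (N N' : Submodule A M) (k : ι) (φ : N' →ₗ[A] Θ k), d k ≠ 0 → N ≤ N' →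
      Function.Surjective φ → (∀ x : N', φ x = 0 ↔ (x : M) ∈ N) → Q N → Q N') : Q ⊤ := by
  obtain ⟨r, F, lab, h0, hr, hs, hd⟩ := hM
  have key : ∀ t ≤ r, Q (F t) := by
    intro t
    induction t with
    | zero => intro _; rw [h0]; exact bot
    | succ t ih =>
      intro ht
      obtain ⟨hle, ⟨f⟩⟩ := hs t (by omega)
      refine step (F t) (F (t + 1)) (lab t)
        (f.toLinearMap ∘ₗ ((F t).submoduleOf (F (t + 1))).mkQ) ?_ hle ?_ ?_ (ih (by omega))
      · rw [hd]
        have hfin : {s : ℕ | s < r ∧ lab s = lab t}.Finite :=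
          (Set.finite_Iio r).subset fun s hs => hs.1
        exact ((Set.ncard_pos hfin).2 ⟨t, by omega, rfl⟩).ne'
      · exact f.surjective.comp (Submodule.mkQ_surjective _)
      · intro x
        change f (((F t).submoduleOf (F (t + 1))).mkQ x) = 0 ↔ _
        rw [LinearEquiv.map_eq_zero_iff, Submodule.mkQ_apply, Submodule.Quotient.mk_eq_zero]
        rfl
  rw [← hr]
  exact key r le_rfl

theorem exists_linearMap_of_linearIndependent {K V W κ : Type*} [Field K] [AddCommGroup V]
    [Module K V] [AddCommGroup W] [Module K W] {v : κ → V} (hv : LinearIndependent K v)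
    (f : κ → W) : ∃ g : V →ₗ[K] W, ∀ x, g (v x) = f x := by
  obtain ⟨g, hg⟩ := LinearMap.exists_extend ((Module.Basis.span hv).constr K f)
  refine ⟨g, fun x => ?_⟩
  have h1 := (Module.Basis.span hv).constr_basis K f x
  rw [← hg] at h1
  simpa [Module.Basis.span_apply] using h1

variable {K : Type*} [Field K] {A : Type*} [Ring A] [Algebra K A]

/-- The span of the vectors `w t' l` with `t' < s`. -/
def lowerSpan (K : Type*) [Field K] {M : Type*} [AddCommGroup M] [Module K M] {r : ℕ}
    {γ : Fin r → Type*} (w : ∀ t, γ t → M) (s : ℕ) : Submodule K M :=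
  Submodule.span K {x | ∃ t' : Fin r, t'.val < s ∧ ∃ l, x = w t' l}

/-- A family of vectors `w t l` on which the algebra acts, up to the vectors with smaller `t`, as
on the basis of `Θ (lab t)`, gives a filtration with subquotients `Θ (lab t)`. -/
theorem HasFiltration.of_family {ι : Type*} [Nonempty ι] {Θ : ι → Type*}
    [∀ i, AddCommGroup (Θ i)] [∀ i, Module A (Θ i)] [∀ i, Module K (Θ i)]
    [∀ i, IsScalarTower K A (Θ i)] {β : ι → Type*} [∀ i, Fintype (β i)]
    (θ : ∀ i, Module.Basis (β i) K (Θ i))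
    {M : Type*} [AddCommGroup M] [Module A M] [Module K M] [IsScalarTower K A M]
    (N : Submodule A M) {r : ℕ} (lab : Fin r → ι) (w : ∀ t, β (lab t) → M)
    (hli : LinearIndependent K (fun x : Σ t, β (lab t) => w x.1 x.2))
    (hN : N.restrictScalars K = Submodule.span K (Set.range fun x : Σ t, β (lab t) => w x.1 x.2))
    (G : Set A) (hG : Algebra.adjoin K G = ⊤)
    (h : ∀ g ∈ G, ∀ (t : Fin r) l, g • w t l - ∑ m, (θ (lab t)).repr (g • θ (lab t) l) m • w t m ∈
      lowerSpan K w t) :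
    HasFiltration (A := A) Θ N (fun k => {t | lab t = k}.ncard) := by
  classical
  let f : ∀ t, Θ (lab t) →ₗ[K] M := fun t => (θ (lab t)).constr K (w t)
  have hf : ∀ t l, f t (θ (lab t) l) = w t l := fun t l => (θ (lab t)).constr_basis K _ l
  have hf' : ∀ t y, f t y = ∑ m, (θ (lab t)).repr y m • w t m := fun t y => by
    rw [Module.Basis.constr_apply_fintype]; rfl
  have hmono : ∀ s s', s ≤ s' → lowerSpan K w s ≤ lowerSpan K w s' := fun s s' hs =>
    Submodule.span_mono fun x ⟨t', ht', l, hl⟩ => ⟨t', by omega, l, hl⟩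
  have hmem : ∀ (t : Fin r) s, t.val < s → ∀ y, f t y ∈ lowerSpan K w s := fun t s hs y => by
    rw [hf']
    exact Submodule.sum_mem _ fun m _ =>
      Submodule.smul_mem _ _ (Submodule.subset_span ⟨t, hs, m, rfl⟩)
  -- If a commutes with all maps `f t` up to lower layers, then it preserves the span of the lower
  -- layers.
  have stable : ∀ a : A, (∀ t y, a • f t y - f t (a • y) ∈ lowerSpan K w t.val) →
      ∀ s, ∀ x ∈ lowerSpan K w s, a • x ∈ lowerSpan K w s := by
    intro a ha s x hx
    induction hx using Submodule.span_induction with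
    | mem x hx =>
      obtain ⟨t, ht, l, rfl⟩ := hx
      have h1 := ha t (θ _ l)
      rw [hf] at h1
      have h2 := Submodule.add_mem _ (hmono _ _ ht.le h1) (hmem t s ht (a • θ _ l))
      simpa using h2
    | zero => simp
    | add x y _ _ hx hy => rw [smul_add]; exact Submodule.add_mem _ hx hy
    | smul c x _ hx => rw [smul_algebra_smul_comm]; exact Submodule.smul_mem _ _ hx
  -- The elements that commute with the `f t` up to lower layers form a subalgebra; closure under
  -- products needs `stable`. Hence it is enough to test the generators in `G`.
  have act : ∀ a : A, ∀ t y, a • f t y - f t (a • y) ∈ lowerSpan K w t.val := by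
    intro a
    have ha : a ∈ Algebra.adjoin K G := by rw [hG]; trivial
    induction ha using Algebra.adjoin_induction with
    | mem g hg =>
      intro t y
      have hy : y = ∑ l, (θ (lab t)).repr y l • θ (lab t) l := ((θ (lab t)).sum_repr y).symm
      rw [hy]
      simp only [map_sum, Finset.smul_sum, ← Finset.sum_sub_distrib]
      refine Submodule.sum_mem _ fun l _ => ?_
      rw [smul_algebra_smul_comm, map_smul, map_smul, smul_algebra_smul_comm, ← smul_sub]
      refine Submodule.smul_mem _ _ ?_
      rw [hf, hf']
      exact h g hg t l
    | algebraMap c =>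
      intro t y
      simp [algebraMap_smul]
    | add a b _ _ ha hb =>
      intro t y
      have := Submodule.add_mem _ (ha t y) (hb t y)
      simp only [add_smul, map_add]
      convert this using 1
      abel
    | mul a b _ _ ha hb =>
      intro t y
      have h1 := stable a ha _ _ (hb t y)
      have h2 := ha t (b • y)
      have := Submodule.add_mem _ h1 h2
      simp only [mul_smul]
      convert this using 1
      rw [smul_sub]; abel
  let L : ℕ → Submodule A M := fun s =>
    { carrier := lowerSpan K w s
      add_mem' := fun hx hy => Submodule.add_mem _ hx hy
      zero_mem' := Submodule.zero_mem _
      smul_mem' := fun a x hx => stable a (act a) s x hx }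
  have memL : ∀ s x, x ∈ L s ↔ x ∈ lowerSpan K w s := fun s x => Iff.rfl
  have hLN : ∀ s, L s ≤ N := by
    intro s x hx
    have : x ∈ N.restrictScalars K := by
      rw [hN]
      exact Submodule.span_mono (by rintro x ⟨t', _, l, rfl⟩; exact ⟨⟨t', l⟩,
          rfl⟩) ((memL _ _).1 hx)
    exact this
  -- The K-linear projection to the layer t; it exists because the whole family is independent.
  have hπ : ∀ t : Fin r, ∃ π : M →ₗ[K] Θ (lab t), (∀ l, π (w t l) = θ (lab t) l) ∧
      ∀ t' ≠ t, ∀ l, π (w t' l) = 0 := by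
    intro t
    obtain ⟨g, hg⟩ := exists_linearMap_of_linearIndependent hli
      (fun x => if h : x.1 = t then θ (lab t) (h ▸ x.2) else 0)
    refine ⟨g, fun l => by simpa using hg ⟨t, l⟩, fun t' ht' l => by simpa [ht'] using hg ⟨t', l⟩⟩
  have split : ∀ t : Fin r, ∀ x ∈ lowerSpan K w (t.val + 1), ∃ y, x - f t y ∈ lowerSpan K w t := by
    intro t x hx
    induction hx using Submodule.span_induction with
    | mem x hx =>
      obtain ⟨t', ht', l, rfl⟩ := hx
      rcases Nat.lt_succ_iff_lt_or_eq.1 ht' with h1 | h1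
      · exact ⟨0, by
          rw [map_zero, sub_zero]; exact Submodule.subset_span ⟨t', h1, l, rfl⟩⟩
      · obtain rfl : t' = t := Fin.ext h1
        exact ⟨θ _ l, by simp [hf]⟩
    | zero => exact ⟨0, by simp⟩
    | add x y _ _ hx hy =>
      obtain ⟨a, ha⟩ := hx
      obtain ⟨b, hb⟩ := hy
      refine ⟨a + b, ?_⟩
      rw [map_add, add_sub_add_comm]
      exact Submodule.add_mem _ ha hb
    | smul c x _ hx =>
      obtain ⟨a, ha⟩ := hx
      refine ⟨c • a, ?_⟩
      rw [map_smul, ← smul_sub]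
      exact Submodule.smul_mem _ _ ha
  -- Labels of a filtration are indexed by ℕ; the values from `r` on play no role.
  obtain ⟨lab', hlab⟩ : ∃ lab' : ℕ → ι, ∀ t : Fin r, lab' t = lab t :=
    ⟨fun s => if hs : s < r then lab ⟨s, hs⟩ else Classical.arbitrary ι, fun t => by simp⟩
  refine ⟨r, fun s => (L s).submoduleOf N, lab', ?_, ?_, ?_, ?_⟩
  · ext x
    have h0 : lowerSpan K w 0 = ⊥ := by simp [lowerSpan]
    change (x : M) ∈ lowerSpan K w 0 ↔ _
    rw [h0]
    simp
  · ext x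
    change (x : M) ∈ lowerSpan K w r ↔ _
    have hx : (x : M) ∈ N.restrictScalars K := x.2
    rw [hN] at hx
    simp only [Submodule.mem_top, iff_true]
    refine Submodule.span_mono ?_ hx
    rintro _ ⟨⟨t, l⟩, rfl⟩
    exact ⟨t, t.2, l, rfl⟩
  · intro s hs
    refine ⟨fun x hx => hmono s (s + 1) (by omega) hx, ?_⟩
    rw [show lab' s = lab ⟨s, hs⟩ from hlab ⟨s, hs⟩]
    obtain ⟨π, hπ1, hπ2⟩ := hπ ⟨s, hs⟩
    have hπf : ∀ y, π (f ⟨s, hs⟩ y) = y := fun y => by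
      rw [hf']
      simp only [map_sum, map_smul, hπ1]
      exact (θ _).sum_repr y
    have hπ0 : ∀ x ∈ lowerSpan K w s, π x = 0 := by
      intro x hx
      induction hx using Submodule.span_induction with
      | mem x hx =>
        obtain ⟨t', ht', l, rfl⟩ := hx
        exact hπ2 t' (by rintro rfl; simp at ht') l
      | zero => simp
      | add x y _ _ hx hy => simp [hx, hy]
      | smul c x _ hx => simp [hx]
    have hπs : ∀ x ∈ lowerSpan K w (s + 1), x - f ⟨s, hs⟩ (π x) ∈ lowerSpan K w s := by
      intro x hx
      obtain ⟨y, hy⟩ := split ⟨s, hs⟩ x hx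
      have h1 := hπ0 _ hy
      rw [map_sub, hπf, sub_eq_zero] at h1
      rw [h1]
      exact hy
    -- Globally π is only K-linear. On `L (s + 1)` it is A-linear, since there x differs from `f (π
    -- x)` by lower layers, which are stable and killed by π.
    let φ : (L (s + 1)).submoduleOf N →ₗ[A] Θ (lab ⟨s, hs⟩) :=
      { toFun := fun x => π x
        map_add' := fun x y => by simp
        map_smul' := fun a x => by
          have h1 := stable a (act a) s _ (hπs x x.2)
          have h2 := hπ0 _ (Submodule.add_mem _ h1 (act a ⟨s, hs⟩ (π x)))
          rw [smul_sub, sub_add_sub_cancel, map_sub, hπf, sub_eq_zero] at h2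
          exact h2 }
    have hφ : Function.Surjective φ := fun y =>
      ⟨⟨⟨f ⟨s, hs⟩ y, hLN _ (hmem ⟨s, hs⟩ (s + 1) (Nat.lt_succ_self s) y)⟩,
        hmem ⟨s, hs⟩ (s + 1) (Nat.lt_succ_self s) y⟩, hπf y⟩
    have hker : ((L s).submoduleOf N).submoduleOf ((L (s + 1)).submoduleOf N) =
        LinearMap.ker φ := by
      ext x
      rw [LinearMap.mem_ker]
      change (x : M) ∈ lowerSpan K w s ↔ π x = 0
      refine ⟨hπ0 _, fun hx => ?_⟩
      have := hπs x x.2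
      rwa [hx, map_zero, sub_zero] at this
    exact ⟨(Submodule.quotEquivOfEq _ _ hker).trans (φ.quotKerEquivOfSurjective hφ)⟩
  · intro k
    change {t | lab t = k}.ncard = _
    rw [← Set.ncard_image_of_injective _ Fin.val_injective]
    congr 1
    ext s
    constructor
    · rintro ⟨t, ht, rfl⟩
      exact ⟨t.2, (hlab t).trans ht⟩
    · rintro ⟨hs, ht⟩
      exact ⟨⟨s, hs⟩, (hlab ⟨s, hs⟩).symm.trans ht, rfl⟩

theorem mult_eq_card {ι : Type*} (e : ι → A) {M : Type*} [AddCommGroup M] [Module K M] [Module A M]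
    [IsScalarTower K A M] {κ : Type*} [Fintype κ] (w : Module.Basis κ K M) (wt : κ → ι) (j : ι)
    (h : ∀ x, wt x = j → e j • w x = w x) (h' : ∀ x, wt x ≠ j → e j • w x = 0) :
    mult K e M j = {x | wt x = j}.ncard := by
  classical
  have h1 : LinearMap.range (Algebra.lsmul K K M (e j) : M →ₗ[K] M) =
      Submodule.span K (Set.range fun x : {x | wt x = j} => w x) := by
    apply le_antisymm
    · rintro _ ⟨m, rfl⟩
      rw [← w.sum_repr m]
      simp only [map_sum, map_smul]
      refine Submodule.sum_mem _ fun x _ => Submodule.smul_mem _ _ ?_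
      by_cases hx : wt x = j
      · simp only [Algebra.lsmul_coe, h x hx]
        exact Submodule.subset_span ⟨⟨x, hx⟩, rfl⟩
      · simp [h' x hx]
    · rw [Submodule.span_le]
      rintro _ ⟨⟨x, hx⟩, rfl⟩
      exact ⟨w x, h x hx⟩
  have h2 := finrank_span_eq_card (w.linearIndependent.comp _
    (Subtype.val_injective (p := fun x => wt x = j)))
  rw [mult, h1]
  refine h2.trans ?_
  rw [← Nat.card_eq_fintype_card]
  exact Nat.card_coe_set_eq _

end Filtrations
end OneQH

namespace OneQH

/-! ### Triangular bases: coordinates and products -/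

section Triangular

variable {K : Type*} [Field K] {A : Type*} [Ring A] [Algebra K A] {ι : Type*} [Fintype ι]
  [PartialOrder ι]

/-- A `K`-basis of `A` that consists of elements `p j k i ∈ e_j A e_i`, one for each `k ≥ i, j`,
whose products `p m l j * p j k i` are combinations of the `p m r i` with `r ≥ k, l`; the
coefficients are independent of `i` and `m`. -/
structure TriangularBasis (K : Type*) [Field K] {A : Type*} [Ring A] [Algebra K A] {ι : Type*}
    [Fintype ι] [PartialOrder ι] (e : ι → A) where
  p : ι → ι → ι → A
  γ : ι → ι → ι → ι → K
  linInd : LinearIndependent K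
    (fun x : {x : ι × ι × ι // x.1 ≤ x.2.1 ∧ x.2.2 ≤ x.2.1} => p x.1.1 x.1.2.1 x.1.2.2)
  span : ⊤ ≤ Submodule.span K (Set.range
    (fun x : {x : ι × ι × ι // x.1 ≤ x.2.1 ∧ x.2.2 ≤ x.2.1} => p x.1.1 x.1.2.1 x.1.2.2))
  p_self : ∀ i, p i i i = e i
  mul_p : ∀ {m l j k i}, m ≤ l → j ≤ l → j ≤ k → i ≤ k →
    p m l j * p j k i = ∑ r, γ l j k r • p m r i
  mul_p_ne : ∀ {m l j j' k i}, m ≤ l → j ≤ l → j' ≤ k → i ≤ k → j ≠ j' → p m l j * p j' k i = 0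
  γ_ge : ∀ {l j k r}, j ≤ l → j ≤ k → γ l j k r ≠ 0 → l ≤ r ∧ k ≤ r
  γ_left_ne : ∀ {j k r}, j ≤ k → r ≠ k → γ j j k r = 0
  γ_left : ∀ {j k}, j ≤ k → γ j j k k = 1
  γ_right_ne : ∀ {j k r}, j ≤ k → r ≠ k → γ k j j r = 0
  γ_right : ∀ {j k}, j ≤ k → γ k j j k = 1
  -- If one factor passes through a level strictly above `j`, the product has no component at the
  -- level of the other factor. Together with `γ_ge` this means that the level goes strictly up.
  γ_lt_left : ∀ {l j k}, j ≤ l → j < k → γ l j k l = 0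
  γ_lt_right : ∀ {l j k}, j < l → j ≤ k → γ l j k k = 0

namespace TriangularBasis

variable {e : ι → A} (D : TriangularBasis K e)

/-- The elements `p j k i` as a basis. -/
noncomputable def basis : Module.Basis {x : ι × ι × ι // x.1 ≤ x.2.1 ∧ x.2.2 ≤ x.2.1} K A :=
  Module.Basis.mk D.linInd D.span

theorem basis_apply {j k i : ι} (hj : j ≤ k) (hi : i ≤ k) :
    D.basis ⟨(j, k, i), hj, hi⟩ = D.p j k i := Module.Basis.mk_apply _ _ _

open Classical in
/-- The coefficient of `p j k i`. -/
noncomputable def coeff (j k i : ι) : A →ₗ[K] K :=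
  if h : j ≤ k ∧ i ≤ k then D.basis.coord ⟨(j, k, i), h⟩ else 0

open Classical in
theorem coeff_p {j k i : ι} (hj : j ≤ k) (hi : i ≤ k) (j' k' i' : ι) :
    D.coeff j' k' i' (D.p j k i) = if j' = j ∧ k' = k ∧ i' = i then 1 else 0 := by
  rw [coeff, ← D.basis_apply hj hi]
  split_ifs with h1 h2 h2
  · obtain ⟨rfl, rfl, rfl⟩ := h2
    simp
  · rw [Module.Basis.coord_apply, Module.Basis.repr_self, Finsupp.single_apply, if_neg]
    intro h3
    apply h2
    simp only [Subtype.mk.injEq, Prod.mk.injEq] at h3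
    exact ⟨h3.1.symm, h3.2.1.symm, h3.2.2.symm⟩
  · obtain ⟨rfl, rfl, rfl⟩ := h2
    exact (h1 ⟨hj, hi⟩).elim
  · rfl

theorem coeff_p_self {j k i : ι} (hj : j ≤ k) (hi : i ≤ k) :
    D.coeff j k i (D.p j k i) = 1 := by
  simp [D.coeff_p hj hi]

theorem coeff_of_not {j k i : ι} (h : ¬ (j ≤ k ∧ i ≤ k)) (a : A) : D.coeff j k i a = 0 := by
  simp [coeff, h]

theorem le_of_coeff_ne {j k i : ι} {a : A} (h : D.coeff j k i a ≠ 0) : j ≤ k ∧ i ≤ k := by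
  by_contra h1
  exact h (D.coeff_of_not h1 a)

theorem ext_coeff {a b : A} (h : ∀ j k i, D.coeff j k i a = D.coeff j k i b) : a = b := by
  apply D.basis.ext_elem
  rintro ⟨⟨j, k, i⟩, hx⟩
  have := h j k i
  simp only [coeff, hx, and_self, dif_pos] at this
  exact this

/-- Induction over the basis elements. -/
theorem induction_on {Q : A → Prop} (a : A) (zero : Q 0) (add : ∀ a b, Q a → Q b → Q (a + b))
    (smul : ∀ (c : K) a, Q a → Q (c • a)) (hp : ∀ j k i, j ≤ k → i ≤ k → Q (D.p j k i)) : Q a := by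
  have ha := D.span (Submodule.mem_top (x := a))
  induction ha using Submodule.span_induction with
  | mem x hx => obtain ⟨⟨⟨j, k, i⟩, hj, hi⟩, rfl⟩ := hx; exact hp j k i hj hi
  | zero => exact zero
  | add x y _ _ hx hy => exact add x y hx hy
  | smul c x _ hx => exact smul c x hx

/-- The function `p` is total, but its values off the range `m, i ≤ r` are unspecified; by `γ_ge`
such values never enter a product. -/
theorem smul_p_of_ne {m l j k r i : ι} (hm : m ≤ l) (hj : j ≤ l) (hk : j ≤ k) (hi : i ≤ k)
    (h : ¬ (m ≤ r ∧ i ≤ r)) : D.γ l j k r = 0 := by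
  by_contra h1
  have := D.γ_ge hj hk h1
  exact h ⟨hm.trans this.1, hi.trans this.2⟩

-- Later arguments compare coefficients instead of elements, and this formula for left
-- multiplication is the one they rely on.
open Classical in
theorem coeff_p_mul {m l j : ι} (hm : m ≤ l) (hj : j ≤ l) (m' r i : ι) (a : A) :
    D.coeff m' r i (D.p m l j * a) =
      if m' = m then ∑ k, D.γ l j k r * D.coeff j k i a else 0 := by
  induction a using D.induction_on with
  | zero => simp
  | add a b ha hb => rw [mul_add, map_add, ha, hb]; split_ifs <;> simp [mul_add,
      Finset.sum_add_distrib]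
  | smul c a ha =>
    rw [mul_smul_comm, map_smul, ha]
    split_ifs
    · simp only [map_smul, smul_eq_mul, Finset.mul_sum]
      exact Finset.sum_congr rfl fun _ _ => by ring
    · simp
  | hp j' k i' hj' hi' =>
    by_cases h : j = j'
    · subst h
      rw [D.mul_p hm hj hj' hi', map_sum]
      simp only [map_smul, smul_eq_mul, D.coeff_p hj' hi']
      have : ∀ x, D.γ l j k x * D.coeff m' r i (D.p m x i') =
          if x = r then (if m' = m ∧ i = i' then D.γ l j k r else 0) else 0 := by
        intro x
        by_cases hx : m ≤ x ∧ i' ≤ x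
        · rw [D.coeff_p hx.1 hx.2]
          by_cases h1 : x = r
          · subst h1; simp
          · simp [h1, Ne.symm h1]
        · rw [D.smul_p_of_ne hm hj hj' hi' hx]
          split_ifs with h1
          · subst h1; simp [D.smul_p_of_ne hm hj hj' hi' hx]
          · simp
          · simp
      simp only [this, Finset.sum_ite_eq', Finset.mem_univ, if_true]
      by_cases h1 : m' = m <;> by_cases h2 : i = i' <;> simp [h1, h2]
    · rw [D.mul_p_ne hm hj hj' hi' h, map_zero]
      simp [D.coeff_p hj' hi', h]

open Classical in
theorem coeff_mul_p {j k i : ι} (hj : j ≤ k) (hi : i ≤ k) (m r i' : ι) (a : A) :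
    D.coeff m r i' (a * D.p j k i) =
      if i' = i then ∑ l, D.γ l j k r * D.coeff m l j a else 0 := by
  induction a using D.induction_on with
  | zero => simp
  | add a b ha hb => rw [add_mul, map_add, ha, hb]; split_ifs <;> simp [mul_add,
      Finset.sum_add_distrib]
  | smul c a ha =>
    rw [smul_mul_assoc, map_smul, ha]
    split_ifs
    · simp only [map_smul, smul_eq_mul, Finset.mul_sum]
      exact Finset.sum_congr rfl fun _ _ => by ring
    · simp
  | hp m' l j' hm' hj' =>
    rw [D.coeff_p_mul hm' hj']
    by_cases h3 : j' = j
    · subst h3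
      by_cases h : m = m' <;> by_cases h2 : i' = i <;>
        simp [h, h2, D.coeff_p hm' hj', D.coeff_p hj hi]
    · simp [Ne.symm h3, D.coeff_p hm' hj', D.coeff_p hj hi, h3]

theorem p_mul_p_self {j k i : ι} (hj : j ≤ k) (hi : i ≤ k) : D.p j k k * D.p k k i = D.p j k i := by
  rw [D.mul_p hj le_rfl le_rfl hi, Finset.sum_eq_single k]
  · rw [D.γ_left le_rfl, one_smul]
  · intro r _ hr; rw [D.γ_left_ne le_rfl hr, zero_smul]
  · simp

open Classical in
theorem coeff_e_mul (i m r j : ι) (a : A) :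
    D.coeff m r j (e i * a) = if m = i then D.coeff m r j a else 0 := by
  rw [← D.p_self, D.coeff_p_mul le_rfl le_rfl]
  split_ifs with h
  · subst h
    rw [Finset.sum_eq_single r]
    · by_cases h1 : m ≤ r
      · rw [D.γ_left h1, one_mul]
      · rw [D.coeff_of_not (by tauto), mul_zero]
    · intro k _ hk
      by_cases h1 : m ≤ k
      · rw [D.γ_left_ne h1 hk.symm, zero_mul]
      · rw [D.coeff_of_not (by tauto), mul_zero]
    · simp
  · rfl

open Classical in
theorem coeff_mul_e (i m r j : ι) (a : A) :
    D.coeff m r j (a * e i) = if j = i then D.coeff m r j a else 0 := by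
  rw [← D.p_self, D.coeff_mul_p le_rfl le_rfl]
  split_ifs with h
  · subst h
    rw [Finset.sum_eq_single r]
    · by_cases h1 : j ≤ r
      · rw [D.γ_right h1, one_mul]
      · rw [D.coeff_of_not (by tauto), mul_zero]
    · intro k _ hk
      by_cases h1 : j ≤ k
      · rw [D.γ_right_ne h1 hk.symm, zero_mul]
      · rw [D.coeff_of_not (by tauto), mul_zero]
    · simp
  · rfl

theorem e_mul_p {j k i : ι} (hj : j ≤ k) (hi : i ≤ k) : e j * D.p j k i = D.p j k i := by
  classical
  refine D.ext_coeff fun a b c => ?_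
  rw [D.coeff_e_mul, D.coeff_p hj hi]
  by_cases h : a = j <;> simp [h]

theorem p_mul_e {j k i : ι} (hj : j ≤ k) (hi : i ≤ k) : D.p j k i * e i = D.p j k i := by
  classical
  refine D.ext_coeff fun a b c => ?_
  rw [D.coeff_mul_e, D.coeff_p hj hi]
  by_cases h : c = i <;> simp [h]

include D in
theorem completeOrthogonalIdempotents : CompleteOrthogonalIdempotents e := by
  classical
  refine ⟨⟨fun i => ?_, fun i j hij => ?_⟩, ?_⟩
  · refine D.ext_coeff fun a b c => ?_
    rw [D.coeff_e_mul, ← D.p_self, D.coeff_p le_rfl le_rfl]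
    by_cases h : a = i <;> simp [h]
  · refine D.ext_coeff fun a b c => ?_
    rw [D.coeff_e_mul, ← D.p_self j, D.coeff_p le_rfl le_rfl, map_zero]
    by_cases h : a = i
    · subst h; simp [hij]
    · simp [h]
  · refine D.ext_coeff fun a b c => ?_
    rw [← mul_one (∑ i, e i), Finset.sum_mul, map_sum]
    simp only [D.coeff_e_mul]
    simp

theorem mem_P {i : ι} {a : A} : a ∈ P e i ↔ ∀ m l j, j ≠ i → D.coeff m l j a = 0 := by
  classical
  rw [Submodule.mem_span_singleton]
  constructor
  · rintro ⟨b, rfl⟩ m l j hj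
    rw [smul_eq_mul, D.coeff_mul_e, if_neg hj]
  · intro h
    refine ⟨a, D.ext_coeff fun m l j => ?_⟩
    rw [smul_eq_mul, D.coeff_mul_e]
    split_ifs with h1
    · rfl
    · rw [h m l j h1]

theorem p_mem_P {j k i : ι} (hj : j ≤ k) (hi : i ≤ k) : D.p j k i ∈ P e i :=
  Submodule.mem_span_singleton.2 ⟨D.p j k i, D.p_mul_e hj hi⟩

end TriangularBasis
end Triangular
end OneQH

namespace OneQH

/-! ### Simple, projective and standard modules of a triangular basis -/

section Triangular

theorem e_mem_P {A : Type*} [Ring A] {ι : Type*} (e : ι → A) (i : ι) : e i ∈ P e i :=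
  Submodule.mem_span_singleton_self _

variable {K : Type*} [Field K] {A : Type*} [Ring A] [Algebra K A] {ι : Type*} [Fintype ι]
  [PartialOrder ι]

namespace TriangularBasis

variable {e : ι → A} (D : TriangularBasis K e)

include D in
theorem e_mul_self (i : ι) : e i * e i = e i := D.completeOrthogonalIdempotents.idem i

include D in
theorem e_mul_ne {i j : ι} (h : i ≠ j) : e i * e j = 0 := D.completeOrthogonalIdempotents.ortho h

/-- The ideal generated by the element `p j l i` with maximal `l`. -/
theorem coeff_p_mul_self {i j l : ι} (hj : j ≤ l) (hi : i ≤ l) (x : A) :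
    D.coeff j l i (D.p j l i * x) = D.coeff i i i x := by
  classical
  rw [D.coeff_p_mul hj hi, if_pos rfl, Finset.sum_eq_single i]
  · rw [D.γ_right hi, one_mul]
  · intro k _ hk
    by_cases h : i ≤ k
    · rw [D.γ_lt_left hi (lt_of_le_of_ne h (Ne.symm hk)), zero_mul]
    · rw [D.coeff_of_not (by tauto), mul_zero]
  · simp

/-- By `γ_ge`, a product lives at levels above those of both factors. This lemma bounds the level by
that of the left factor, the next one by those of the right factor. -/
theorem ge_of_coeff_p_mul_ne {i m l j r i' : ι} (hm : m ≤ l) (hj : j ≤ l) {x : A}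
    (h : D.coeff i r i' (D.p m l j * x) ≠ 0) : i = m ∧ l ≤ r := by
  classical
  rw [D.coeff_p_mul hm hj] at h
  split_ifs at h with h1
  · refine ⟨h1, ?_⟩
    obtain ⟨k, _, hk⟩ := Finset.exists_ne_zero_of_sum_ne_zero h
    have h2 := D.le_of_coeff_ne (right_ne_zero_of_mul hk)
    exact (D.γ_ge hj h2.1 (left_ne_zero_of_mul hk)).1
  · exact (h rfl).elim

theorem ge_of_coeff_p_mul_ne' {i m l j r i' : ι} (hm : m ≤ l) (hj : j ≤ l) {x : A}
    (h : D.coeff i r i' (D.p m l j * x) ≠ 0) : ∃ k, k ≤ r ∧ D.coeff j k i' x ≠ 0 ∧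
      D.γ l j k r ≠ 0 := by
  classical
  rw [D.coeff_p_mul hm hj] at h
  split_ifs at h with h1
  · obtain ⟨k, _, hk⟩ := Finset.exists_ne_zero_of_sum_ne_zero h
    have h2 := D.le_of_coeff_ne (right_ne_zero_of_mul hk)
    exact ⟨k, (D.γ_ge hj h2.1 (left_ne_zero_of_mul hk)).2, right_ne_zero_of_mul hk,
      left_ne_zero_of_mul hk⟩
  · exact (h rfl).elim

/-- Every element of `A` is the sum of its components. -/
theorem sum_coeff (a : A) : ∑ j, ∑ k, ∑ i, D.coeff j k i a • D.p j k i = a := by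
  classical
  refine D.ext_coeff fun j' k' i' => ?_
  simp only [map_sum, map_smul, smul_eq_mul]
  have : ∀ j k i, D.coeff j k i a * D.coeff j' k' i' (D.p j k i) =
      if j = j' then if k = k' then if i = i' then D.coeff j' k' i' a else 0 else 0 else 0 := by
    intro j k i
    by_cases h : j ≤ k ∧ i ≤ k
    · rw [D.coeff_p h.1 h.2]
      simp only [eq_comm (a := j'), eq_comm (a := k'), eq_comm (a := i')]
      by_cases h1 : j = j' <;> by_cases h2 : k = k' <;> by_cases h3 : i = i' <;>
        simp [h1, h2, h3]
    · rw [D.coeff_of_not h, zero_mul]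
      split_ifs with h1 h2 h3
      · subst h1 h2 h3; rw [D.coeff_of_not h]
      all_goals rfl
  simp [this]

theorem sum_coeff_P {i : ι} {a : A} (ha : a ∈ P e i) :
    ∑ j, ∑ k, D.coeff j k i a • D.p j k i = a := by
  conv_rhs => rw [← D.sum_coeff a]
  refine Finset.sum_congr rfl fun j _ => Finset.sum_congr rfl fun k _ => ?_
  rw [Finset.sum_eq_single i]
  · intro l _ hl
    rw [D.mem_P.1 ha _ _ _ hl, zero_smul]
  · simp

include D in
/-- An element of `P(i)` outside the radical generates `P(i)`. -/
theorem e_mem_span {i : ι} {x : A} (hx : x ∈ P e i) (h : D.coeff i i i x ≠ 0) :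
    e i ∈ Submodule.span A {x} := by
  classical
  -- Descending induction on the level: `p j l i * x` is a nonzero multiple of `p j l i` plus terms
  -- of higher level, which are already in the span.
  have key : ∀ l, i ≤ l → ∀ j ≤ l, D.p j l i ∈ Submodule.span A {x} := by
    intro l
    induction l using WellFoundedGT.induction with
    | ind l ih =>
      intro hi j hj
      have h1 : D.p j l i * x ∈ Submodule.span A {x} :=
        Submodule.smul_mem _ _ (Submodule.mem_span_singleton_self x)
      have h2 : D.p j l i * x ∈ P e i := Submodule.smul_mem _ _ hx
      rw [← D.sum_coeff_P h2, Finset.sum_eq_single j, ← Finset.add_sum_erase _ _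
        (Finset.mem_univ l), D.coeff_p_mul_self hj hi] at h1
      · have h3 : ∑ k ∈ Finset.univ.erase l, D.coeff j k i (D.p j l i * x) • D.p j k i ∈
            (Submodule.span A {x}).restrictScalars K := by
          refine Submodule.sum_mem _ fun k hk => ?_
          by_cases h4 : D.coeff j k i (D.p j l i * x) = 0
          · rw [h4, zero_smul]; exact Submodule.zero_mem _
          · have h5 := D.ge_of_coeff_p_mul_ne hj hi h4
            have h6 := D.le_of_coeff_ne h4
            have h7 : k ≠ l := by simpa using hk
            exact Submodule.smul_mem _ _ (ih k (lt_of_le_of_ne h5.2 h7.symm) h6.2 j h6.1)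
        have h4 := (Submodule.add_mem_iff_left _ h3).1 h1
        exact (Submodule.smul_mem_iff ((Submodule.span A {x}).restrictScalars K) h).1 h4
      · intro j' _ hj'
        refine Finset.sum_eq_zero fun k _ => ?_
        by_cases h4 : D.coeff j' k i (D.p j l i * x) = 0
        · rw [h4, zero_smul]
        · exact (hj' (D.ge_of_coeff_p_mul_ne hj hi h4).1).elim
      · simp
  rw [← D.p_self]
  exact key i le_rfl i le_rfl

/-- The radical of `P(i)`. -/
def radP (i : ι) : Submodule A (P e i) where
  carrier := {x | D.coeff i i i x = 0}
  add_mem' {x y} hx hy := by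
    have hx' : D.coeff i i i x = 0 := hx
    have hy' : D.coeff i i i y = 0 := hy
    simp [hx', hy']
  zero_mem' := by simp
  smul_mem' a x hx := by
    have hx' : D.coeff i i i x = 0 := hx
    change D.coeff i i i (a * x) = 0
    induction a using D.induction_on with
    | zero => simp
    | add a b ha hb => rw [add_mul, map_add, ha, hb, add_zero]
    | smul c a ha => rw [smul_mul_assoc, map_smul, ha, smul_zero]
    | hp m l j hm hj =>
      -- A nonzero coefficient forces m = l = k = i. Then either j = i, and the coefficient of x
      -- itself is nonzero, or j < i, which `γ_lt_left` excludes.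
      by_contra h
      obtain ⟨rfl, h2⟩ := D.ge_of_coeff_p_mul_ne hm hj h
      obtain rfl := le_antisymm hm h2
      obtain ⟨k, hk, hc, hγ⟩ := D.ge_of_coeff_p_mul_ne' hm hj h
      have h3 := D.le_of_coeff_ne hc
      obtain rfl := le_antisymm hk h3.2
      rcases eq_or_lt_of_le hj with h4 | h4
      · subst h4; exact hc hx'
      · exact hγ (D.γ_lt_left hj h4)

theorem mem_radP {i : ι} {x : P e i} : x ∈ D.radP i ↔ D.coeff i i i x = 0 := Iff.rfl

theorem coeff_e (i : ι) : D.coeff i i i (e i) = 1 := by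
  rw [← D.p_self, D.coeff_p_self le_rfl le_rfl]

/-- An element outside `radP` generates P(i) by `e_mem_span`; thus P(i) is local. -/
theorem le_radP {i : ι} {N : Submodule A (P e i)} (hN : N ≠ ⊤) : N ≤ D.radP i := by
  intro x hx
  by_contra h
  apply hN
  obtain ⟨a, ha⟩ := Submodule.mem_span_singleton.1 (D.e_mem_span x.2 h)
  rw [eq_top_iff]
  rintro ⟨y, hy⟩ -
  obtain ⟨b, hb⟩ := Submodule.mem_span_singleton.1 hy
  have : (⟨y, hy⟩ : P e i) = b • a • x := by
    apply Subtype.ext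
    change y = b • a • (x : A)
    rw [ha, hb]
  rw [this]
  exact N.smul_mem _ (N.smul_mem _ hx)

theorem radP_ne_top (i : ι) : D.radP i ≠ ⊤ := by
  intro h
  have h1 : (⟨e i, e_mem_P e i⟩ : P e i) ∈ D.radP i := h ▸ Submodule.mem_top
  rw [D.mem_radP, D.coeff_e] at h1
  exact one_ne_zero h1

theorem isCoatom_radP (i : ι) : IsCoatom (D.radP i) := by
  refine ⟨D.radP_ne_top i, fun N hN => ?_⟩
  by_contra h
  exact absurd (D.le_radP h) (not_le_of_gt hN)

theorem jacobson_P (i : ι) : Module.jacobson A (P e i) = D.radP i := by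
  apply le_antisymm
  · exact sInf_le (D.isCoatom_radP i)
  · refine le_sInf fun N hN => ?_
    have h1 := D.le_radP hN.1
    rcases eq_or_lt_of_le h1 with h2 | h2
    · exact h2.ge
    · exact absurd (hN.2 _ h2) (D.radP_ne_top i)

include D in
theorem isSimpleModule_S (i : ι) : IsSimpleModule A (S e i) := by
  rw [isSimpleModule_iff_isCoatom, D.jacobson_P]
  exact D.isCoatom_radP i

-- Non-isomorphism of different simple modules: e_i fixes the class of e_i in S(i) and annihilates
-- S(j) for j ≠ i.
include D in
theorem isBasicAlgebra : IsBasicAlgebra K e := by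
  classical
  refine ⟨Module.Finite.of_basis D.basis, D.completeOrthogonalIdempotents, D.isSimpleModule_S,
    fun i j ⟨f⟩ => ?_⟩
  by_contra hij
  let y : S e i := Submodule.Quotient.mk ⟨e i, e_mem_P e i⟩
  have hy : e i • y = y := by
    change Submodule.Quotient.mk (e i • (⟨e i, e_mem_P e i⟩ : P e i)) = _
    congr 1
    exact Subtype.ext (D.e_mul_self i)
  have hz : ∀ z : S e j, e i • z = 0 := by
    intro z
    obtain ⟨z, rfl⟩ := Submodule.Quotient.mk_surjective _ z
    rw [← Submodule.Quotient.mk_smul, Submodule.Quotient.mk_eq_zero, D.jacobson_P, D.mem_radP]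
    change D.coeff j j j (e i * z) = 0
    rw [D.coeff_e_mul, if_neg (Ne.symm hij)]
  have h0 : f y = 0 := by rw [← hy, map_smul, hz]
  rw [LinearEquiv.map_eq_zero_iff, Submodule.Quotient.mk_eq_zero, D.jacobson_P, D.mem_radP,
    D.coeff_e] at h0
  exact one_ne_zero h0

/-! ### Standard modules -/

/-- Levels only go up, so the elements without component at level i form a submodule, and it
contains e_k P(i) for all k ≰ i. Conversely, `p j k i` with k ≰ i factors as `p j k k * e k * p k k
i` through the vertex k. -/
theorem mem_kerDelta {i : ι} {x : P e i} :
    x ∈ kerDelta e i ↔ ∀ m, D.coeff m i i x = 0 := by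
  classical
  constructor
  · intro hx
    let N : Submodule A (P e i) :=
      { carrier := {x | ∀ m, D.coeff m i i x = 0}
        add_mem' := fun {x y} hx hy m => by
          have hx' : D.coeff m i i x = 0 := hx m
          have hy' : D.coeff m i i y = 0 := hy m
          simp [hx', hy']
        zero_mem' := by simp
        smul_mem' := fun a x hx => by
          have hx' : ∀ m, D.coeff m i i x = 0 := hx
          intro m'
          change D.coeff m' i i (a * x) = 0
          induction a using D.induction_on with
          | zero => simp
          | add a b ha hb => rw [add_mul, map_add, ha, hb, add_zero]
          | smul c a ha => rw [smul_mul_assoc, map_smul, ha, smul_zero]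
          | hp m l j hm hj =>
            by_contra h
            obtain ⟨k, hk, hc, hγ⟩ := D.ge_of_coeff_p_mul_ne' hm hj h
            have h3 := D.le_of_coeff_ne hc
            obtain rfl := le_antisymm hk h3.2
            exact hc (hx' j) }
    have hN : kerDelta e i ≤ N := by
      refine sInf_le fun k hk x m => ?_
      change D.coeff m i i (e k * x) = 0
      rw [D.coeff_e_mul]
      split_ifs with h
      · subst h; exact D.coeff_of_not (by tauto) _
      · rfl
    exact hN hx
  · intro hx
    rw [kerDelta, Submodule.mem_sInf]
    intro N hN
    have h1 : (x : A) ∈ (N.map (P e i).subtype).restrictScalars K := by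
      rw [← D.sum_coeff_P x.2]
      refine Submodule.sum_mem _ fun j _ => Submodule.sum_mem _ fun k _ => ?_
      by_cases hc : D.coeff j k i x = 0
      · rw [hc, zero_smul]; exact Submodule.zero_mem _
      · have h2 := D.le_of_coeff_ne hc
        have hk : ¬ k ≤ i := by
          intro hk
          obtain rfl := le_antisymm hk h2.2
          exact hc (hx j)
        refine Submodule.smul_mem _ _ ⟨D.p j k k • e k • ⟨D.p k k i, D.p_mem_P le_rfl h2.2⟩,
          N.smul_mem _ (hN k hk _), ?_⟩
        change D.p j k k * (e k * D.p k k i) = _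
        rw [D.e_mul_p le_rfl h2.2, D.p_mul_p_self h2.1 h2.2]
    obtain ⟨y, hy, hxy⟩ := h1
    rwa [← Subtype.ext hxy]

/-- The coordinates on `Δ(i)`. -/
noncomputable def deltaCoord (i : ι) : Delta e i →ₗ[K] ({m : ι // m ≤ i} → K) :=
  ((kerDelta e i).restrictScalars K).liftQ
      (LinearMap.pi fun m : {m : ι // m ≤ i} =>
        D.coeff m.1 i i ∘ₗ (P e i).subtype.restrictScalars K)
      (fun x hx => by
        ext m
        exact D.mem_kerDelta.1 hx m.1) ∘ₗ
    (Submodule.Quotient.restrictScalarsEquiv K (kerDelta e i)).symm.toLinearMap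

theorem deltaCoord_mk (i : ι) (x : P e i) (m : {m : ι // m ≤ i}) :
    D.deltaCoord i (Submodule.Quotient.mk x) m = D.coeff m.1 i i x := rfl

theorem deltaCoord_bijective (i : ι) : Function.Bijective (D.deltaCoord i) := by
  classical
  constructor
  · rw [injective_iff_map_eq_zero]
    intro y hy
    obtain ⟨x, rfl⟩ := Submodule.Quotient.mk_surjective _ y
    rw [Submodule.Quotient.mk_eq_zero, D.mem_kerDelta]
    intro m
    by_cases hm : m ≤ i
    · rw [← D.deltaCoord_mk i x ⟨m, hm⟩, hy]; rfl
    · exact D.coeff_of_not (by tauto) _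
  · intro v
    refine ⟨Submodule.Quotient.mk (∑ m : {m : ι // m ≤ i}, v m •
      ⟨D.p m.1 i i, D.p_mem_P m.2 le_rfl⟩), ?_⟩
    ext m
    rw [D.deltaCoord_mk]
    have : ∀ x : {m : ι // m ≤ i}, v x * D.coeff m.1 i i (D.p x.1 i i) =
        if x = m then v x else 0 := by
      intro x
      rw [D.coeff_p x.2 le_rfl]
      by_cases h : x = m
      · subst h; simp
      · have h' : ¬ m.1 = x.1 := fun h' => h (Subtype.ext h'.symm)
        simp [h, h']
    simp [this]

/-- The basis of `Δ(i)` that consists of the classes of the `p m i i`. -/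
noncomputable def deltaBasis (i : ι) : Module.Basis {m : ι // m ≤ i} K (Delta e i) :=
  Module.Basis.ofEquivFun (LinearEquiv.ofBijective _ (D.deltaCoord_bijective i))

theorem deltaBasis_repr_mk (i : ι) (x : P e i) (m : {m : ι // m ≤ i}) :
    (D.deltaBasis i).repr (Submodule.Quotient.mk x) m = D.coeff m.1 i i x := rfl

theorem deltaBasis_apply (i : ι) (m : {m : ι // m ≤ i}) :
    D.deltaBasis i m = Submodule.Quotient.mk ⟨D.p m.1 i i, D.p_mem_P m.2 le_rfl⟩ := by
  classical
  apply (D.deltaBasis i).ext_elem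
  intro m'
  rw [Module.Basis.repr_self, D.deltaBasis_repr_mk, D.coeff_p m.2 le_rfl, Finsupp.single_apply]
  by_cases h : m = m'
  · subst h; simp
  · have h' : ¬ m'.1 = m.1 := fun h' => h (Subtype.ext h'.symm)
    simp [h, h']

-- On Δ(k) only the descending paths, those with `l' = m`, act nontrivially: `γ_lt_right` pushes
-- every other product above the level k. A descending path permutes basis vectors with coefficient
-- 1.
open Classical in
theorem deltaBasis_repr_smul {m' l' m : ι} (hm' : m' ≤ l') (hm : m ≤ l') (k : ι)
    (x y : {m : ι // m ≤ k}) : (D.deltaBasis k).repr (D.p m' l' m • D.deltaBasis k x) y =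
      if x.1 = m ∧ l' = m ∧ y.1 = m' then 1 else 0 := by
  rw [D.deltaBasis_apply, ← Submodule.Quotient.mk_smul, D.deltaBasis_repr_mk]
  change D.coeff y.1 k k (D.p m' l' m * D.p x.1 k k) = _
  rw [D.coeff_p_mul hm' hm]
  by_cases h : y.1 = m'
  · rw [if_pos h]
    by_cases h2 : x.1 = m
    · have hmk : m ≤ k := h2 ▸ x.2
      rw [Finset.sum_eq_single k]
      · rw [D.coeff_p x.2 le_rfl]
        by_cases h3 : l' = m
        · subst h3
          rw [D.γ_left hmk]; simp [h, h2]
        · rw [D.γ_lt_right (lt_of_le_of_ne hm (Ne.symm h3)) hmk]; simp [h3]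
      · intro l _ hl
        rw [D.coeff_p x.2 le_rfl]; simp [hl]
      · simp
    · rw [if_neg (by tauto)]
      refine Finset.sum_eq_zero fun l _ => ?_
      rw [D.coeff_p x.2 le_rfl]; simp [Ne.symm h2]
  · simp [h]

include D in
theorem mult_delta (i j : ι) (h : j ≤ i) : mult K e (Delta e i) j = 1 := by
  classical
  have hs : ∀ x : {m : ι // m ≤ i}, e j • D.deltaBasis i x =
      if x.1 = j then D.deltaBasis i x else 0 := by
    intro x
    rw [D.deltaBasis_apply, ← Submodule.Quotient.mk_smul]
    split_ifs with h1
    · congr 1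
      apply Subtype.ext
      change e j * D.p x.1 i i = _
      rw [← h1, D.e_mul_p x.2 le_rfl]
    · rw [Submodule.Quotient.mk_eq_zero, D.mem_kerDelta]
      intro m
      change D.coeff m i i (e j * D.p x.1 i i) = 0
      rw [D.coeff_e_mul, D.coeff_p x.2 le_rfl]
      split_ifs with h2 h3
      · exact (h1 (h3.1.symm.trans h2)).elim
      all_goals rfl
  rw [mult_eq_card e (D.deltaBasis i) (fun x => x.1) j (fun x hx => by rw [hs, if_pos hx])
    (fun x hx => by rw [hs, if_neg hx]), Set.ncard_eq_one]
  refine ⟨⟨j, h⟩, ?_⟩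
  ext x
  simp [Subtype.ext_iff]

end TriangularBasis
end Triangular
end OneQH

namespace OneQH

/-! ### Standard filtrations of the projectives; costandard modules -/

section Triangular

/-- The elements of a finite poset can be listed so that larger elements come first. -/
theorem exists_equiv_fin_antitone (α : Type*) [Fintype α] [PartialOrder α] :
    ∃ (r : ℕ) (f : Fin r ≃ α), ∀ a b, f a < f b → b < a := by
  classical
  let : Fintype (LinearExtension αᵒᵈ) := inferInstanceAs (Fintype α)
  have f : Fin (Fintype.card (LinearExtension αᵒᵈ)) ≃o LinearExtension αᵒᵈ :=
    Fintype.orderIsoFinOfCardEq _ rfl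
  refine ⟨_, f.toEquiv.trans (Equiv.refl α), fun a b h => ?_⟩
  have h1 : (toLinearExtension (OrderDual.toDual (f b : α)) : LinearExtension αᵒᵈ) ≤
      toLinearExtension (OrderDual.toDual (f a : α)) :=
    toLinearExtension.monotone (OrderDual.toDual_le_toDual.2 h.le)
  have h2 : f b ≤ f a := h1
  rcases eq_or_lt_of_le (f.le_iff_le.1 h2) with h3 | h3
  · subst h3; exact absurd h (lt_irrefl _)
  · exact h3

theorem DualReg.ev_sum {K A κ : Type*} [Field K] [Ring A] [Algebra K A] (f : DualReg K A)
    (s : Finset κ) (x : κ → A) : f.ev (∑ i ∈ s, x i) = ∑ i ∈ s, f.ev (x i) :=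
  map_sum (id f : A →ₗ[K] K) x s

variable {K : Type*} [Field K] {A : Type*} [Ring A] [Algebra K A] {ι : Type*} [Fintype ι]
  [PartialOrder ι]

namespace TriangularBasis

variable {e : ι → A} (D : TriangularBasis K e)

theorem adjoin_p : Algebra.adjoin K {a | ∃ m l j, m ≤ l ∧ j ≤ l ∧ a = D.p m l j} = ⊤ := by
  rw [eq_top_iff]
  intro a _
  induction a using D.induction_on with
  | zero => exact Subalgebra.zero_mem _
  | add a b ha hb => exact Subalgebra.add_mem _ (ha trivial) (hb trivial)
  | smul c a ha => exact Subalgebra.smul_mem _ (ha trivial) c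
  | hp m l j hm hj => exact Algebra.subset_adjoin ⟨m, l, j, hm, hj, rfl⟩

-- The vectors `p m k i` with fixed k form a layer isomorphic to Δ(k): the structure constants do
-- not depend on i, so the tail from i to k is carried along passively. Higher levels come first,
-- since multiplication raises the level.
include D in
theorem hasFiltration_P (i : ι) : ∃ d : ι → ℕ, HasFiltration (A := A) (Delta e) (P e i) d ∧
    (∀ k, i ≤ k → d k = 1) ∧ ∀ k, ¬ i ≤ k → d k = 0 := by
  classical
  obtain ⟨r, f, hf⟩ := exists_equiv_fin_antitone {k : ι // i ≤ k}
  have : Nonempty ι := ⟨i⟩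
  refine ⟨_, HasFiltration.of_family (K := K) D.deltaBasis (P e i) (fun t => (f t).1)
    (fun t m => D.p m.1 (f t).1 i) ?_ ?_ _ D.adjoin_p ?_, ?_, ?_⟩
  · let g : (Σ t : Fin r, {m : ι // m ≤ (f t).1}) →
        {x : ι × ι × ι // x.1 ≤ x.2.1 ∧ x.2.2 ≤ x.2.1} :=
      fun x => ⟨(x.2.1, (f x.1).1, i), x.2.2, (f x.1).2⟩
    have hg : Function.Injective g := by
      rintro ⟨t, m, hm⟩ ⟨t', m', hm'⟩ h
      simp only [g, Subtype.mk.injEq, Prod.mk.injEq, and_true] at h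
      obtain ⟨rfl, h⟩ := h
      obtain rfl : t = t' := f.injective (Subtype.ext h)
      rfl
    exact D.linInd.comp g hg
  · apply le_antisymm
    · intro a ha
      have ha' : a ∈ P e i := ha
      rw [← D.sum_coeff_P ha']
      refine Submodule.sum_mem _ fun j _ => Submodule.sum_mem _ fun k _ => ?_
      by_cases h : D.coeff j k i a = 0
      · rw [h, zero_smul]; exact Submodule.zero_mem _
      · have h1 := D.le_of_coeff_ne h
        refine Submodule.smul_mem _ _ (Submodule.subset_span ⟨⟨f.symm ⟨k, h1.2⟩, j, ?_⟩, ?_⟩)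
        · simpa using h1.1
        · simp
    · rw [Submodule.span_le]
      rintro _ ⟨⟨t, m, hm⟩, rfl⟩
      exact D.p_mem_P hm (f t).2
  · rintro _ ⟨m', l', m, hm', hm, rfl⟩ t ⟨x, hx⟩
    simp only [D.deltaBasis_repr_smul hm' hm, smul_eq_mul]
    have lower : ∀ k (hk : (f t).1 < k) (h : m' ≤ k),
        D.p m' k i ∈ lowerSpan K (fun (t : Fin r) (m : {m : ι // m ≤ (f t).1}) =>
          D.p m.1 (f t).1 i) t := by
      intro k hk h
      have hik : i ≤ k := (f t).2.trans hk.le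
      refine Submodule.subset_span ⟨f.symm ⟨k, hik⟩, ?_, ⟨m', by simpa using h⟩, by simp⟩
      have := hf t (f.symm ⟨k, hik⟩) (by rw [Equiv.apply_symm_apply]; exact hk)
      exact this
    by_cases h : x = m
    · subst h
      rw [D.mul_p hm' hm hx (f t).2]
      by_cases h2 : l' = x
      · subst h2
        rw [Finset.sum_eq_single (f t).1, D.γ_left hx, one_smul,
          Finset.sum_eq_single ⟨m', hm'.trans hx⟩]
        · simp
        · intro b _ hb
          rw [if_neg, zero_smul]
          exact fun h => hb (Subtype.ext h.2.2)
        · simp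
        · intro b _ hb; rw [D.γ_left_ne hx hb, zero_smul]
        · simp
      · simp only [h2, false_and, and_false, if_false, zero_smul, Finset.sum_const_zero, sub_zero]
        refine Submodule.sum_mem _ fun k _ => ?_
        by_cases h3 : D.γ l' x (f t).1 k = 0
        · rw [h3, zero_smul]; exact Submodule.zero_mem _
        · have h4 := D.γ_ge hm hx h3
          refine Submodule.smul_mem _ _ (lower k (lt_of_le_of_ne h4.2 ?_) (hm'.trans h4.1))
          intro h5
          apply h3
          rw [← h5]
          exact D.γ_lt_right (lt_of_le_of_ne hm (Ne.symm h2)) hx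
    · rw [D.mul_p_ne hm' hm hx (f t).2 (Ne.symm h)]
      simp only [h, false_and, if_false, zero_smul, Finset.sum_const_zero, sub_zero]
      exact Submodule.zero_mem _
  · intro k hk
    rw [Set.ncard_eq_one]
    refine ⟨f.symm ⟨k, hk⟩, ?_⟩
    ext t
    simp only [Set.mem_ofPred_eq, Set.mem_singleton_iff, Equiv.eq_symm_apply, Subtype.ext_iff]
  · intro k hk
    rw [Set.ncard_eq_zero]
    ext t
    simp only [Set.mem_ofPred_eq, Set.mem_empty_iff_false, iff_false]
    rintro rfl
    exact hk (f t).2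

include D in
theorem isQuasiHereditary : IsQuasiHereditary K e := by
  refine ⟨fun i => D.mult_delta i i le_rfl, fun i => ?_⟩
  obtain ⟨d, h, h1, h2⟩ := D.hasFiltration_P i
  exact ⟨d, h, h1 i le_rfl, h2⟩

/-! ### Costandard modules -/

theorem ev_eq_sum (f : DualReg K A) (x : A) :
    f.ev x = ∑ j, ∑ k, ∑ i, D.coeff j k i x * f.ev (D.p j k i) := by
  conv_lhs => rw [← D.sum_coeff x]
  simp only [DualReg.ev_sum, DualReg.ev_smul_right]

theorem ev_ext {f g : DualReg K A}
    (h : ∀ j k i, j ≤ k → i ≤ k → f.ev (D.p j k i) = g.ev (D.p j k i)) : f = g := by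
  refine DualReg.ext K A fun x => ?_
  induction x using D.induction_on with
  | zero => simp
  | add a b ha hb => rw [DualReg.ev_add_right, DualReg.ev_add_right, ha, hb]
  | smul c a ha => rw [DualReg.ev_smul_right, DualReg.ev_smul_right, ha]
  | hp j k i hj hi => exact h j k i hj hi

theorem mem_I {i : ι} {f : DualReg K A} :
    f ∈ I K e i ↔ ∀ j k l, j ≤ k → l ≤ k → j ≠ i → f.ev (D.p j k l) = 0 := by
  constructor
  · intro hf j k l hj hl hji
    rw [← hf, ← D.e_mul_p hj hl, ← mul_assoc, D.e_mul_ne (Ne.symm hji), zero_mul,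
      DualReg.ev_zero_right]
  · intro h x
    induction x using D.induction_on with
    | zero => simp
    | add a b ha hb => rw [mul_add, DualReg.ev_add_right, DualReg.ev_add_right, ha, hb]
    | smul c a ha => rw [mul_smul_comm, DualReg.ev_smul_right, DualReg.ev_smul_right, ha]
    | hp j k l hj hl =>
      by_cases hji : j = i
      · subst hji; rw [D.e_mul_p hj hl]
      · rw [h j k l hj hl hji, ← D.e_mul_p hj hl, ← mul_assoc, D.e_mul_ne (Ne.symm hji), zero_mul,
          DualReg.ev_zero_right]

/-- Dual to `mem_kerDelta`. The value of f at `p i k m` is the value of `e k • p k k m • f` at `p i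
k k`, hence 0 if the submodule containing f has no e_k-part. -/
theorem mem_Nabla {i : ι} {f : I K e i} :
    f ∈ Nabla K e i ↔ ∀ k m, i < k → m ≤ k → f.1.ev (D.p i k m) = 0 := by
  classical
  constructor
  · let N0 : Submodule A (I K e i) :=
      { carrier := {f | ∀ k m, i < k → m ≤ k → f.1.ev (D.p i k m) = 0}
        add_mem' := fun {f g} hf hg k m hk hm => by
          have h1 := hf k m hk hm
          have h2 := hg k m hk hm
          change (f.1 + g.1).ev _ = 0
          rw [DualReg.ev_add, h1, h2, add_zero]
        zero_mem' := fun k m _ _ => DualReg.ev_zero K A _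
        smul_mem' := fun a f hf k m hk hm => by
          change (a • f.1).ev _ = 0
          rw [DualReg.ev_smul, D.ev_eq_sum]
          refine Finset.sum_eq_zero fun j _ => Finset.sum_eq_zero fun l _ =>
            Finset.sum_eq_zero fun n _ => ?_
          by_cases hc : D.coeff j l n (D.p i k m * a) = 0
          · rw [hc, zero_mul]
          · obtain ⟨rfl, h2⟩ := D.ge_of_coeff_p_mul_ne hk.le hm hc
            have h3 := D.le_of_coeff_ne hc
            rw [hf l n (hk.trans_le h2) h3.2, mul_zero] }
    have hN : Nabla K e i ≤ N0 := by
      refine sSup_le fun N hN f hf k m hk hm => ?_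
      have h1 : e k • (D.p k k m • f) = 0 := hN k (not_le_of_gt hk) _ (N.smul_mem _ hf)
      have h2 : (e k • (D.p k k m • f.1)).ev (D.p i k k) = 0 := by
        have : e k • (D.p k k m • f.1) = 0 := congrArg Subtype.val h1
        rw [this, DualReg.ev_zero]
      rwa [DualReg.ev_smul, DualReg.ev_smul, D.p_mul_e hk.le le_rfl,
        D.p_mul_p_self hk.le hm] at h2
    exact fun hf => hN hf
  · intro hf
    -- The functionals whose generated submodule has no e_k-part for any k ≰ i.
    let N : Submodule A (I K e i) :=
      { carrier := {f | ∀ k, ¬ k ≤ i → ∀ a : A, e k • a • f = 0}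
        add_mem' := fun {f g} hf hg k hk a => by
          rw [smul_add, smul_add, hf k hk, hg k hk, add_zero]
        zero_mem' := fun k _ a => by rw [smul_zero, smul_zero]
        smul_mem' := fun b f hf k hk a => by rw [← mul_smul a b]; exact hf k hk _ }
    have hN : N ≤ Nabla K e i := by
      refine le_sSup fun k hk f hf => ?_
      have := hf k hk 1
      rwa [one_smul] at this
    refine hN fun k hk a => Subtype.ext ?_
    change e k • a • f.1 = 0
    refine D.ev_ext fun j l n hj hn => ?_
    rw [DualReg.ev_smul, DualReg.ev_smul, DualReg.ev_zero, mul_assoc, D.ev_eq_sum]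
    refine Finset.sum_eq_zero fun j' _ => Finset.sum_eq_zero fun l' _ =>
      Finset.sum_eq_zero fun n' _ => ?_
    by_cases hc : D.coeff j' l' n' (D.p j l n * (e k * a)) = 0
    · rw [hc, zero_mul]
    · obtain ⟨rfl, h2⟩ := D.ge_of_coeff_p_mul_ne hj hn hc
      obtain ⟨k', hk', hc', -⟩ := D.ge_of_coeff_p_mul_ne' hj hn hc
      have h3 := D.le_of_coeff_ne hc
      rw [D.coeff_e_mul] at hc'
      split_ifs at hc' with hnk
      · subst hnk
        by_cases hji : j' = i
        · subst hji
          rw [hf l' n' _ h3.2, mul_zero]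
          exact lt_of_le_of_ne h3.1 fun h => hk ((D.le_of_coeff_ne hc').1.trans (hk'.trans h.ge))
        · rw [D.mem_I.1 f.2 _ _ _ h3.1 h3.2 hji, mul_zero]
      · exact (hc' rfl).elim

/-- The coordinates on `∇(i)`. -/
def nablaCoord (i : ι) : Nabla K e i →ₗ[K] ({m : ι // m ≤ i} → K) where
  toFun f m := f.1.1.ev (D.p i i m.1)
  map_add' _ _ := rfl
  map_smul' _ _ := rfl

theorem nablaCoord_bijective (i : ι) : Function.Bijective (D.nablaCoord i) := by
  classical
  constructor
  · intro f g hfg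
    refine Subtype.ext (Subtype.ext (D.ev_ext fun j k l hj hl => ?_))
    by_cases hji : j = i
    · subst hji
      rcases eq_or_lt_of_le hj with h | h
      · subst h; exact congrFun hfg ⟨l, hl⟩
      · rw [D.mem_Nabla.1 f.2 k l h hl, D.mem_Nabla.1 g.2 k l h hl]
    · rw [D.mem_I.1 f.1.2 _ _ _ hj hl hji, D.mem_I.1 g.1.2 _ _ _ hj hl hji]
  · intro v
    let f : DualReg K A := show A →ₗ[K] K from ∑ m : {m : ι // m ≤ i}, v m • D.coeff i i m.1
    have hf : ∀ j k l, j ≤ k → l ≤ k → f.ev (D.p j k l) =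
        ∑ m : {m : ι // m ≤ i}, v m * (if i = j ∧ i = k ∧ m.1 = l then 1 else 0) := by
      intro j k l hj hl
      change (∑ m : {m : ι // m ≤ i}, v m • D.coeff i i m.1) (D.p j k l) = _
      simp [LinearMap.sum_apply, D.coeff_p hj hl]
    refine ⟨⟨⟨f, D.mem_I.2 fun j k l hj hl hji => ?_⟩, D.mem_Nabla.2 fun k m hk hm => ?_⟩, ?_⟩
    · rw [hf j k l hj hl]; simp [Ne.symm hji]
    · change f.ev _ = 0
      rw [hf i k m hk.le hm]; simp [hk.ne]
    · ext m
      change f.ev _ = _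
      rw [hf i i m.1 le_rfl m.2]
      simp [← Subtype.ext_iff]

/-- The basis of `∇(i)` that is dual to the `p i i m`. -/
noncomputable def nablaBasis (i : ι) : Module.Basis {m : ι // m ≤ i} K (Nabla K e i) :=
  Module.Basis.ofEquivFun (LinearEquiv.ofBijective _ (D.nablaCoord_bijective i))

theorem nablaBasis_repr (i : ι) (f : Nabla K e i) (m : {m : ι // m ≤ i}) :
    (D.nablaBasis i).repr f m = f.1.1.ev (D.p i i m.1) := rfl

open Classical in
theorem nablaBasis_ev (i : ι) (x m : {m : ι // m ≤ i}) :
    (D.nablaBasis i x).1.1.ev (D.p i i m.1) = if x = m then 1 else 0 := by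
  rw [← D.nablaBasis_repr, Module.Basis.repr_self, Finsupp.single_apply]

-- On ∇(k) only the ascending paths, those with `l' = m'`, act nontrivially; the reason is the same
-- as for Δ(k), with left and right exchanged.
open Classical in
theorem nablaBasis_repr_smul {m' l' m : ι} (hm' : m' ≤ l') (hm : m ≤ l') (k : ι)
    (x y : {m : ι // m ≤ k}) : (D.nablaBasis k).repr (D.p m' l' m • D.nablaBasis k x) y =
      if x.1 = m ∧ l' = m' ∧ y.1 = m' then 1 else 0 := by
  rw [D.nablaBasis_repr]
  change (D.p m' l' m • (D.nablaBasis k x).1.1).ev _ = _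
  rw [DualReg.ev_smul]
  by_cases h : y.1 = m'
  · have hy : m' ≤ k := h ▸ y.2
    rw [h, D.mul_p le_rfl hy hm' hm, DualReg.ev_sum, Finset.sum_eq_single k]
    · by_cases h2 : l' = m'
      · subst h2
        rw [D.γ_right hy, one_smul]
        have := D.nablaBasis_ev k x ⟨m, hm.trans hy⟩
        rw [this]
        simp [Subtype.ext_iff]
      · rw [D.γ_lt_left hy (lt_of_le_of_ne hm' (Ne.symm h2)), zero_smul, DualReg.ev_zero_right]
        simp [h2]
    · intro r _ hr
      by_cases hγ : D.γ k m' l' r = 0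
      · rw [hγ, zero_smul, DualReg.ev_zero_right]
      · have h3 := D.γ_ge hy hm' hγ
        rw [DualReg.ev_smul_right, D.mem_Nabla.1 (D.nablaBasis k x).2 r m
          (lt_of_le_of_ne h3.1 (Ne.symm hr)) (hm.trans h3.2), mul_zero]
    · simp
  · rw [D.mul_p_ne le_rfl y.2 hm' hm h, DualReg.ev_zero_right]
    simp [h]

end TriangularBasis
end Triangular
end OneQH

namespace OneQH

/-! ### Socles and injectives: 1-quasi-heredity from nondegenerate pairings -/

section Triangular

theorem headMod_equiv_of_surjective {A M N : Type*} [Ring A] [AddCommGroup M] [Module A M]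
    [AddCommGroup N] [Module A N] (f : M →ₗ[A] N) (hf : Function.Surjective f)
    (h : LinearMap.ker f ≤ Module.jacobson A M) : Nonempty (HeadMod A N ≃ₗ[A] HeadMod A M) := by
  let g : M →ₗ[A] HeadMod A N := (Module.jacobson A N).mkQ ∘ₗ f
  have hg : Function.Surjective g := (Submodule.mkQ_surjective _).comp hf
  have hk : LinearMap.ker g = Module.jacobson A M := by
    rw [LinearMap.ker_comp, Submodule.ker_mkQ]
    exact Module.comap_jacobson_of_ker_le hf h
  exact ⟨((Submodule.quotEquivOfEq _ _ hk.symm).trans (g.quotKerEquivOfSurjective hg)).symm⟩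

variable {K : Type*} [Field K] {A : Type*} [Ring A] [Algebra K A] {ι : Type*} [Fintype ι]
  [PartialOrder ι]

namespace TriangularBasis

variable {e : ι → A} (D : TriangularBasis K e)

/-- The structure constants are symmetric, there are a smallest and a largest vertex `b`, `t`, and
the pairing given by the coefficients at `t` is nondegenerate. -/
structure IsFrobenius (b t : ι) : Prop where
  bot_le : ∀ i, b ≤ i
  le_top : ∀ i, i ≤ t
  symm : ∀ {l j k r}, j ≤ l → j ≤ k → D.γ l j k r = D.γ k j l r
  nondeg : ∀ j, ∀ v : ι → K, (∀ k, ¬ j ≤ k → v k = 0) →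
    (∀ l, j ≤ l → ∑ k, D.γ l j k t * v k = 0) → v = 0

namespace IsFrobenius

variable {D} {b t : ι} (F : D.IsFrobenius b t)

include F

/-- A strictly ascending path would have to raise the level t, which is already maximal, and
`γ_lt_right` forbids staying there. -/
theorem γ_top_ne {l j r : ι} (hl : j < l) : D.γ l j t r = 0 := by
  by_contra h
  have h1 := D.γ_ge hl.le (F.le_top j) h
  obtain rfl := le_antisymm h1.2 (F.le_top r)
  exact h (D.γ_lt_right hl (F.le_top j))

/-- Nothing descends from b, and every path that ascends kills level t. So A acts on the line of `p
b t i` through the coefficient of e_b. -/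
theorem mul_socle (i : ι) (a : A) : a * D.p b t i = D.coeff b b b a • D.p b t i := by
  classical
  refine D.ext_coeff fun m r i' => ?_
  rw [D.coeff_mul_p (F.bot_le t) (F.le_top i), map_smul, D.coeff_p (F.bot_le t) (F.le_top i),
    Finset.sum_eq_single b]
  · by_cases h : i' = i
    · rw [if_pos h]
      by_cases hm : m = b
      · subst hm
        by_cases hr : r = t
        · subst hr; rw [D.γ_left (F.bot_le r)]; simp [h]
        · rw [D.γ_left_ne (F.bot_le t) hr]; simp [hr]
      · rw [D.coeff_of_not fun h => hm (le_antisymm h.1 (F.bot_le m))]; simp [hm]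
    · simp [h]
  · intro l _ hl
    rw [F.γ_top_ne (lt_of_le_of_ne (F.bot_le l) (Ne.symm hl)), zero_mul]
  · simp

/-- Every nonzero submodule of `P(i)` contains the socle. -/
theorem socle_mem {i : ι} {N : Submodule A A} (hN : N ≤ P e i) (h0 : N ≠ ⊥) :
    D.p b t i ∈ N := by
  classical
  obtain ⟨x, hx, hx0⟩ := Submodule.exists_mem_ne_zero_of_ne_bot h0
  -- The coefficient of `p b t i` in `p b l j * x` is the pairing of l with the coefficients of x at
  -- the vertex j, so nondegeneracy at j detects x ≠ 0.
  have hex : ∃ l j, j ≤ l ∧ ∃ x ∈ N, D.p b l j * x ≠ 0 := by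
    have : ∃ j k, D.coeff j k i x ≠ 0 := by
      by_contra hcon
      push Not at hcon
      apply hx0
      rw [← D.sum_coeff_P (hN hx)]
      simp [hcon]
    obtain ⟨j, k, hjk⟩ := this
    by_contra hcon
    push Not at hcon
    have := F.nondeg j (fun k => D.coeff j k i x) (fun k hk => D.coeff_of_not (by tauto) x)
      (fun l hl => by
        have h1 := congrArg (D.coeff b t i) (hcon l j hl x hx)
        rwa [D.coeff_p_mul (F.bot_le l) hl, if_pos rfl, map_zero] at h1)
    exact hjk (congrFun this k)
  -- With l maximal, y = `p b l j * x` is killed by every `p b l' b` with l' > b, because `p b l' b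
  -- * p b l j` is a combination of `p b r j` with r > l.
  obtain ⟨l, ⟨j, hj, x, hx, hl⟩, hmax⟩ : ∃ l, (∃ j, j ≤ l ∧ ∃ x ∈ N, D.p b l j * x ≠ 0) ∧
      ∀ l', l < l' → ¬ ∃ j, j ≤ l' ∧ ∃ x ∈ N, D.p b l' j * x ≠ 0 := by
    obtain ⟨l, hl, hm⟩ := WellFounded.has_min (wellFounded_gt (α := ι))
      {l | ∃ j, j ≤ l ∧ ∃ x ∈ N, D.p b l j * x ≠ 0} hex
    exact ⟨l, hl, fun l' h1 h2 => hm l' h2 h1⟩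
  push Not at hmax
  let y := D.p b l j * x
  have hyN : y ∈ N := N.smul_mem _ hx
  have hy : ∀ l', b < l' → D.p b l' b * y = 0 := by
    intro l' hl'
    change D.p b l' b * (D.p b l j * x) = 0
    rw [← mul_assoc, D.mul_p (F.bot_le l') (F.bot_le l') (F.bot_le l) hj, Finset.sum_mul]
    refine Finset.sum_eq_zero fun r _ => ?_
    by_cases hγ : D.γ l' b l r = 0
    · rw [hγ, zero_smul, zero_mul]
    · have h1 := D.γ_ge (F.bot_le l') (F.bot_le l) hγ
      have h2 : l ≠ r := by
        rintro rfl
        exact hγ (D.γ_lt_right hl' (F.bot_le l))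
      rw [smul_mul_assoc, hmax r (lt_of_le_of_ne h1.2 h2) j (hj.trans h1.2) x hx, smul_zero]
  have hyb : ∀ m k, m ≠ b → D.coeff m k i y = 0 := by
    intro m k hm
    rw [D.coeff_p_mul (F.bot_le l) hj, if_neg hm]
  -- Nondegeneracy at b, applied to the coefficients of y with the one at t removed. The removal
  -- settles l' = b, where the pairing reads off exactly this coefficient; for l' > b the column t
  -- vanishes anyway. What remains of y is a multiple of `p b t i`.
  have hv : (fun k => if k = t then 0 else D.coeff b k i y) = 0 := by
    refine F.nondeg b _ (fun k hk => (hk (F.bot_le k)).elim) fun l' _ => ?_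
    rcases eq_or_lt_of_le (F.bot_le l') with h1 | h1
    · subst h1
      refine Finset.sum_eq_zero fun k _ => ?_
      split_ifs with h2
      · rw [mul_zero]
      · rw [D.γ_left_ne (F.bot_le k) (Ne.symm h2), zero_mul]
    · have h2 := congrArg (D.coeff b t i) (hy l' h1)
      rw [D.coeff_p_mul (F.bot_le l') (F.bot_le l'), if_pos rfl, map_zero] at h2
      rw [← h2]
      refine Finset.sum_congr rfl fun k _ => ?_
      split_ifs with h3
      · subst h3; rw [F.γ_top_ne h1, zero_mul, zero_mul]
      · rfl
  have hyy : y = D.coeff b t i y • D.p b t i := by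
    conv_lhs => rw [← D.sum_coeff_P (hN hyN)]
    rw [Finset.sum_eq_single b, Finset.sum_eq_single t]
    · intro k _ hk
      have := congrFun hv k
      simp only [hk, if_false, Pi.zero_apply] at this
      rw [this, zero_smul]
    · simp
    · intro m _ hm
      exact Finset.sum_eq_zero fun k _ => by rw [hyb m k hm, zero_smul]
    · simp
  have hc : D.coeff b t i y ≠ 0 := fun h => hl (by
    change y = 0
    rw [hyy, h, zero_smul])
  rw [hyy] at hyN
  exact (Submodule.smul_mem_iff (N.restrictScalars K) hc).1 hyN

/-- The map `P(b) → P(i)` onto the socle. -/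
def socleMap (i : ι) : P e b →ₗ[A] P e i :=
  LinearMap.codRestrict (P e i)
    ((LinearMap.toSpanSingleton A A (D.p b t i)) ∘ₗ (P e b).subtype)
    (fun _ => (P e i).smul_mem _ (D.p_mem_P (F.bot_le t) (F.le_top i)))

theorem socleMap_apply (i : ι) (x : P e b) :
    (F.socleMap i x : A) = D.coeff b b b x • D.p b t i := F.mul_socle i x

theorem p_socle_ne (i : ι) : D.p b t i ≠ 0 := by
  intro h
  have := D.coeff_p_self (F.bot_le t) (F.le_top i)
  rw [h, map_zero] at this
  exact zero_ne_one this

theorem ker_socleMap (i : ι) : LinearMap.ker (F.socleMap i) = Module.jacobson A (P e b) := by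
  ext x
  rw [LinearMap.mem_ker, D.jacobson_P, D.mem_radP, ← ZeroMemClass.coe_eq_zero, F.socleMap_apply,
    smul_eq_zero, or_iff_left (F.p_socle_ne i)]

/-- The image of P(b) is simple and lies in every nonzero submodule, so it is the only simple
submodule. -/
theorem soc_P (i : ι) : soc A (P e i) = LinearMap.range (F.socleMap i) := by
  have hmin : ∀ N : Submodule A (P e i), N ≠ ⊥ → LinearMap.range (F.socleMap i) ≤ N := by
    rintro N hN _ ⟨x, rfl⟩
    have h1 : D.p b t i ∈ N.map (P e i).subtype := by
      refine F.socle_mem (Submodule.map_subtype_le _ _) ?_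
      intro h
      apply hN
      rw [eq_bot_iff]
      intro y hy
      exact Subtype.ext ((Submodule.eq_bot_iff _).1 h y ⟨y, hy, rfl⟩)
    obtain ⟨y, hy, hyp⟩ := h1
    have : F.socleMap i x = D.coeff b b b x • y := by
      apply Subtype.ext
      rw [F.socleMap_apply]
      change _ = D.coeff b b b x • (P e i).subtype y
      rw [hyp]
    rw [this]
    exact (N.restrictScalars K).smul_mem _ hy
  have hsimple : IsSimpleModule A (LinearMap.range (F.socleMap i)) := by
    have := D.isSimpleModule_S b
    exact IsSimpleModule.congr ((F.socleMap i).quotKerEquivRange.symm.trans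
      (Submodule.quotEquivOfEq _ _ (F.ker_socleMap i)))
  apply le_antisymm
  · refine sSup_le fun N hN => ?_
    have hN' : IsSimpleModule A N := hN
    have hatom := isSimpleModule_iff_isAtom.1 hN'
    have h1 : N ≠ ⊥ := hatom.1
    have hatom' := isSimpleModule_iff_isAtom.1 hsimple
    exact ((hatom.le_iff.1 (hmin N h1)).resolve_left hatom'.1).ge
  · exact le_sSup hsimple

theorem soc_equiv (i : ι) : Nonempty (soc A (P e i) ≃ₗ[A] S e b) :=
  ⟨(LinearEquiv.ofEq _ _ (F.soc_P i)).trans ((F.socleMap i).quotKerEquivRange.symm.trans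
      (Submodule.quotEquivOfEq _ _ (F.ker_socleMap i)))⟩

/-- The functional that generates `I(i)`. -/
noncomputable def socleForm (D : TriangularBasis K e) (b t i : ι) : DualReg K A := D.coeff i t b

omit F in
theorem socleForm_ev (i : ι) (x : A) : (socleForm D b t i).ev x = D.coeff i t b x := rfl

omit F in
theorem socleForm_mem (i : ι) : socleForm D b t i ∈ I K e i := by
  classical
  rw [D.mem_I]
  intro j k l hj hl hji
  rw [socleForm_ev, D.coeff_p hj hl, if_neg (by tauto)]

/-- The values of `a • socleForm` at the `p i k j` are the pairings of k with the coefficients of a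
at the vertex j. Prescribing them is one linear system for each j, injective by nondegeneracy and
hence solvable in finite dimension. -/
theorem exists_smul_socleForm {i : ι} {g : DualReg K A} (hg : g ∈ I K e i) :
    ∃ a ∈ P e b, a • socleForm D b t i = g := by
  classical
  -- The matrix of the pairing at j, padded with the identity at the indices k ≱ j to get an
  -- endomorphism of the full coordinate space.
  let L : ι → (ι → K) →ₗ[K] (ι → K) := fun j =>
    LinearMap.pi fun k => if j ≤ k then ∑ l, (if j ≤ l then D.γ k j l t else 0) •
      LinearMap.proj l else LinearMap.proj k
  have hL : ∀ j v k, L j v k = if j ≤ k then ∑ l, (if j ≤ l then D.γ k j l t else 0) * v l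
      else v k := by
    intro j v k
    simp only [L, LinearMap.pi_apply]
    split_ifs with h
    · simp only [LinearMap.sum_apply, LinearMap.smul_apply, LinearMap.proj_apply, smul_eq_mul]
    · rfl
  have hsurj : ∀ j, Function.Surjective (L j) := by
    intro j
    apply LinearMap.surjective_of_injective
    rw [injective_iff_map_eq_zero]
    intro v hv
    have h1 : ∀ k, ¬ j ≤ k → v k = 0 := by
      intro k hk
      have := congrFun hv k
      rwa [hL, if_neg hk] at this
    refine F.nondeg j v h1 fun l hl => ?_
    have h2 := congrFun hv l
    rw [hL, if_pos hl, Pi.zero_apply] at h2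
    rw [← h2]
    refine Finset.sum_congr rfl fun k _ => ?_
    split_ifs with h3
    · rfl
    · rw [h1 k h3, mul_zero, mul_zero]
  choose s hs using fun j => hsurj j (fun k => if i ≤ k then g.ev (D.p i k j) else 0)
  let a := ∑ j, ∑ l, (if j ≤ l then s j l else 0) • D.p j l b
  have haP : a ∈ P e b := by
    refine Submodule.sum_mem _ fun j _ => Submodule.sum_mem _ fun l _ => ?_
    split_ifs with h
    · exact ((P e b).restrictScalars K).smul_mem _ (D.p_mem_P h (F.bot_le l))
    · rw [zero_smul]; exact Submodule.zero_mem _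
  have hac : ∀ j l, j ≤ l → D.coeff j l b a = s j l := by
    intro j l hjl
    have h1 : ∀ j' l', (if j' ≤ l' then s j' l' else 0) * D.coeff j l b (D.p j' l' b) =
        if j' = j then if l' = l then s j l else 0 else 0 := by
      intro j' l'
      by_cases h : j' ≤ l'
      · rw [D.coeff_p h (F.bot_le l'), if_pos h]
        simp only [eq_comm (a := j), eq_comm (a := l)]
        by_cases h1 : j' = j <;> by_cases h2 : l' = l <;> simp [h1, h2]
      · rw [if_neg h, zero_mul]
        split_ifs with h1 h2
        · subst h1 h2; exact (h hjl).elim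
        all_goals rfl
    simp only [a, map_sum, map_smul, smul_eq_mul, h1]
    simp
  refine ⟨a, haP, D.ev_ext fun j k l hj hl => ?_⟩
  rw [DualReg.ev_smul, socleForm_ev, D.coeff_p_mul hj hl]
  split_ifs with h
  · subst h
    have h1 := congrFun (hs l) k
    rw [hL, if_pos hl, if_pos hj] at h1
    rw [← h1]
    refine Finset.sum_congr rfl fun m _ => ?_
    split_ifs with h2
    · rw [hac l m h2]
    · rw [D.coeff_of_not (by tauto), mul_zero, zero_mul]
  · rw [D.mem_I.1 hg _ _ _ hj hl (Ne.symm h)]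

omit F in
/-- The map `P(b) → I(i)` given by the generator. -/
noncomputable def toI (D : TriangularBasis K e) (b t i : ι) : P e b →ₗ[A] I K e i :=
  (LinearMap.toSpanSingleton A (I K e i) ⟨socleForm D b t i, socleForm_mem i⟩) ∘ₗ
    (P e b).subtype

theorem toI_surjective (i : ι) : Function.Surjective (toI D b t i) := by
  intro g
  obtain ⟨a, ha, h⟩ := F.exists_smul_socleForm g.2
  exact ⟨⟨a, ha⟩, Subtype.ext h⟩

/-- I(i) is a nonzero quotient of the local module P(b), hence has the same head. -/
theorem head_I (i : ι) : Nonempty (HeadMod A (I K e i) ≃ₗ[A] S e b) := by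
  refine headMod_equiv_of_surjective (toI D b t i) (F.toI_surjective i) ?_
  rw [D.jacobson_P]
  refine D.le_radP fun h => ?_
  have h1 : toI D b t i ⟨e b, e_mem_P e b⟩ = 0 := by
    rw [← LinearMap.mem_ker, h]; trivial
  have h2 : (e b • socleForm D b t i).ev (D.p i t b) = 0 := by
    have : e b • socleForm D b t i = 0 := congrArg Subtype.val h1
    rw [this, DualReg.ev_zero]
  rw [DualReg.ev_smul, D.p_mul_e (F.le_top i) (F.bot_le t), socleForm_ev,
    D.coeff_p_self (F.le_top i) (F.bot_le t)] at h2
  exact one_ne_zero h2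

/-- Right multiplication by `p i t t`, followed by P(t) → Δ(t). At level t only the components of x
at level i survive, so the kernel is exactly that of P(i) → Δ(i). -/
theorem exists_delta_injective (i : ι) :
    ∃ f : Delta e i →ₗ[A] Delta e t, Function.Injective f := by
  classical
  let g : P e i →ₗ[A] Delta e t := (kerDelta e t).mkQ ∘ₗ LinearMap.codRestrict (P e t)
    ((LinearMap.toSpanSingleton A A (D.p i t t)) ∘ₗ (P e i).subtype)
    (fun _ => (P e t).smul_mem _ (D.p_mem_P (F.le_top i) le_rfl))
  have hg : LinearMap.ker g = kerDelta e i := by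
    ext x
    rw [LinearMap.mem_ker, D.mem_kerDelta]
    change Submodule.Quotient.mk _ = _ ↔ _
    rw [Submodule.Quotient.mk_eq_zero, D.mem_kerDelta]
    refine forall_congr' fun m => ?_
    change D.coeff m t t (x * D.p i t t) = 0 ↔ _
    rw [D.coeff_mul_p (F.le_top i) le_rfl, if_pos rfl, Finset.sum_eq_single i,
      D.γ_left (F.le_top i), one_mul]
    · intro l _ hl
      by_cases h : i ≤ l
      · rw [F.γ_top_ne (lt_of_le_of_ne h (Ne.symm hl)), zero_mul]
      · rw [D.coeff_of_not (by tauto), mul_zero]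
    · simp
  refine ⟨(kerDelta e i).liftQ g hg.ge, ?_⟩
  rw [← LinearMap.ker_eq_bot]
  exact Submodule.ker_liftQ_eq_bot _ _ _ hg.le

/-- Functionals are composed with left multiplication by `p t t i`. Symmetry of the constants is
needed to land in ∇(i): `γ_top_ne` concerns the right factor, whereas here the top level is in the
left one. -/
theorem exists_nabla_surjective (i : ι) :
    ∃ g : Nabla K e t →ₗ[A] Nabla K e i, Function.Surjective g := by
  classical
  let φ : DualReg K A → DualReg K A := fun f =>
    (id f : A →ₗ[K] K) ∘ₗ LinearMap.mulLeft K (D.p t t i)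
  have hφ : ∀ f x, (φ f).ev x = f.ev (D.p t t i * x) := fun f x => rfl
  have h1 : ∀ f, φ f ∈ I K e i := fun f x => by
    rw [hφ, hφ, ← mul_assoc, D.p_mul_e le_rfl (F.le_top i)]
  have h2 : ∀ f : Nabla K e t, (⟨φ f.1.1, h1 _⟩ : I K e i) ∈ Nabla K e i := by
    intro f
    rw [D.mem_Nabla]
    intro k m hk hm
    change (φ f.1.1).ev _ = 0
    rw [hφ, D.mul_p le_rfl (F.le_top i) hk.le hm, DualReg.ev_sum]
    refine Finset.sum_eq_zero fun r _ => ?_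
    rw [F.symm (F.le_top i) hk.le, F.γ_top_ne hk, zero_smul, DualReg.ev_zero_right]
  let g : Nabla K e t →ₗ[A] Nabla K e i :=
    { toFun := fun f => ⟨⟨φ f.1.1, h1 _⟩, h2 f⟩
      map_add' := fun f g => rfl
      map_smul' := fun a f => by
        refine Subtype.ext (Subtype.ext (DualReg.ext K A fun x => ?_))
        change (a • f.1.1).ev (D.p t t i * x) = f.1.1.ev (D.p t t i * (x * a))
        rw [DualReg.ev_smul, mul_assoc] }
  refine ⟨g, ?_⟩
  let g' : Nabla K e t →ₗ[K] Nabla K e i := g.restrictScalars K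
  have hg' : ⊤ ≤ LinearMap.range g' := by
    rw [← (D.nablaBasis i).span_eq, Submodule.span_le]
    rintro _ ⟨m, rfl⟩
    refine ⟨D.nablaBasis t ⟨m.1, F.le_top _⟩, ?_⟩
    apply (D.nablaBasis i).ext_elem
    intro x
    rw [D.nablaBasis_repr, D.nablaBasis_repr, D.nablaBasis_ev]
    change (D.nablaBasis t ⟨m.1, F.le_top _⟩).1.1.ev (D.p t t i * D.p i i x.1) = _
    rw [D.mul_p le_rfl (F.le_top i) le_rfl x.2, Finset.sum_eq_single t,
      D.γ_right (F.le_top i), one_smul]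
    · have := D.nablaBasis_ev t ⟨m.1, F.le_top _⟩ ⟨x.1, F.le_top _⟩
      rw [this]
      simp [Subtype.ext_iff]
    · intro r _ hr
      rw [D.γ_right_ne (F.le_top i) hr, zero_smul]
    · simp
  intro y
  obtain ⟨x, hx⟩ := hg' (Submodule.mem_top (x := y))
  exact ⟨x, hx⟩

theorem isOneQuasiHereditary : IsOneQuasiHereditary K e := by
  refine ⟨D.isQuasiHereditary, b, t, F.bot_le, F.le_top, fun i j hij => ⟨D.mult_delta i j hij, ?_⟩,
    fun i => ⟨F.soc_equiv i, F.head_I i⟩,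
    fun i => ⟨F.exists_delta_injective i, F.exists_nabla_surjective i⟩⟩
  obtain ⟨d, hd, h1, -⟩ := D.hasFiltration_P j
  exact ⟨d, hd, h1 i hij⟩

end IsFrobenius
end TriangularBasis
end Triangular
end OneQH

namespace OneQH

/-! ### The factor algebras A(i) -/

section Truncation

variable {K : Type*} [Field K] {A : Type*} [Ring A] [Algebra K A] {ι : Type*} [Fintype ι]
  [PartialOrder ι]

theorem truncMk_surjective (e : ι → A) (i₀ : ι) : Function.Surjective (truncMk K e i₀) :=
  RingQuot.mkAlgHom_surjective K (TruncRel e i₀)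

namespace TriangularBasis

variable {e : ι → A} (D : TriangularBasis K e)

include D in
theorem truncMk_e (i₀ : ι) {i : ι} (h : ¬ i ≤ i₀) : truncMk K e i₀ (e i) = 0 := by
  classical
  have h1 : truncMk K e i₀ (∑ j with ¬ j ≤ i₀, e j) = 0 := by
    have := RingQuot.mkAlgHom_rel K (TruncRel.zero (e := e) (i := i₀))
    rw [map_zero] at this
    exact this
  have h2 : e i * ∑ j with ¬ j ≤ i₀, e j = e i := by
    rw [Finset.mul_sum, Finset.sum_eq_single i]
    · exact D.e_mul_self i
    · intro j _ hj; exact D.e_mul_ne (Ne.symm hj)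
    · intro hi; simp [h] at hi
  rw [← h2, map_mul, h1, mul_zero]

theorem truncMk_p (i₀ : ι) {j k i : ι} (hj : j ≤ k) (hi : i ≤ k) (h : ¬ k ≤ i₀) :
    truncMk K e i₀ (D.p j k i) = 0 := by
  rw [← D.p_mul_p_self hj hi, ← D.e_mul_p le_rfl hi, map_mul, map_mul, D.truncMk_e i₀ h, zero_mul,
    mul_zero]

/-- The kernel of the projection to the truncated algebra. -/
def truncKer (i₀ : ι) : Submodule A A where
  carrier := {a | ∀ j k l, k ≤ i₀ → D.coeff j k l a = 0}
  add_mem' {a b} ha hb j k l hk := by rw [map_add, ha j k l hk, hb j k l hk, add_zero]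
  zero_mem' _ _ _ _ := map_zero _
  smul_mem' a x hx := by
    intro j' k' l' hk'
    rw [smul_eq_mul]
    induction a using D.induction_on with
    | zero => simp
    | add a b ha hb => rw [add_mul, map_add, ha, hb, add_zero]
    | smul c a ha => rw [smul_mul_assoc, map_smul, ha, smul_zero]
    | hp m l j hm hj =>
      by_contra h
      obtain ⟨k, hk, hc, -⟩ := D.ge_of_coeff_p_mul_ne' hm hj h
      exact hc (hx _ _ _ (hk.trans hk'))

/-- The kernel of A → A(i₀) is not larger than `truncKer`: the sum of the e_j with j ≰ i₀ acts as 0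
on A modulo `truncKer`, so A(i₀) acts there, and the class of 1 recovers a. -/
theorem coeff_eq_zero_of_truncMk (i₀ : ι) {a : A} (h : truncMk K e i₀ a = 0) {j k i : ι}
    (hk : k ≤ i₀) : D.coeff j k i a = 0 := by
  classical
  let ρ : A →ₐ[K] Module.End K (A ⧸ D.truncKer i₀) := Algebra.lsmul K K (A ⧸ D.truncKer i₀)
  have hρ : ∀ x y, TruncRel e i₀ x y → ρ x = ρ y := by
    rintro _ _ ⟨⟩
    refine LinearMap.ext fun z => ?_
    obtain ⟨z, rfl⟩ := Submodule.Quotient.mk_surjective _ z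
    rw [map_zero, LinearMap.zero_apply]
    change (Submodule.Quotient.mk (_ * z) : A ⧸ D.truncKer i₀) = 0
    rw [Submodule.Quotient.mk_eq_zero]
    intro j k l hk
    rw [Finset.sum_mul, map_sum]
    refine Finset.sum_eq_zero fun m hm => ?_
    rw [D.coeff_e_mul]
    split_ifs with h1
    · subst h1
      refine D.coeff_of_not (fun h2 => ?_) _
      exact (by simpa using hm : ¬ j ≤ i₀) (h2.1.trans hk)
    · rfl
  let ρ' : RingQuot (TruncRel e i₀) →ₐ[K] Module.End K (A ⧸ D.truncKer i₀) :=
    RingQuot.liftAlgHom K ⟨ρ, fun {x y} h => hρ x y h⟩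
  have h1 : ρ' (RingQuot.mkAlgHom K (TruncRel e i₀) a) = ρ a :=
    RingQuot.liftAlgHom_mkAlgHom_apply K ρ _ a
  have h2 : RingQuot.mkAlgHom K (TruncRel e i₀) a = 0 := h
  rw [h2, map_zero] at h1
  have h3 : (Submodule.Quotient.mk (a * 1) : A ⧸ D.truncKer i₀) = 0 :=
    (LinearMap.congr_fun h1 (Submodule.Quotient.mk 1)).symm
  rw [Submodule.Quotient.mk_eq_zero, mul_one] at h3
  exact h3 j k i hk

/-- The basis of the truncated algebra. -/
def trunc [DecidableLE ι] (i₀ : ι) : TriangularBasis K (truncIdem K e i₀) where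
  p j k i := truncMk K e i₀ (D.p j k i)
  γ l j k r := D.γ l j k r
  linInd := by
    classical
    rw [Fintype.linearIndependent_iff]
    rintro g hg ⟨⟨j, k, i⟩, hj, hi⟩
    simp only [← map_smul, ← map_sum] at hg
    have h1 := D.coeff_eq_zero_of_truncMk i₀ hg k.2 (j := j) (i := i)
    rw [map_sum, Finset.sum_eq_single ⟨(j, k, i), hj, hi⟩] at h1
    · rw [map_smul, D.coeff_p_self hj hi] at h1
      simpa using h1
    · rintro ⟨⟨j', k', i'⟩, hj', hi'⟩ - hne
      rw [map_smul, D.coeff_p hj' hi', if_neg, smul_zero]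
      rintro ⟨h2, h3, h4⟩
      apply hne
      simp only [Subtype.mk.injEq, Prod.mk.injEq]
      exact ⟨Subtype.ext h2.symm, Subtype.ext h3.symm, Subtype.ext h4.symm⟩
    · simp
  span := by
    intro x _
    obtain ⟨a, rfl⟩ := truncMk_surjective (K := K) e i₀ x
    induction a using D.induction_on with
    | zero => rw [map_zero]; exact Submodule.zero_mem _
    | add a b ha hb => rw [map_add]; exact Submodule.add_mem _ (ha trivial) (hb trivial)
    | smul c a ha => rw [map_smul]; exact Submodule.smul_mem _ _ (ha trivial)
    | hp j k i hj hi =>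
      by_cases h : k ≤ i₀
      · exact Submodule.subset_span ⟨⟨(⟨j, hj.trans h⟩, ⟨k, h⟩, ⟨i, hi.trans h⟩), hj, hi⟩, rfl⟩
      · rw [D.truncMk_p i₀ hj hi h]; exact Submodule.zero_mem _
  p_self i := by rw [D.p_self]; rfl
  mul_p {m l j k i} hm hj hj' hi := by
    classical
    rw [← map_mul, D.mul_p hm hj hj' hi, map_sum]
    simp only [map_smul]
    -- The levels r ≰ i₀ drop out, because `p m r i` passes through the vertex r and so maps to 0.
    rw [← Finset.sum_subset (Finset.subset_univ (Finset.univ.filter (· ≤ i₀)))]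
    · exact Finset.sum_subtype _ (by simp) _
    · intro r _ hr
      have hr' : ¬ r ≤ i₀ := by simpa using hr
      by_cases h : D.γ l j k r = 0
      · rw [h, zero_smul]
      · have h1 := D.γ_ge hj hj' h
        rw [D.truncMk_p i₀ (le_trans hm h1.1) (le_trans hi h1.2) hr', smul_zero]
  mul_p_ne {m l j j' k i} hm hj hj' hi hne := by
    rw [← map_mul, D.mul_p_ne hm hj hj' hi (fun h => hne (Subtype.ext h)), map_zero]
  γ_ge h1 h2 h3 := D.γ_ge h1 h2 h3
  γ_left_ne h1 h2 := D.γ_left_ne h1 (fun h => h2 (Subtype.ext h))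
  γ_left h1 := D.γ_left h1
  γ_right_ne h1 h2 := D.γ_right_ne h1 (fun h => h2 (Subtype.ext h))
  γ_right h1 := D.γ_right h1
  γ_lt_left h1 h2 := D.γ_lt_left h1 h2
  γ_lt_right h1 h2 := D.γ_lt_right h1 h2

end TriangularBasis
end Truncation
end OneQH

namespace OneQH
open Vtx

set_option linter.unusedSimpArgs false

/-! ### Normal forms of paths in A -/

section SixVertices

variable {K : Type u} [Field K] (q : K)

/-- The arrow `i → j` as an element of the algebra. -/
noncomputable def arr (i j : Vtx) : Alg6 q := mk6 q (arrow K adj6 i j)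

theorem pth_single (i : Vtx) : pth q [i] = idem6 q i := rfl

theorem pth_cons (i j : Vtx) (l : List Vtx) : pth q (i :: j :: l) = pth q (j :: l) * arr q i j :=
  map_mul (mk6 q) _ _

theorem arrow_mul_vertex (i j : Vtx) :
    arrow K adj6 i j * vertex K adj6 i = arrow K adj6 i j := by
  unfold arrow
  split_ifs with h
  · have := RingQuot.mkAlgHom_rel K (PathRel.source (K := K) (adj := adj6) ⟨(i, j), h⟩)
    rw [map_mul] at this
    exact this
  · exact zero_mul _

theorem vertex_mul_arrow (i j : Vtx) :
    vertex K adj6 j * arrow K adj6 i j = arrow K adj6 i j := by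
  unfold arrow
  split_ifs with h
  · have := RingQuot.mkAlgHom_rel K (PathRel.target (K := K) (adj := adj6) ⟨(i, j), h⟩)
    rw [map_mul] at this
    exact this
  · exact mul_zero _

theorem arr_mul_idem (i j : Vtx) : arr q i j * idem6 q i = arr q i j := by
  have := congrArg (mk6 q) (arrow_mul_vertex (K := K) i j)
  rw [map_mul] at this
  exact this

theorem idem_mul_arr (i j : Vtx) : idem6 q j * arr q i j = arr q i j := by
  have := congrArg (mk6 q) (vertex_mul_arrow (K := K) i j)
  rw [map_mul] at this
  exact this

theorem idem_mul_arr_mul (i j : Vtx) (z : Alg6 q) :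
    idem6 q j * (arr q i j * z) = arr q i j * z := by
  rw [← mul_assoc, idem_mul_arr]

theorem vertex_mul_self (i : Vtx) :
    vertex K adj6 i * vertex K adj6 i = vertex K adj6 i := by
  have := RingQuot.mkAlgHom_rel K (PathRel.idem (K := K) (adj := adj6) i)
  rw [map_mul] at this
  exact this

theorem vertex_mul_ne {i j : Vtx} (h : i ≠ j) : vertex K adj6 i * vertex K adj6 j = 0 := by
  have := RingQuot.mkAlgHom_rel K (PathRel.orth (K := K) (adj := adj6) i j h)
  rw [map_mul, map_zero] at this
  exact this

theorem idem6_mul_self (i : Vtx) : idem6 q i * idem6 q i = idem6 q i := by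
  have := congrArg (mk6 q) (vertex_mul_self (K := K) i)
  rw [map_mul] at this
  exact this

theorem idem6_mul_ne {i j : Vtx} (h : i ≠ j) : idem6 q i * idem6 q j = 0 := by
  have := congrArg (mk6 q) (vertex_mul_ne (K := K) h)
  rw [map_mul, map_zero] at this
  exact this

theorem sum_vertex : ∑ i, vertex K adj6 i = 1 := by
  have := RingQuot.mkAlgHom_rel K (PathRel.one (K := K) (adj := adj6))
  rw [map_sum, map_one] at this
  exact this

theorem sum_idem6 : ∑ i, idem6 q i = 1 := by
  have := congrArg (mk6 q) (sum_vertex (K := K))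
  rw [map_sum, map_one] at this
  exact this

/-! ### The relations, as rewriting rules that move descending arrows to the left -/

theorem pth_rel {x y : PathAlgebra K adj6} (h : Rel6 q x y) : mk6 q x = mk6 q y :=
  RingQuot.mkAlgHom_rel K h

/-- Of the two ascending paths from 1 to 5, the one through 2 and 3 serves as normal form; the next
rule does the same for descending paths. -/
theorem arr_45_14 : arr q v4 v5 * arr q v1 v4 = arr q v3 v5 * (arr q v2 v3 * arr q v1 v2) := by
  have h : pth q [v1, v2, v3, v5] = pth q [v1, v4, v5] := pth_rel q .r1235
  simp only [pth_cons, pth_single, idem_mul_arr, mul_assoc, idem_mul_arr_mul] at h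
  exact h.symm

theorem arr_41_54 : arr q v4 v1 * arr q v5 v4 = arr q v2 v1 * (arr q v3 v2 * arr q v5 v3) := by
  have h : pth q [v5, v3, v2, v1] = pth q [v5, v4, v1] := pth_rel q .r5321
  simp only [pth_cons, pth_single, idem_mul_arr, mul_assoc, idem_mul_arr_mul] at h
  exact h.symm

theorem arr_12_21 : arr q v1 v2 * arr q v2 v1 = arr q v3 v2 * arr q v2 v3 := by
  have h : pth q [v2, v1, v2] = pth q [v2, v3, v2] := pth_rel q .r212
  simp only [pth_cons, pth_single, idem_mul_arr, mul_assoc, idem_mul_arr_mul] at h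
  exact h

theorem arr_23_32 : arr q v2 v3 * arr q v3 v2 = arr q v5 v3 * arr q v3 v5 := by
  have h : pth q [v3, v2, v3] = pth q [v3, v5, v3] := pth_rel q .r323
  simp only [pth_cons, pth_single, idem_mul_arr, mul_assoc, idem_mul_arr_mul] at h
  exact h

theorem arr_35_53 : arr q v3 v5 * arr q v5 v3 = arr q v6 v5 * arr q v5 v6 := by
  have h : pth q [v5, v3, v5] = pth q [v5, v6, v5] := pth_rel q .r535
  simp only [pth_cons, pth_single, idem_mul_arr, mul_assoc, idem_mul_arr_mul] at h
  exact h

theorem arr_45_54 : arr q v4 v5 * arr q v5 v4 = arr q v6 v5 * arr q v5 v6 := by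
  have h : pth q [v5, v4, v5] = pth q [v5, v6, v5] := pth_rel q .r545
  simp only [pth_cons, pth_single, idem_mul_arr, mul_assoc, idem_mul_arr_mul] at h
  exact h

theorem arr_56_65 : arr q v5 v6 * arr q v6 v5 = 0 := by
  have h : pth q [v6, v5, v6] = mk6 q 0 := pth_rel q .r656
  simp only [pth_cons, pth_single, idem_mul_arr, mul_assoc, idem_mul_arr_mul] at h
  rw [h, map_zero]

theorem arr_12_41 : arr q v1 v2 * arr q v4 v1 = arr q v3 v2 * (arr q v5 v3 * arr q v4 v5) := by
  have h : pth q [v4, v1, v2] = pth q [v4, v5, v3, v2] := pth_rel q .r412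
  simp only [pth_cons, pth_single, idem_mul_arr, mul_assoc, idem_mul_arr_mul] at h
  exact h

theorem arr_14_21 : arr q v1 v4 * arr q v2 v1 = arr q v5 v4 * (arr q v3 v5 * arr q v2 v3) := by
  have h : pth q [v2, v1, v4] = pth q [v2, v3, v5, v4] := pth_rel q .r214
  simp only [pth_cons, pth_single, idem_mul_arr, mul_assoc, idem_mul_arr_mul] at h
  exact h

theorem arr_14_41 : arr q v1 v4 * arr q v4 v1 =
    q • (arr q v5 v4 * (arr q v6 v5 * (arr q v5 v6 * arr q v4 v5))) := by
  have h : pth q [v4, v1, v4] = mk6 q (q • path K adj6 [v4, v5, v6, v5, v4]) := pth_rel q .r414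
  rw [map_smul] at h
  change _ = q • pth q [v4, v5, v6, v5, v4] at h
  simp only [pth_cons, pth_single, idem_mul_arr, mul_assoc, idem_mul_arr_mul] at h
  exact h

/-- The versions with a tail z let the rules apply inside right-associated words. -/
theorem arr_41_54_mul (z : Alg6 q) : arr q v4 v1 * (arr q v5 v4 * z) =
    arr q v2 v1 * (arr q v3 v2 * (arr q v5 v3 * z)) := by
  simp only [← mul_assoc, arr_41_54]

theorem arr_12_21_mul (z : Alg6 q) : arr q v1 v2 * (arr q v2 v1 * z) =
    arr q v3 v2 * (arr q v2 v3 * z) := by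
  rw [← mul_assoc, arr_12_21, mul_assoc]

theorem arr_23_32_mul (z : Alg6 q) : arr q v2 v3 * (arr q v3 v2 * z) =
    arr q v5 v3 * (arr q v3 v5 * z) := by
  rw [← mul_assoc, arr_23_32, mul_assoc]

theorem arr_35_53_mul (z : Alg6 q) : arr q v3 v5 * (arr q v5 v3 * z) =
    arr q v6 v5 * (arr q v5 v6 * z) := by
  rw [← mul_assoc, arr_35_53, mul_assoc]

theorem arr_45_54_mul (z : Alg6 q) : arr q v4 v5 * (arr q v5 v4 * z) =
    arr q v6 v5 * (arr q v5 v6 * z) := by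
  rw [← mul_assoc, arr_45_54, mul_assoc]

theorem arr_56_65_mul (z : Alg6 q) : arr q v5 v6 * (arr q v6 v5 * z) = 0 := by
  rw [← mul_assoc, arr_56_65, zero_mul]

theorem arr_14_21_mul (z : Alg6 q) : arr q v1 v4 * (arr q v2 v1 * z) =
    arr q v5 v4 * (arr q v3 v5 * (arr q v2 v3 * z)) := by
  simp only [← mul_assoc, arr_14_21]

/-! ### The basis elements and their structure constants -/

/-- The chosen ascending path from `i` to `k`. -/
def upPath : Vtx → Vtx → List Vtx
  | v1, v1 => [v1] | v1, v2 => [v1, v2] | v1, v3 => [v1, v2, v3] | v1, v4 => [v1, v4]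
  | v1, v5 => [v1, v2, v3, v5] | v1, v6 => [v1, v2, v3, v5, v6]
  | v2, v2 => [v2] | v2, v3 => [v2, v3] | v2, v5 => [v2, v3, v5] | v2, v6 => [v2, v3, v5, v6]
  | v3, v3 => [v3] | v3, v5 => [v3, v5] | v3, v6 => [v3, v5, v6]
  | v4, v4 => [v4] | v4, v5 => [v4, v5] | v4, v6 => [v4, v5, v6]
  | v5, v5 => [v5] | v5, v6 => [v5, v6]
  | v6, v6 => [v6]
  | _, _ => []

/-- The ascending path from `i` to `k`. -/
noncomputable def up (k i : Vtx) : Alg6 q := pth q (upPath i k)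

/-- The descending path from `k` to `j`. -/
noncomputable def dn (j k : Vtx) : Alg6 q := pth q (upPath j k).reverse

/-- The path that ascends from `i` to `k` and descends to `j`. -/
noncomputable def pp (j k i : Vtx) : Alg6 q := dn q j k * up q k i

/-- The index `r` such that `p m l j * p j k i` is a multiple of `p m r i`. -/
def tbl : Vtx → Vtx → Vtx → Option Vtx := fun l j k =>
  if l = j then some k else if k = j then some l else
  match j, l, k with
  | v1, v2, v2 => some v3
  | v1, v2, v3 | v1, v3, v2 | v1, v2, v4 | v1, v4, v2 => some v5
  | v1, v2, v5 | v1, v5, v2 | v1, v3, v3 | v1, v3, v4 | v1, v4, v3 | v1, v4, v4 => some v6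
  | v2, v3, v3 => some v5
  | v2, v3, v5 | v2, v5, v3 => some v6
  | v3, v5, v5 => some v6
  | v4, v5, v5 => some v6
  | _, _, _ => none

/-- The coefficient of `p m r i` in `p m l j * p j k i`, for `r = tbl l j k`. -/
def tblCoeff (l j k : Vtx) : K := if l = v4 ∧ j = v1 ∧ k = v4 then q else 1

/-- The structure constants. -/
def strConst (l j k r : Vtx) : K := if tbl l j k = some r then tblCoeff q l j k else 0

theorem dn_mul_dn {j k l : Vtx} (h1 : j ≤ k) (h2 : k ≤ l) : dn q j k * dn q k l = dn q j l := by
  revert h1 h2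
  cases j <;> cases k <;> cases l <;> intro h1 h2 <;>
  first
  | exact absurd h1 (by decide)
  | exact absurd h2 (by decide)
  | simp only [dn, upPath, List.reverse_cons, List.reverse_nil, List.nil_append,
      List.cons_append, pth_cons, pth_single, idem_mul_arr, mul_assoc, idem_mul_arr_mul,
      arr_mul_idem, idem6_mul_self, arr_41_54, arr_41_54_mul]

theorem up_mul_up {j k l : Vtx} (h1 : j ≤ k) (h2 : k ≤ l) : up q l k * up q k j = up q l j := by
  revert h1 h2
  cases j <;> cases k <;> cases l <;> intro h1 h2 <;>
  first
  | exact absurd h1 (by decide)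
  | exact absurd h2 (by decide)
  | simp only [up, upPath, pth_cons, pth_single, idem_mul_arr, mul_assoc, idem_mul_arr_mul,
      arr_mul_idem, idem6_mul_self, arr_45_14]

/-- The core computation: a valley becomes a peak. Give 1, 2, 3, 5, 6 the heights 0 to 4, and 4 the
height 2; for a proper valley the peak is then at the vertex of height l + k - j, or the product is
0 if this exceeds 4. The scalar q occurs only for l = k = 4, j = 1. -/
theorem up_mul_dn {l j k : Vtx} (h1 : j ≤ l) (h2 : j ≤ k) :
    up q l j * dn q j k = ∑ r, strConst q l j k r • pp q l r k := by
  have h : up q l j * dn q j k = match tbl l j k with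
      | some r => tblCoeff q l j k • pp q l r k
      | none => 0 := by
    revert h1 h2
    cases j <;> cases k <;> cases l <;> intro h1 h2 <;>
    first
    | exact absurd h1 (by decide)
    | exact absurd h2 (by decide)
    | simp [up, dn, pp, tbl, tblCoeff, upPath, pth_cons, pth_single, idem_mul_arr, mul_assoc,
        idem_mul_arr_mul, arr_mul_idem, idem6_mul_self, arr_45_14, arr_41_54,
        arr_41_54_mul, arr_12_21, arr_12_21_mul, arr_23_32, arr_23_32_mul, arr_35_53,
        arr_35_53_mul, arr_45_54, arr_45_54_mul, arr_56_65, arr_56_65_mul, arr_12_41,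
        arr_14_21, arr_14_21_mul, arr_14_41]
  rw [h]
  simp only [strConst]
  cases tbl l j k <;> simp [ite_smul]

end SixVertices
end OneQH

namespace OneQH
open Vtx

/-! ### The path basis of A -/

section SixVertices

variable {K : Type u} [Field K] (q : K)

/-- Induction over the generators of the algebra. -/
theorem alg6_adjoin : Algebra.adjoin K (Set.range (idem6 q) ∪
    {a | ∃ i j, adj6 i j = true ∧ a = arr q i j}) = ⊤ := by
  rw [eq_top_iff]
  intro a _
  obtain ⟨b, rfl⟩ := RingQuot.mkAlgHom_surjective K (Rel6 q) a
  obtain ⟨c, rfl⟩ := RingQuot.mkAlgHom_surjective K (PathRel K adj6) b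
  change mk6 q (pathMk K adj6 c) ∈ _
  induction c using FreeAlgebra.induction with
  | grade0 r =>
    rw [AlgHom.commutes, AlgHom.commutes]
    exact Subalgebra.algebraMap_mem _ r
  | grade1 x =>
    refine Algebra.subset_adjoin ?_
    rcases x with i | ⟨⟨i, j⟩, h⟩
    · exact Or.inl ⟨i, rfl⟩
    · refine Or.inr ⟨i, j, h, ?_⟩
      have h' : adj6 i j = true := h
      simp [arr, arrow, h']
  | mul a b ha hb => rw [map_mul, map_mul]; exact Subalgebra.mul_mem _ (ha trivial) (hb trivial)
  | add a b ha hb => rw [map_add, map_add]; exact Subalgebra.add_mem _ (ha trivial) (hb trivial)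

theorem pp_self (i : Vtx) : pp q i i i = idem6 q i := by
  cases i <;> simp [pp, up, dn, upPath, pth_single, idem6_mul_self]

theorem up_self (i : Vtx) : up q i i = idem6 q i := by cases i <;> rfl

theorem dn_self (i : Vtx) : dn q i i = idem6 q i := by cases i <;> rfl

theorem up_mul_idem {k i : Vtx} (h : i ≤ k) : up q k i * idem6 q i = up q k i := by
  rw [← up_self, up_mul_up q le_rfl h]

theorem idem_mul_dn {j k : Vtx} (h : j ≤ k) : idem6 q j * dn q j k = dn q j k := by
  rw [← dn_self, dn_mul_dn q le_rfl h]

theorem adj6_le : ∀ i j, adj6 i j = true → (i < j ∨ j < i) := by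
  have : ∀ i j, adj6 i j = true → ((i ≤ j ∧ ¬ j ≤ i) ∨ (j ≤ i ∧ ¬ i ≤ j)) := by decide
  exact this

theorem arr_eq_up {i j : Vtx} (h : adj6 i j = true) (hij : i < j) : arr q i j = up q j i := by
  revert h hij
  cases i <;> cases j <;> intro h hij <;>
  first
  | exact absurd h (by decide)
  | exact absurd hij.le (by decide)
  | simp [up, upPath, pth_cons, pth_single, idem_mul_arr]

theorem arr_eq_dn {i j : Vtx} (h : adj6 i j = true) (hij : j < i) : arr q i j = dn q j i := by
  revert h hij
  cases i <;> cases j <;> intro h hij <;>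
  first
  | exact absurd h (by decide)
  | exact absurd hij.le (by decide)
  | simp [dn, upPath, pth_cons, pth_single, idem_mul_arr]

theorem arr_eq_pp_up {i j : Vtx} (h : adj6 i j = true) (hij : i < j) : arr q i j = pp q j j i := by
  rw [arr_eq_up q h hij, pp, dn_self, ← up_self, up_mul_up q hij.le le_rfl]

theorem arr_eq_pp_dn {i j : Vtx} (h : adj6 i j = true) (hij : j < i) : arr q i j = pp q j i i := by
  rw [arr_eq_dn q h hij, pp, up_self, ← dn_self, dn_mul_dn q hij.le le_rfl]

theorem strConst_ge {l j k r : Vtx} (h1 : j ≤ l) (h2 : j ≤ k) (h : strConst q l j k r ≠ 0) :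
    l ≤ r ∧ k ≤ r := by
  have key : ∀ l j k, j ≤ l → j ≤ k → ∀ r, tbl l j k = some r → l ≤ r ∧ k ≤ r := by decide
  refine key l j k h1 h2 r ?_
  by_contra hne
  exact h (if_neg hne)

/-- Only the inner valley has to be rewritten; the outer paths are absorbed by concatenation. This
is why the constants do not depend on m and i. -/
theorem pp_mul {m l j k i : Vtx} (hm : m ≤ l) (hj : j ≤ l) (hk : j ≤ k) (hi : i ≤ k) :
    pp q m l j * pp q j k i = ∑ r, strConst q l j k r • pp q m r i := by
  rw [pp, pp, mul_assoc, ← mul_assoc (up q l j), up_mul_dn q hj hk, Finset.sum_mul,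
    Finset.mul_sum]
  refine Finset.sum_congr rfl fun r _ => ?_
  by_cases h : strConst q l j k r = 0
  · rw [h, zero_smul, zero_smul, zero_mul, mul_zero]
  · have h1 := strConst_ge q hj hk h
    rw [smul_mul_assoc, mul_smul_comm, pp, mul_assoc, up_mul_up q hi h1.2, ← mul_assoc,
      dn_mul_dn q hm h1.1, pp]

theorem pp_mul_ne {m l j j' k i : Vtx} (hj : j ≤ l) (hj' : j' ≤ k) (h : j ≠ j') :
    pp q m l j * pp q j' k i = 0 := by
  rw [pp, pp, ← up_mul_idem q hj, ← idem_mul_dn q hj']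
  simp only [mul_assoc]
  rw [← mul_assoc (idem6 q j), idem6_mul_ne q h, zero_mul, mul_zero, mul_zero]

/-- The span contains 1 and the arrows and is closed under products, so it is a subalgebra
containing the generators. -/
theorem span_pp : ⊤ ≤ Submodule.span K (Set.range
    (fun x : {x : Vtx × Vtx × Vtx // x.1 ≤ x.2.1 ∧ x.2.2 ≤ x.2.1} =>
      pp q x.1.1 x.1.2.1 x.1.2.2)) := by
  set V := Submodule.span K (Set.range
    (fun x : {x : Vtx × Vtx × Vtx // x.1 ≤ x.2.1 ∧ x.2.2 ≤ x.2.1} =>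
      pp q x.1.1 x.1.2.1 x.1.2.2)) with hV
  have hp : ∀ j k i, j ≤ k → i ≤ k → pp q j k i ∈ V := fun j k i hj hi =>
    Submodule.subset_span ⟨⟨(j, k, i), hj, hi⟩, rfl⟩
  have h1 : (1 : Alg6 q) ∈ V := by
    rw [← sum_idem6]
    exact Submodule.sum_mem _ fun i _ => by rw [← pp_self]; exact hp i i i le_rfl le_rfl
  have hm : ∀ x y, x ∈ V → y ∈ V → x * y ∈ V := by
    intro x y hx hy
    have := Submodule.mul_mem_mul hx hy
    rw [hV, Submodule.span_mul_span] at this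
    refine (Submodule.span_le.2 ?_) this
    rintro _ ⟨_, ⟨⟨⟨m, l, j⟩, hm, hj⟩, rfl⟩, _, ⟨⟨⟨j', k, i⟩, hj', hi⟩, rfl⟩, rfl⟩
    change pp q m l j * pp q j' k i ∈ V
    by_cases h : j = j'
    · subst h
      rw [pp_mul q hm hj hj' hi]
      refine Submodule.sum_mem _ fun r _ => ?_
      by_cases h : strConst q l j k r = 0
      · rw [h, zero_smul]; exact Submodule.zero_mem _
      · have h1 := strConst_ge q hj hj' h
        exact Submodule.smul_mem _ _ (hp _ _ _ (hm.trans h1.1) (hi.trans h1.2))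
    · rw [pp_mul_ne q hj hj' h]; exact Submodule.zero_mem _
  intro x _
  have hx : x ∈ Algebra.adjoin K (Set.range (idem6 q) ∪
    {a | ∃ i j, adj6 i j = true ∧ a = arr q i j}) := by rw [alg6_adjoin]; trivial
  have hle : Algebra.adjoin K (Set.range (idem6 q) ∪
      {a | ∃ i j, adj6 i j = true ∧ a = arr q i j}) ≤ V.toSubalgebra h1 hm := by
    refine Algebra.adjoin_le ?_
    rintro _ (⟨i, rfl⟩ | ⟨i, j, h, rfl⟩)
    · rw [← pp_self]; exact hp i i i le_rfl le_rfl
    · rcases adj6_le i j h with h2 | h2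
      · rw [arr_eq_pp_up q h h2]; exact hp _ _ _ le_rfl h2.le
      · rw [arr_eq_pp_dn q h h2]; exact hp _ _ _ h2.le le_rfl
  exact hle hx

/-! ### The representation on `P(1)` in coordinates -/

/-- The image of the basis vector `x` under the arrow `i → j`. -/
noncomputable def arrowVec (i j : Vtx) (x : Vtx × Vtx) : Vtx × Vtx →₀ K :=
  if x.1 = i ∧ Vtx.leB i x.2 = true then
    if Vtx.leB j i = true then Finsupp.single (j, x.2) 1 else
      match tbl j i x.2 with
      | some r => Finsupp.single (j, r) (tblCoeff q j i x.2)
      | none => 0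
  else 0

/-- The action of the arrow `i → j`. -/
noncomputable def arrowOp (i j : Vtx) : Module.End K (Vtx × Vtx →₀ K) :=
  Finsupp.linearCombination K (arrowVec q i j)

/-- The action of the vertex `i`. -/
noncomputable def vertexOp (K : Type u) [Field K] (i : Vtx) : Module.End K (Vtx × Vtx →₀ K) :=
  Finsupp.linearCombination K fun x => if x.1 = i then Finsupp.single x 1 else 0

theorem arrowOp_single (i j : Vtx) (x : Vtx × Vtx) (c : K) :
    arrowOp q i j (Finsupp.single x c) = c • arrowVec q i j x :=
  Finsupp.linearCombination_single _ _ _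

theorem vertexOp_single (i : Vtx) (x : Vtx × Vtx) (c : K) :
    vertexOp K i (Finsupp.single x c) =
      c • if x.1 = i then Finsupp.single x 1 else 0 :=
  Finsupp.linearCombination_single _ _ _

/-- The representation of the free algebra. -/
noncomputable def repFree : FreeAlgebra K (Vtx ⊕ Arrow adj6) →ₐ[K]
    Module.End K (Vtx × Vtx →₀ K) :=
  FreeAlgebra.lift K (Sum.elim (vertexOp K) (fun a => arrowOp q a.1.1 a.1.2))

theorem end_ext {f g : Module.End K (Vtx × Vtx →₀ K)}
    (h : ∀ a k, f (Finsupp.single (a, k) 1) = g (Finsupp.single (a, k) 1)) : f = g :=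
  Finsupp.lhom_ext' fun ⟨a, k⟩ => LinearMap.ext_ring (h a k)

theorem repFree_rel {x y : FreeAlgebra K (Vtx ⊕ Arrow adj6)} (h : PathRel K adj6 x y) :
    repFree q x = repFree q y := by
  induction h with
  | idem i =>
    simp only [map_mul, repFree, FreeAlgebra.lift_ι_apply, Sum.elim_inl]
    refine end_ext fun a k => ?_
    simp only [Module.End.mul_apply, vertexOp_single, one_smul]
    split_ifs with h <;> simp [vertexOp_single, h]
  | orth i j hij =>
    simp only [map_mul, map_zero, repFree, FreeAlgebra.lift_ι_apply, Sum.elim_inl]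
    refine end_ext fun a k => ?_
    simp only [Module.End.mul_apply, vertexOp_single, one_smul]
    split_ifs with h
    · subst h; simp [vertexOp_single, Ne.symm hij]
    · simp
  | one =>
    simp only [map_sum, map_one, repFree, FreeAlgebra.lift_ι_apply, Sum.elim_inl]
    refine end_ext fun a k => ?_
    simp [LinearMap.sum_apply, vertexOp_single]
  | source a =>
    simp only [map_mul, repFree, FreeAlgebra.lift_ι_apply, Sum.elim_inl, Sum.elim_inr]
    refine end_ext fun b k => ?_
    simp only [Module.End.mul_apply, vertexOp_single, one_smul]
    split_ifs with h
    · rfl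
    · simp [arrowOp_single, arrowVec, h]
  | target a =>
    simp only [map_mul, repFree, FreeAlgebra.lift_ι_apply, Sum.elim_inl, Sum.elim_inr]
    refine end_ext fun b k => ?_
    simp only [Module.End.mul_apply, arrowOp_single, one_smul, arrowVec]
    split_ifs with h h1
    · simp [vertexOp_single]
    · cases tbl a.1.2 a.1.1 k <;> simp [vertexOp_single]
    · simp

/-- The representation of the path algebra. -/
noncomputable def repPath : PathAlgebra K adj6 →ₐ[K] Module.End K (Vtx × Vtx →₀ K) :=
  RingQuot.liftAlgHom K ⟨repFree q, fun {_ _} h => repFree_rel q h⟩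

theorem repPath_mk (x : FreeAlgebra K (Vtx ⊕ Arrow adj6)) :
    repPath q (pathMk K adj6 x) = repFree q x :=
  RingQuot.liftAlgHom_mkAlgHom_apply K _ _ x

theorem repPath_vertex (i : Vtx) : repPath q (vertex K adj6 i) = vertexOp K i := by
  rw [vertex, repPath_mk, repFree, FreeAlgebra.lift_ι_apply, Sum.elim_inl]

theorem repPath_arrow {i j : Vtx} (h : adj6 i j = true) :
    repPath q (arrow K adj6 i j) = arrowOp q i j := by
  rw [arrow, dif_pos h, repPath_mk, repFree, FreeAlgebra.lift_ι_apply, Sum.elim_inr]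

/-- A finite check of the ten relations on all vectors (a,k). Vectors with a ≰ k correspond to
nothing in P(1); they do no harm, as every arrow kills them. -/
theorem repPath_rel {x y : PathAlgebra K adj6} (h : Rel6 q x y) : repPath q x = repPath q y := by
  induction h
  all_goals
    simp only [path, map_mul, map_smul, map_zero, repPath_vertex]
    repeat rw [repPath_arrow q (by rfl)]
    refine end_ext fun a k => ?_
    cases a <;> cases k <;>
      simp [Module.End.mul_apply, arrowOp_single, arrowVec, vertexOp_single, tbl, tblCoeff,
        Vtx.leB]

/-- The representation of the algebra on `P(1)`, in coordinates. -/
noncomputable def rep6 : Alg6 q →ₐ[K] Module.End K (Vtx × Vtx →₀ K) :=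
  RingQuot.liftAlgHom K ⟨repPath q, fun {_ _} h => repPath_rel q h⟩

theorem rep6_mk (x : PathAlgebra K adj6) : rep6 q (mk6 q x) = repPath q x :=
  RingQuot.liftAlgHom_mkAlgHom_apply K _ _ x

theorem rep6_idem (i : Vtx) : rep6 q (idem6 q i) = vertexOp K i := by
  rw [idem6, pth, path, rep6_mk, repPath_vertex]

theorem rep6_arr {i j : Vtx} (h : adj6 i j = true) : rep6 q (arr q i j) = arrowOp q i j := by
  rw [arr, rep6_mk, repPath_arrow q h]

theorem rep6_up {i k : Vtx} (h : i ≤ k) :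
    rep6 q (up q k i) (Finsupp.single (i, i) 1) = Finsupp.single (k, k) 1 := by
  revert h
  cases i <;> cases k <;> intro h <;>
  first
  | exact absurd h (by decide)
  | (simp only [up, upPath, pth_cons, pth_single, map_mul, rep6_idem]
     repeat rw [rep6_arr q (by rfl)]
     simp [Module.End.mul_apply, arrowOp_single, arrowVec, vertexOp_single, tbl, tblCoeff,
        Vtx.leB])

theorem rep6_dn {j k : Vtx} (h : j ≤ k) :
    rep6 q (dn q j k) (Finsupp.single (k, k) 1) = Finsupp.single (j, k) 1 := by
  revert h
  cases j <;> cases k <;> intro h <;>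
  first
  | exact absurd h (by decide)
  | (simp only [dn, upPath, List.reverse_cons, List.reverse_nil, List.nil_append,
      List.cons_append, pth_cons, pth_single, map_mul, rep6_idem]
     repeat rw [rep6_arr q (by rfl)]
     simp [Module.End.mul_apply, arrowOp_single, arrowVec, vertexOp_single, tbl, tblCoeff,
        Vtx.leB])

/-- The vector (j,k) stands for p(j,k,1). The diagonal vectors (a,a) separate the starting points i,
so this one representation detects all basis elements, not only those in P(1). -/
theorem rep6_pp {j k i : Vtx} (hj : j ≤ k) (hi : i ≤ k) (a : Vtx) :
    rep6 q (pp q j k i) (Finsupp.single (a, a) 1) =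
      if i = a then Finsupp.single (j, k) 1 else 0 := by
  rw [pp, map_mul, Module.End.mul_apply]
  split_ifs with h
  · subst h
    rw [rep6_up q hi, rep6_dn q hj]
  · rw [← up_mul_idem q hi, map_mul, Module.End.mul_apply, rep6_idem, vertexOp_single,
      if_neg (Ne.symm h)]
    simp

theorem linearIndependent_pp : LinearIndependent K
    (fun x : {x : Vtx × Vtx × Vtx // x.1 ≤ x.2.1 ∧ x.2.2 ≤ x.2.1} =>
      pp q x.1.1 x.1.2.1 x.1.2.2) := by
  rw [Fintype.linearIndependent_iff]
  rintro g hg ⟨⟨j, k, i⟩, hj, hi⟩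
  have h1 := congrArg (fun f => rep6 q f (Finsupp.single (i, i) 1) (j, k)) hg
  simp only [map_sum, map_smul, LinearMap.sum_apply, LinearMap.smul_apply, map_zero,
    LinearMap.zero_apply, Finsupp.coe_zero, Pi.zero_apply, Finsupp.finsetSum_apply,
    Finsupp.smul_apply] at h1
  rw [Finset.sum_eq_single ⟨(j, k, i), hj, hi⟩] at h1
  · rw [rep6_pp q hj hi, if_pos rfl] at h1
    simpa using h1
  · rintro ⟨⟨j', k', i'⟩, hj', hi'⟩ - hne
    rw [rep6_pp q hj' hi']
    split_ifs with h
    · subst h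
      rw [Finsupp.single_apply, if_neg, smul_zero]
      intro h2
      simp only [Prod.mk.injEq] at h2
      obtain ⟨rfl, rfl⟩ := h2
      exact hne rfl
    · simp
  · simp

/-- The basis of the algebra that consists of the paths `p j k i`. -/
noncomputable def basis6 : TriangularBasis K (idem6 q) where
  p := pp q
  γ := strConst q
  linInd := linearIndependent_pp q
  span := span_pp q
  p_self := pp_self q
  mul_p := pp_mul q
  mul_p_ne _ hj hj' _ h := pp_mul_ne q hj hj' h
  γ_ge := strConst_ge q
  γ_left_ne {j k r} h hr := by simp [strConst, tbl, Ne.symm hr]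
  γ_left {j k} h := by
    have : ¬ (j = v4 ∧ j = v1 ∧ k = v4) := by rintro ⟨rfl, h, -⟩; exact absurd h (by decide)
    simp [strConst, tbl, tblCoeff, this]
  γ_right_ne {j k r} h hr := by
    have : tbl k j j = some k := by cases j <;> cases k <;> rfl
    simp [strConst, this, Ne.symm hr]
  γ_right {j k} h := by
    have : tbl k j j = some k := by cases j <;> cases k <;> rfl
    have h2 : ¬ (k = v4 ∧ j = v1 ∧ j = v4) := by
      rintro ⟨-, rfl, h⟩; exact absurd h (by decide)
    simp only [strConst, this, if_true, tblCoeff, if_neg h2]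
  γ_lt_left {l j k} hl hk := by
    have key : ∀ l j k, j ≤ l → j ≤ k → ¬ k ≤ j → tbl l j k ≠ some l := by decide
    exact if_neg (key l j k hl hk.le (not_le_of_gt hk))
  γ_lt_right {l j k} hl hk := by
    have key : ∀ l j k, j ≤ l → ¬ l ≤ j → j ≤ k → tbl l j k ≠ some k := by decide
    exact if_neg (key l j k hl.le (not_le_of_gt hl) hk)

end SixVertices
end OneQH

namespace OneQH
open Vtx

set_option linter.unusedSimpArgs false

/-! ### Nondegeneracy of the pairings for A and for A(i), i ≠ 5 -/

section SixVertices

variable {K : Type u} [Field K] (q : K)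

theorem sum_vtx {M : Type*} [AddCommMonoid M] (f : Vtx → M) :
    ∑ i, f i = f v1 + (f v2 + (f v3 + (f v4 + (f v5 + f v6)))) := by
  change ∑ i ∈ ({v1, v2, v3, v4, v5, v6} : Finset Vtx), f i = _
  simp

theorem v1_le (i : Vtx) : v1 ≤ i := by cases i <;> decide

theorem le_v6 (i : Vtx) : i ≤ v6 := by cases i <;> decide

theorem strConst_symm {l j k : Vtx} (r : Vtx) (h1 : j ≤ l) (h2 : j ≤ k) :
    strConst q l j k r = strConst q k j l r := by
  have key : ∀ l j k, j ≤ l → j ≤ k → tbl l j k = tbl k j l := by decide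
  have h3 : tblCoeff q l j k = tblCoeff q k j l := by
    simp only [tblCoeff]
    congr 1
    simp only [eq_iff_iff]
    tauto
  rw [strConst, strConst, key l j k h1 h2, h3]

/-- The pairings given by the coefficient at `i₀ ≠ 5` are nondegenerate. -/
theorem strConst_nondeg (hq : q ≠ 1) {i₀ : Vtx} (hi : i₀ ≠ v5) {j : Vtx} (hj : j ≤ i₀) (v : Vtx → K)
    (h0 : ∀ k, ¬ (j ≤ k ∧ k ≤ i₀) → v k = 0)
    (h : ∀ l, j ≤ l → l ≤ i₀ → ∑ k, strConst q l j k i₀ * v k = 0) : v = 0 := by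
  have h1 : ∀ k, (!(Vtx.leB j k && Vtx.leB k i₀)) = true → v k = 0 := fun k hk => h0 k (by
    rintro ⟨h2, h3⟩
    have h2' : Vtx.leB j k = true := h2
    have h3' : Vtx.leB k i₀ = true := h3
    simp [h2', h3'] at hk)
  have h2 : ∀ l, (Vtx.leB j l && Vtx.leB l i₀) = true → ∑ k, strConst q l j k i₀ * v k = 0 :=
    fun l hl => by
      rw [Bool.and_eq_true] at hl
      exact h l hl.1 hl.2
  simp only [sum_vtx] at h2
  have a1 := h1 v1
  have a2 := h1 v2
  have a3 := h1 v3
  have a4 := h1 v4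
  have a5 := h1 v5
  have a6 := h1 v6
  have b1 := h2 v1
  have b2 := h2 v2
  have b3 := h2 v3
  have b4 := h2 v4
  have b5 := h2 v5
  have b6 := h2 v6
  clear h h0 h1 h2
  suffices v v1 = 0 ∧ v v2 = 0 ∧ v v3 = 0 ∧ v v4 = 0 ∧ v v5 = 0 ∧ v v6 = 0 by
    funext k
    cases k <;> simp [this]
  -- For fixed i₀ and j the equations are solved by inspection, except for i₀ = 6, j = 1. The case
  -- i₀ = 5 has to be excluded: for j = 1 the vertices 3 and 4 both pair nontrivially only with 2,
  -- so their columns agree.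
  revert hj hi
  cases i₀ <;> intro hi <;> cases j <;> intro hj <;>
  first
  | exact absurd rfl hi
  | exact absurd hj (by decide)
  | (simp [strConst, tbl, tblCoeff, Vtx.leB] at a1 a2 a3 a4 a5 a6 b1 b2 b3 b4 b5 b6
     simp only [*, and_self, true_and, and_true, add_zero, zero_add] at *)
  -- The case i₀ = 6, j = 1: l = 3 gives v 3 + v 4 = 0, and l = 4 gives v 3 + q v 4 = 0. This is
  -- where q ≠ 1 enters.
  have h4 : (q - 1) * v v4 = 0 := by linear_combination b4 - b3
  have h5 := (mul_eq_zero.1 h4).resolve_left (sub_ne_zero.2 hq)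
  exact ⟨by simpa [h5] using b3, h5⟩

theorem isFrobenius6 (hq : q ≠ 1) : (basis6 q).IsFrobenius v1 v6 where
  bot_le := v1_le
  le_top := le_v6
  symm h1 h2 := strConst_symm q _ h1 h2
  nondeg j v h0 h := strConst_nondeg q hq (by decide) (le_v6 j) v
    (fun k hk => h0 k fun h => hk ⟨h, le_v6 k⟩) (fun l hl _ => h l hl)

theorem isFrobenius_trunc (hq : q ≠ 1) {i₀ : Vtx} (hi : i₀ ≠ v5) :
    ((basis6 q).trunc i₀).IsFrobenius ⟨v1, v1_le i₀⟩ ⟨i₀, le_rfl⟩ where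
  bot_le i := v1_le i.1
  le_top i := i.2
  symm h1 h2 := strConst_symm q _ h1 h2
  nondeg := by
    rintro ⟨j, hj⟩ v h0 h
    -- A vector on the vertices of A(i₀) is extended by 0 to all vertices.
    have key := strConst_nondeg q hq hi hj (fun k => if h : k ≤ i₀ then v ⟨k, h⟩ else 0)
      (fun k hk => by
        split_ifs with h1
        · exact h0 _ fun h2 => hk ⟨h2, h1⟩
        · rfl)
      (fun l hl hl' => by
        refine Eq.trans ?_ (h ⟨l, hl'⟩ hl)
        rw [← Finset.sum_subset (Finset.subset_univ (Finset.univ.filter (· ≤ i₀)))]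
        · rw [Finset.sum_subtype (p := (· ≤ i₀)) _ (by simp)]
          refine Finset.sum_congr rfl fun k _ => ?_
          rw [dif_pos k.2]
          rfl
        · intro k _ hk
          have : ¬ k ≤ i₀ := by simpa using hk
          rw [dif_neg this, mul_zero])
    funext k
    have := congrFun key k.1
    simpa [k.2] using this

theorem isBasicAlgebra_trunc (i₀ : Vtx) : IsBasicAlgebra K (truncIdem K (idem6 q) i₀) :=
  ((basis6 q).trunc i₀).isBasicAlgebra

theorem isOneQuasiHereditary_trunc (hq : q ≠ 1) {i₀ : Vtx} (hi : i₀ ≠ v5) :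
    IsOneQuasiHereditary K (truncIdem K (idem6 q) i₀) :=
  (isFrobenius_trunc q hq hi).isOneQuasiHereditary

end SixVertices
end OneQH

namespace OneQH

/-! ### A triangular basis on a chain and the Auslander algebra -/

section Auslander

variable {K : Type*} [Field K] {B : Type*} [CommRing B] [Algebra K B] (x : B) {m : ℕ}

/-- Multiplication by `x ^ (k - i)`, from the summand `(x^i)` to the summand `(x^j)`. -/
noncomputable def idealShift (j i : Fin m) (k : ℕ) (hj : (j : ℕ) ≤ k) (hi : (i : ℕ) ≤ k) :
    Module.End B (∀ i : Fin m, ↥(Ideal.span {x ^ (i : ℕ)})) :=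
  LinearMap.single B (fun i : Fin m => ↥(Ideal.span {x ^ (i : ℕ)})) j ∘ₗ
    LinearMap.codRestrict (Ideal.span {x ^ (j : ℕ)})
      (LinearMap.mulLeft B (x ^ (k - i)) ∘ₗ (Ideal.span {x ^ (i : ℕ)}).subtype)
      (fun v => by
        obtain ⟨b, hb⟩ := Ideal.mem_span_singleton'.1 v.2
        refine Ideal.mem_span_singleton.2 ⟨x ^ (k - j) * b, ?_⟩
        change x ^ (k - i) * v.1 = _
        rw [← hb, ← mul_assoc (x ^ (j : ℕ)), ← pow_add, Nat.add_sub_cancel' hj, mul_left_comm,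
          ← pow_add, Nat.sub_add_cancel hi, mul_comm]) ∘ₗ
    LinearMap.proj i

theorem idealShift_apply (j i : Fin m) (k : ℕ) (hj : (j : ℕ) ≤ k) (hi : (i : ℕ) ≤ k)
    (v : ∀ i : Fin m, ↥(Ideal.span {x ^ (i : ℕ)})) (a : Fin m) :
    (idealShift x j i k hj hi v a : B) = if a = j then x ^ (k - i) * (v i : B) else 0 := by
  change ((Pi.single j _ : ∀ i : Fin m, ↥(Ideal.span {x ^ (i : ℕ)})) a : B) = _
  split_ifs with h
  · subst h; rw [Pi.single_eq_same]; rfl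
  · rw [Pi.single_eq_of_ne h]; rfl

theorem end_ext_coe {f g : Module.End B (∀ i : Fin m, ↥(Ideal.span {x ^ (i : ℕ)}))}
    (h : ∀ v a, (f v a : B) = g v a) : f = g :=
  LinearMap.ext fun v => funext fun a => Subtype.ext (h v a)

/-- The shift with index k sends the generator x^i of its source to x^k. Composition therefore adds
heights and subtracts that of the middle summand, as in A. -/
theorem idealShift_mul (a j i : Fin m) (l k : ℕ) (ha : (a : ℕ) ≤ l) (hj : (j : ℕ) ≤ l)
    (hj' : (j : ℕ) ≤ k) (hi : (i : ℕ) ≤ k) (r : ℕ) (hr : r + j = l + k) (har : (a : ℕ) ≤ r)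
    (hir : (i : ℕ) ≤ r) :
    idealShift x a j l ha hj * idealShift x j i k hj' hi = idealShift x a i r har hir := by
  refine end_ext_coe x fun v b => ?_
  rw [Module.End.mul_apply, idealShift_apply, idealShift_apply, idealShift_apply, if_pos rfl,
    ← mul_assoc, ← pow_add]
  congr 3
  omega

theorem idealShift_mul_ne (a j j' i : Fin m) (l k : ℕ) (ha : (a : ℕ) ≤ l) (hj : (j : ℕ) ≤ l)
    (hj' : (j' : ℕ) ≤ k) (hi : (i : ℕ) ≤ k) (h : j ≠ j') :
    idealShift x a j l ha hj * idealShift x j' i k hj' hi = 0 := by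
  refine end_ext_coe x fun v b => ?_
  rw [Module.End.mul_apply, idealShift_apply, idealShift_apply, if_neg h]
  simp

theorem idealShift_eq_zero (hx : x ^ m = 0) (j i : Fin m) (k : ℕ) (hj : (j : ℕ) ≤ k)
    (hi : (i : ℕ) ≤ k) (hk : m ≤ k) : idealShift x j i k hj hi = 0 := by
  refine end_ext_coe x fun v b => ?_
  rw [idealShift_apply]
  obtain ⟨c, hc⟩ := Ideal.mem_span_singleton'.1 (v i).2
  have : x ^ (k - i) * (v i : B) = 0 := by
    rw [← hc, mul_comm c, ← mul_assoc, ← pow_add, Nat.sub_add_cancel hi,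
      ← Nat.sub_add_cancel hk, pow_add, hx, mul_zero, zero_mul]
  rw [this]
  simp

-- Multiplication by x^(i-1-k) brings the k-th term to the power x^(m-1) ≠ 0. Later terms then
-- contain x^m = 0, and earlier coefficients vanish by induction.
include K in
theorem coeff_eq_zero_of_pow_mul (hx : x ^ m = 0) (hx' : x ^ (m - 1) ≠ 0) (c : ℕ → K) {i : ℕ}
    (hi : i ≤ m) (h : x ^ (m - i) * ∑ k ∈ Finset.range m, c k • x ^ k = 0) :
    ∀ k < i, c k = 0 := by
  intro k
  induction k using Nat.strong_induction_on with
  | _ k ih =>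
    intro hk
    have h1 : x ^ (i - 1 - k) * (x ^ (m - i) * ∑ k ∈ Finset.range m, c k • x ^ k) = 0 := by
      rw [h, mul_zero]
    rw [← mul_assoc, ← pow_add, Finset.mul_sum, Finset.sum_eq_single k] at h1
    · rw [mul_smul_comm, ← pow_add, show i - 1 - k + (m - i) + k = m - 1 by omega] at h1
      exact (smul_eq_zero.1 h1).resolve_right hx'
    · intro l _ hl
      rcases lt_or_gt_of_ne hl with h2 | h2
      · rw [ih l h2 (h2.trans hk), zero_smul, mul_zero]
      · rw [mul_smul_comm, ← pow_add,
          show i - 1 - k + (m - i) + l = m + (l - k - 1) by omega, pow_add, hx, zero_mul, smul_zero]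
    · intro hk'
      exact absurd (Finset.mem_range.2 (hk.trans_le hi)) hk'

/-- An algebra with a triangular basis indexed by a chain, with the structure constants of the
Auslander algebra of a truncated polynomial ring, is isomorphic to this Auslander algebra. -/
theorem TriangularBasis.nonempty_algEquiv {A : Type*} [Ring A] [Algebra K A] {ι : Type*} [Fintype ι]
    [PartialOrder ι] {e : ι → A} (D : TriangularBasis K e) (hx : x ^ m = 0)
    (hx' : x ^ (m - 1) ≠ 0) (hgen : ∀ y : B, ∃ c : ℕ → K, y = ∑ k ∈ Finset.range m, c k • x ^ k)
    (σ : ι ≃ Fin m) (hσ : ∀ i j, i ≤ j ↔ σ i ≤ σ j)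
    (hγ : ∀ l j k r, j ≤ l → j ≤ k →
      D.γ l j k r = if (σ r : ℕ) + σ j = σ l + σ k then 1 else 0) :
    Nonempty (A ≃ₐ[K] Module.End B (∀ i : Fin m, ↥(Ideal.span {x ^ (i : ℕ)}))) := by
  classical
  let φ : A →ₗ[K] Module.End B (∀ i : Fin m, ↥(Ideal.span {x ^ (i : ℕ)})) :=
    D.basis.constr K fun y => idealShift x (σ y.1.1) (σ y.1.2.2) (σ y.1.2.1)
      ((hσ _ _).1 y.2.1) ((hσ _ _).1 y.2.2)
  have hφ : ∀ j k i (hj : j ≤ k) (hi : i ≤ k), φ (D.p j k i) =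
      idealShift x (σ j) (σ i) (σ k) ((hσ _ _).1 hj) ((hσ _ _).1 hi) := by
    intro j k i hj hi
    rw [← D.basis_apply hj hi]
    exact D.basis.constr_basis K _ _
  have hmul : ∀ a b, φ (a * b) = φ a * φ b := by
    intro a b
    induction a using D.induction_on with
    | zero => simp
    | add a a' ha ha' => rw [add_mul, map_add, ha, ha', map_add, add_mul]
    | smul c a ha => rw [smul_mul_assoc, map_smul, ha, map_smul, smul_mul_assoc]
    | hp m' l j hm hj =>
      induction b using D.induction_on with
      | zero => simp
      | add a a' ha ha' => rw [mul_add, map_add, ha, ha', map_add, mul_add]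
      | smul c a ha => rw [mul_smul_comm, map_smul, ha, map_smul, mul_smul_comm]
      | hp j' k i hj' hi =>
        rw [hφ _ _ _ hm hj, hφ _ _ _ hj' hi]
        by_cases h : j = j'
        · subst h
          rw [D.mul_p hm hj hj' hi, map_sum]
          have h1 := (hσ _ _).1 hm
          have h2 := (hσ _ _).1 hj
          have h3 := (hσ _ _).1 hj'
          have h4 := (hσ _ _).1 hi
          rw [Fin.le_def] at h1 h2 h3 h4
          rw [idealShift_mul x (σ m') (σ j) (σ i) (σ l) (σ k) h1 h2 h3 h4
            (σ l + σ k - σ j) (by omega) (by omega) (by omega)]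
          by_cases hr : (σ l : ℕ) + σ k - σ j < m
          · rw [Finset.sum_eq_single (σ.symm ⟨_, hr⟩)]
            · have h5 : (σ (σ.symm ⟨(σ l : ℕ) + σ k - σ j, hr⟩) : ℕ) = σ l + σ k - σ j := by simp
              rw [hγ _ _ _ _ hj hj', if_pos (by omega), one_smul, hφ]
              · congr 1
              · rw [hσ, Fin.le_def]; omega
              · rw [hσ, Fin.le_def]; omega
            · intro r _ hr'
              rw [hγ _ _ _ _ hj hj', if_neg, zero_smul, map_zero]
              intro h5
              apply hr'
              rw [Equiv.eq_symm_apply]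
              apply Fin.ext
              change (σ r : ℕ) = σ l + σ k - σ j
              omega
            · simp
          · rw [idealShift_eq_zero x hx _ _ _ _ _ (by omega)]
            refine Finset.sum_eq_zero fun r _ => ?_
            rw [hγ _ _ _ _ hj hj', if_neg, zero_smul, map_zero]
            have := (σ r).2
            omega
        · rw [D.mul_p_ne hm hj hj' hi h, map_zero, idealShift_mul_ne]
          exact fun h' => h (σ.injective h')
  have hone : φ 1 = 1 := by
    rw [← D.completeOrthogonalIdempotents.complete, map_sum]
    refine end_ext_coe x fun v a => ?_
    obtain ⟨a, rfl⟩ := σ.surjective a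
    rw [LinearMap.sum_apply, Finset.sum_apply, Submodule.coe_sum, Finset.sum_eq_single a]
    · rw [← D.p_self, hφ _ _ _ le_rfl le_rfl, idealShift_apply]
      simp
    · intro i _ hi
      rw [← D.p_self, hφ _ _ _ le_rfl le_rfl, idealShift_apply, if_neg]
      exact fun h => hi (σ.injective h).symm
    · simp
  -- Evaluate at the generator x^i of the i-th summand and compare coefficients of the powers of x.
  have hinj : Function.Injective φ := by
    rw [injective_iff_map_eq_zero]
    intro a ha
    refine D.ext_coeff fun j k i => ?_
    rw [map_zero]
    by_cases hk : j ≤ k ∧ i ≤ k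
    · let v : ∀ i : Fin m, ↥(Ideal.span {x ^ (i : ℕ)}) :=
        Pi.single (σ i) ⟨x ^ (σ i : ℕ), Ideal.mem_span_singleton_self _⟩
      have h1 : (φ a v (σ j) : B) = 0 := by rw [ha]; rfl
      have h2 : ∀ j' k' i', ((D.coeff j' k' i' a • φ (D.p j' k' i')) v (σ j) : B) =
          if j' = j then if i' = i then D.coeff j k' i a • x ^ (σ k' : ℕ) else 0 else 0 := by
        intro j' k' i'
        by_cases h : j' ≤ k' ∧ i' ≤ k'
        · rw [hφ _ _ _ h.1 h.2]
          change D.coeff j' k' i' a • (idealShift x _ _ _ _ _ v (σ j) : B) = _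
          rw [idealShift_apply]
          by_cases h3 : j' = j
          · subst h3
            by_cases h4 : i' = i
            · subst h4
              have h5 := (hσ _ _).1 h.2
              rw [Fin.le_def] at h5
              simp only [v, Pi.single_eq_same, if_true]
              rw [← pow_add, Nat.sub_add_cancel h5]
            · have h5 : σ i' ≠ σ i := fun h => h4 (σ.injective h)
              simp [v, h4, h5]
          · have h5 : σ j ≠ σ j' := fun h => h3 (σ.injective h.symm)
            simp [h3, h5]
        · rw [D.coeff_of_not h, zero_smul]
          split_ifs with h3 h4
          · subst h3 h4; rw [D.coeff_of_not h, zero_smul]; rfl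
          all_goals rfl
      rw [← D.sum_coeff a] at h1
      simp only [map_sum, map_smul, LinearMap.sum_apply, Finset.sum_apply, Submodule.coe_sum,
        h2] at h1
      have h3 : ∑ k, D.coeff j k i a • x ^ (σ k : ℕ) = 0 := by
        rw [← h1]
        simp
      have h4 : ∑ k ∈ Finset.range m, (if h : k < m then D.coeff j (σ.symm ⟨k, h⟩) i a else 0) •
          x ^ k = 0 := by
        rw [Finset.sum_range, ← h3, ← Equiv.sum_comp σ]
        simp
      have h5 := coeff_eq_zero_of_pow_mul x hx hx' _ le_rfl
        (by rw [Nat.sub_self, pow_zero, one_mul]; exact h4) (σ k) (σ k).2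
      simpa using h5
    · exact D.coeff_of_not hk a
  have hsurj : Function.Surjective φ := by
    intro F
    -- A homomorphism g from (x^i) to (x^j) is determined by g(x^i) = ∑ c k x^k. As x^(m-i) kills
    -- x^i, c k = 0 for k < i; as the value lies in (x^j), c k = 0 for k < j. So g is a combination
    -- of shifts.
    have key : ∀ (j i : Fin m) (g : ↥(Ideal.span {x ^ (i : ℕ)}) →ₗ[B] ↥(Ideal.span {x ^ (j : ℕ)})),
        LinearMap.single B (fun i : Fin m => ↥(Ideal.span {x ^ (i : ℕ)})) j ∘ₗ g ∘ₗ
          LinearMap.proj i ∈ LinearMap.range φ := by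
      intro j i g
      let w : ↥(Ideal.span {x ^ (i : ℕ)}) := ⟨x ^ (i : ℕ), Ideal.mem_span_singleton_self _⟩
      obtain ⟨c, hc⟩ := hgen (g w)
      have hci : ∀ k < (i : ℕ), c k = 0 := by
        refine coeff_eq_zero_of_pow_mul x hx hx' c i.2.le ?_
        rw [← hc]
        have : x ^ (m - i) • w = 0 := by
          apply Subtype.ext
          change x ^ (m - i) * x ^ (i : ℕ) = 0
          rw [← pow_add, Nat.sub_add_cancel i.2.le, hx]
        have h2 : x ^ (m - i) • g w = 0 := by rw [← map_smul, this, map_zero]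
        exact congrArg Subtype.val h2
      have hcj : ∀ k < (j : ℕ), c k = 0 := by
        refine coeff_eq_zero_of_pow_mul x hx hx' c j.2.le ?_
        rw [← hc]
        obtain ⟨b, hb⟩ := Ideal.mem_span_singleton'.1 (g w).2
        rw [← hb, mul_comm b, ← mul_assoc, ← pow_add, Nat.sub_add_cancel j.2.le, hx, zero_mul]
      have hsum : LinearMap.single B (fun i : Fin m => ↥(Ideal.span {x ^ (i : ℕ)})) j ∘ₗ g ∘ₗ
          LinearMap.proj i = ∑ k ∈ Finset.range m, c k •
            (if h : (j : ℕ) ≤ k ∧ (i : ℕ) ≤ k then idealShift x j i k h.1 h.2 else 0) := by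
        refine end_ext_coe x fun v a => ?_
        obtain ⟨b, hb⟩ := Ideal.mem_span_singleton'.1 (v i).2
        have hv : v i = b • w := Subtype.ext hb.symm
        have h1 : ((LinearMap.single B (fun i : Fin m => ↥(Ideal.span {x ^ (i : ℕ)})) j ∘ₗ g ∘ₗ
            LinearMap.proj i) v a : B) = if a = j then b * (g w : B) else 0 := by
          change ((Pi.single j (g (v i)) : ∀ i : Fin m, ↥(Ideal.span {x ^ (i : ℕ)})) a : B) = _
          split_ifs with h
          · subst h; rw [Pi.single_eq_same, hv, map_smul]; rfl
          · rw [Pi.single_eq_of_ne h]; rfl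
        rw [h1, LinearMap.sum_apply, Finset.sum_apply, Submodule.coe_sum]
        split_ifs with ha
        · rw [hc, Finset.mul_sum]
          refine Finset.sum_congr rfl fun k _ => ?_
          by_cases h : (j : ℕ) ≤ k ∧ (i : ℕ) ≤ k
          · rw [dif_pos h]
            change _ = c k • (idealShift x j i k h.1 h.2 v a : B)
            rw [idealShift_apply, if_pos ha, ← hb, mul_smul_comm]
            congr 1
            rw [mul_left_comm, ← pow_add, Nat.sub_add_cancel h.2]
          · have hck : c k = 0 := by
              by_cases h2 : (j : ℕ) ≤ k
              · exact hci k (by omega)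
              · exact hcj k (by omega)
            rw [hck, zero_smul, zero_smul, mul_zero]; rfl
        · refine (Finset.sum_eq_zero fun k _ => ?_).symm
          split_ifs with h
          · change c k • (idealShift x j i k h.1 h.2 v a : B) = 0
            rw [idealShift_apply, if_neg ha, smul_zero]
          · rw [smul_zero]; rfl
      rw [hsum]
      refine Submodule.sum_mem _ fun k hk => Submodule.smul_mem _ _ ?_
      split_ifs with h
      · have hk' := Finset.mem_range.1 hk
        have h1 : σ.symm j ≤ σ.symm ⟨k, hk'⟩ := by
          rw [hσ]; simp only [Equiv.apply_symm_apply]; exact h.1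
        have h2 : σ.symm i ≤ σ.symm ⟨k, hk'⟩ := by
          rw [hσ]; simp only [Equiv.apply_symm_apply]; exact h.2
        refine ⟨D.p _ _ _, (hφ _ _ _ h1 h2).trans ?_⟩
        simp only [Equiv.apply_symm_apply]
      · exact Submodule.zero_mem _
    have hF : F = ∑ j, ∑ i, LinearMap.single B (fun i : Fin m => ↥(Ideal.span {x ^ (i : ℕ)})) j ∘ₗ
        (LinearMap.proj j ∘ₗ F ∘ₗ
          LinearMap.single B (fun i : Fin m => ↥(Ideal.span {x ^ (i : ℕ)})) i) ∘ₗ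
          LinearMap.proj i := by
      refine LinearMap.pi_ext' fun a => LinearMap.ext fun y => funext fun b => ?_
      simp only [LinearMap.sum_apply, Finset.sum_apply, LinearMap.comp_apply, LinearMap.proj_apply,
        LinearMap.single_apply]
      rw [Finset.sum_eq_single b, Finset.sum_eq_single a]
      · simp
      · intro i _ hi
        rw [Pi.single_eq_of_ne hi]
        simp
      · simp
      · intro j _ hj
        refine Finset.sum_eq_zero fun i _ => ?_
        rw [Pi.single_eq_of_ne (Ne.symm hj)]
      · simp
    have : F ∈ LinearMap.range φ := by
      rw [hF]
      exact Submodule.sum_mem _ fun j _ => Submodule.sum_mem _ fun i _ => key j i _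
    exact this
  exact ⟨AlgEquiv.ofBijective (AlgHom.ofLinearMap φ hone hmul) ⟨hinj, hsurj⟩⟩

end Auslander
end OneQH

namespace OneQH
open Vtx

set_option linter.unusedSimpArgs false

/-! ### Truncated polynomial rings; A(1), A(2), A(3), A(4) as Auslander algebras -/

section TruncatedPolynomials

variable (K : Type u) [Field K] (m : ℕ)

theorem quotient_X_pow_eq_zero : (Ideal.Quotient.mk (Ideal.span {(Polynomial.X : Polynomial K) ^ m})
    Polynomial.X) ^ m = 0 := by
  rw [← map_pow, Ideal.Quotient.eq_zero_iff_mem]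
  exact Ideal.mem_span_singleton_self _

theorem quotient_X_pow_ne_zero (hm : 0 < m) :
    (Ideal.Quotient.mk (Ideal.span {(Polynomial.X : Polynomial K) ^ m})
      Polynomial.X) ^ (m - 1) ≠ 0 := by
  rw [← map_pow, Ne, Ideal.Quotient.eq_zero_iff_mem, Ideal.mem_span_singleton,
    Polynomial.X_pow_dvd_iff]
  intro h
  have := h (m - 1) (by omega)
  simp at this

theorem exists_quotient_X_pow_eq_sum
    (y : Polynomial K ⧸ Ideal.span {(Polynomial.X : Polynomial K) ^ m}) :
    ∃ c : ℕ → K, y = ∑ k ∈ Finset.range m, c k •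
      (Ideal.Quotient.mk (Ideal.span {(Polynomial.X : Polynomial K) ^ m}) Polynomial.X) ^ k := by
  obtain ⟨f, rfl⟩ := Ideal.Quotient.mk_surjective y
  refine ⟨f.coeff, ?_⟩
  have h : ∑ k ∈ Finset.range m, f.coeff k •
      (Ideal.Quotient.mk (Ideal.span {(Polynomial.X : Polynomial K) ^ m}) Polynomial.X) ^ k =
      Ideal.Quotient.mk (Ideal.span {(Polynomial.X : Polynomial K) ^ m})
        (∑ k ∈ Finset.range m, f.coeff k • Polynomial.X ^ k) := by
    rw [map_sum]
    refine Finset.sum_congr rfl fun k _ => ?_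
    rw [← map_pow]
    rfl
  rw [h, Ideal.Quotient.eq, Ideal.mem_span_singleton, Polynomial.X_pow_dvd_iff]
  intro d hd
  simp [Polynomial.finsetSum_coeff, Polynomial.coeff_X_pow, hd]

end TruncatedPolynomials

section SixVertices

variable {K : Type u} [Field K] (q : K)

/-- Reduces the isomorphism to a finite check: within A(i₀) the table must be addition of ranks, and
the entry with coefficient q must not occur. -/
theorem nonempty_algEquiv_auslander (i₀ : Vtx) (m : ℕ) (hm : 0 < m) (σ : {j // j ≤ i₀} ≃ Fin m)
    (hσ : ∀ i j, i ≤ j ↔ σ i ≤ σ j)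
    (h : ∀ l j k : {j // j ≤ i₀}, j ≤ l → j ≤ k → ∀ r : {j // j ≤ i₀},
      (tbl l j k = some r.1 ↔ (σ r : ℕ) + σ j = σ l + σ k) ∧
      (tbl l j k = some r.1 → ¬ (l.1 = v4 ∧ j.1 = v1 ∧ k.1 = v4))) :
    Nonempty (TruncAlg (idem6 q) i₀ ≃ₐ[K] AuslanderAlgebra K m) := by
  refine ((basis6 q).trunc i₀).nonempty_algEquiv _ (quotient_X_pow_eq_zero K m)
    (quotient_X_pow_ne_zero K m hm) (exists_quotient_X_pow_eq_sum K m) σ hσ fun l j k r hl hk => ?_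
  change strConst q l j k r = _
  obtain ⟨h1, h2⟩ := h l j k hl hk r
  rw [strConst]
  by_cases h3 : tbl l j k = some r.1
  · rw [if_pos h3, if_pos (h1.1 h3), tblCoeff, if_neg (h2 h3)]
  · rw [if_neg h3, if_neg fun h4 => h3 (h1.2 h4)]

/-- The position of a vertex in a chain. -/
def chainRank : Vtx → ℕ
  -- The vertex 4 has rank 1, its position in the chain 1 < 4 of A(4). The values at 5 and 6 are not
  -- used.
  | v1 => 0 | v2 => 1 | v3 => 2 | v4 => 1 | v5 => 3 | v6 => 4

theorem trunc_v1_equiv : Nonempty (TruncAlg (idem6 q) v1 ≃ₐ[K] AuslanderAlgebra K 1) :=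
  nonempty_algEquiv_auslander q v1 1 (by decide)
    (Equiv.ofBijective (fun j => Fin.ofNat 1 (chainRank j.1)) (by decide)) (by decide) (by decide)

theorem trunc_v2_equiv : Nonempty (TruncAlg (idem6 q) v2 ≃ₐ[K] AuslanderAlgebra K 2) :=
  nonempty_algEquiv_auslander q v2 2 (by decide)
    (Equiv.ofBijective (fun j => Fin.ofNat 2 (chainRank j.1)) (by decide)) (by decide) (by decide)

theorem trunc_v3_equiv : Nonempty (TruncAlg (idem6 q) v3 ≃ₐ[K] AuslanderAlgebra K 3) :=
  nonempty_algEquiv_auslander q v3 3 (by decide)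
    (Equiv.ofBijective (fun j => Fin.ofNat 3 (chainRank j.1)) (by decide)) (by decide) (by decide)

theorem trunc_v4_equiv : Nonempty (TruncAlg (idem6 q) v4 ≃ₐ[K] AuslanderAlgebra K 2) :=
  nonempty_algEquiv_auslander q v4 2 (by decide)
    (Equiv.ofBijective (fun j => Fin.ofNat 2 (chainRank j.1)) (by decide)) (by decide) (by decide)

/-! ### The socle of `P(1)` over `A(5)` -/

theorem isSimpleModule_span_of_smul {A M : Type*} [Ring A] [Algebra K A] [AddCommGroup M]
    [Module A M] [Module K M] [IsScalarTower K A M] {x : M} (hx : x ≠ 0)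
    (h : ∀ a : A, ∃ c : K, a • x = c • x) : IsSimpleModule A (Submodule.span A {x}) := by
  rw [isSimpleModule_iff_isAtom]
  refine ⟨?_, fun N hN => ?_⟩
  · rwa [Ne, Submodule.span_singleton_eq_bot]
  · by_contra hne
    obtain ⟨y, hy, hy0⟩ := Submodule.exists_mem_ne_zero_of_ne_bot hne
    obtain ⟨a, rfl⟩ := Submodule.mem_span_singleton.1 (hN.le hy)
    obtain ⟨c, hc⟩ := h a
    rw [hc] at hy hy0
    have hc0 : c ≠ 0 := fun h => hy0 (by rw [h, zero_smul])
    have hxN : x ∈ N := (Submodule.smul_mem_iff (N.restrictScalars K) hc0).1 hy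
    exact absurd hN (not_lt_of_ge ((Submodule.span_singleton_le_iff_mem _ _).2 hxN))

theorem pth_121 : pth q [v1, v2, v1] = pp q v1 v2 v1 := by
  simp [pp, up, dn, upPath, pth_cons, pth_single, idem_mul_arr, mul_assoc, idem_mul_arr_mul]

theorem pth_141 : pth q [v1, v4, v1] = pp q v1 v4 v1 := by
  simp [pp, up, dn, upPath, pth_cons, pth_single, idem_mul_arr, mul_assoc, idem_mul_arr_mul]

theorem pth_12321 : pth q [v1, v2, v3, v2, v1] = pp q v1 v3 v1 := by
  simp [pp, up, dn, upPath, pth_cons, pth_single, idem_mul_arr, mul_assoc, idem_mul_arr_mul]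

/-- The way through 4 is replaced by the chosen one through 2 and 3, by (145) = (1235) and (541) =
(5321). -/
theorem pth_14541 : pth q [v1, v4, v5, v4, v1] = pp q v1 v5 v1 := by
  simp [pp, up, dn, upPath, pth_cons, pth_single, idem_mul_arr, mul_assoc, idem_mul_arr_mul,
    arr_41_54_mul, arr_45_14]

theorem pth_1456541 : pth q [v1, v4, v5, v6, v5, v4, v1] = pp q v1 v6 v1 := by
  simp [pp, up, dn, upPath, pth_cons, pth_single, idem_mul_arr, mul_assoc, idem_mul_arr_mul,
    arr_41_54_mul, arr_45_14]

theorem pth_12 : pth q [v1, v2] = pp q v2 v2 v1 := by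
  simp [pp, up, dn, upPath, pth_cons, pth_single, idem_mul_arr, mul_assoc, idem_mul_arr_mul]

theorem pth_14 : pth q [v1, v4] = pp q v4 v4 v1 := by
  simp [pp, up, dn, upPath, pth_cons, pth_single, idem_mul_arr, mul_assoc, idem_mul_arr_mul]

theorem pp_mul_of_some {m l j k i r : Vtx} (hm : m ≤ l) (hj : j ≤ l) (hk : j ≤ k) (hi : i ≤ k)
    (h : tbl l j k = some r) : pp q m l j * pp q j k i = tblCoeff q l j k • pp q m r i := by
  rw [pp_mul q hm hj hk hi, Finset.sum_eq_single r]
  · rw [strConst, if_pos h]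
  · intro r' _ hr
    rw [strConst, if_neg, zero_smul]
    rw [h]
    exact fun h' => hr (Option.some.inj h').symm
  · simp

theorem pp_mul_of_none {m l j k i : Vtx} (hm : m ≤ l) (hj : j ≤ l) (hk : j ≤ k) (hi : i ≤ k)
    (h : tbl l j k = none) : pp q m l j * pp q j k i = 0 := by
  rw [pp_mul q hm hj hk hi]
  refine Finset.sum_eq_zero fun r _ => ?_
  rw [strConst, h, if_neg (by simp), zero_smul]

theorem idem_mul_pp {j k i : Vtx} (hj : j ≤ k) (hi : i ≤ k) : idem6 q j * pp q j k i = pp q j k i :=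
  (basis6 q).e_mul_p hj hi

theorem pp_mul_idem {j k i : Vtx} (hj : j ≤ k) (hi : i ≤ k) : pp q j k i * idem6 q i = pp q j k i :=
  (basis6 q).p_mul_e hj hi

/-- The action on an element at the vertex `1` that is killed by the arrows. -/
theorem smul_of_killed {A M : Type*} [Ring A] [Algebra K A] (φ : Alg6 q →ₐ[K] A)
    [AddCommGroup M] [Module K M] [Module A M] [IsScalarTower K A M] {x : M}
    (h1 : φ (idem6 q v1) • x = x) (h12 : φ (arr q v1 v2) • x = 0)
    (h14 : φ (arr q v1 v4) • x = 0) (a : Alg6 q) :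
    φ a • x = (basis6 q).coeff v1 v1 v1 a • x := by
  have hup : ∀ l, adj6 v1 l = true → φ (arr q v1 l) • x = 0 := fun l hl => by
    cases l
    case v2 => exact h12
    case v4 => exact h14
    all_goals exact absurd hl (by decide)
  induction a using (basis6 q).induction_on with
  | zero => simp
  | add a b ha hb => rw [map_add, map_add, add_smul, add_smul, ha, hb]
  | smul c a ha => rw [map_smul, map_smul, smul_assoc, ha, smul_smul, smul_eq_mul]
  | hp m l j hm hj =>
    rw [(basis6 q).coeff_p hm hj]
    by_cases hj1 : j = v1
    · subst hj1
      by_cases hl1 : l = v1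
      · subst hl1
        obtain rfl : m = v1 := le_antisymm hm (v1_le m)
        rw [(basis6 q).p_self, h1]
        simp
      · have key : ∀ l, l ≠ v1 → ∃ k, adj6 v1 k = true ∧ v1 ≤ k ∧ k ≤ l ∧ tbl l k k = some l ∧
            ¬ k ≤ v1 := by decide
        obtain ⟨k, hk, hk1, hkl, ht, hk2⟩ := key l hl1
        have h2 : pp q m l k * arr q v1 k = pp q m l v1 := by
          rw [arr_eq_pp_up q hk (lt_of_le_not_ge hk1 hk2)]
          rw [pp_mul_of_some q hm hkl le_rfl hk1 ht, tblCoeff, if_neg, one_smul]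
          rintro ⟨-, h3, h4⟩
          exact absurd (h3.symm.trans h4) (by decide)
        change φ (pp q m l v1) • x = _
        rw [← h2, map_mul, mul_smul, hup k hk, smul_zero, if_neg, zero_smul]
        exact fun h3 => hl1 h3.2.1.symm
    · have h2 : φ (idem6 q j) • x = 0 := by
        rw [← h1, ← mul_smul, ← map_mul, idem6_mul_ne q hj1, map_zero, zero_smul]
      rw [← (basis6 q).p_mul_e hm hj, map_mul, mul_smul, h2, smul_zero, if_neg, zero_smul]
      exact fun h3 => hj1 h3.2.2.symm

end SixVertices
end OneQH

namespace OneQH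
open Vtx

/-! ### The socle of P(1) over A(5) -/

section SocleTrunc

/-- Two different simple submodules prevent the socle from being simple. -/
theorem not_isSimpleModule_soc {A M : Type*} [Ring A] [AddCommGroup M] [Module A M]
    {N N' : Submodule A M} (h : IsSimpleModule A N) (h' : IsSimpleModule A N') (hne : N ≠ N') :
    ¬ IsSimpleModule A (soc A M) := by
  intro hs
  have key : ∀ L : Submodule A M, IsSimpleModule A L → L = soc A M := fun L hL => by
    have hle : L ≤ soc A M := le_sSup hL
    rw [isSimpleModule_iff_isAtom] at hs hL
    exact (hs.le_iff.1 hle).resolve_left hL.1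
  exact hne ((key N h).trans (key N' h').symm)

theorem isSimpleModule_congr {A M N : Type*} [Ring A] [AddCommGroup M] [Module A M]
    [AddCommGroup N] [Module A N] (e : M ≃ₗ[A] N) (h : IsSimpleModule A N) : IsSimpleModule A M :=
  IsSimpleModule.congr e

instance : DecidableLT Vtx := decidableLTOfDecidableLE

variable {K : Type u} [Field K] (q : K)

theorem arr_mul_pp_dn {i j k l : Vtx} (h : adj6 i j = true) (hj : j < i) (hi : i ≤ k)
    (hl : l ≤ k) : arr q i j * pp q i k l = pp q j k l := by
  rw [arr_eq_pp_dn q h hj]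
  have h1 : tbl i i k = some k := by cases i <;> rfl
  rw [pp_mul_of_some q hj.le le_rfl hi hl h1, tblCoeff, if_neg, one_smul]
  rintro ⟨rfl, h2, -⟩
  exact absurd h2 (by decide)

theorem arr_mul_pp_up {i j k l r : Vtx} (h : adj6 i j = true) (hj : i < j) (hi : i ≤ k)
    (hl : l ≤ k) (hr : tbl j i k = some r) :
    arr q i j * pp q i k l = tblCoeff q j i k • pp q j r l := by
  rw [arr_eq_pp_up q h hj, pp_mul_of_some q le_rfl hj.le hi hl hr]

theorem arr_mul_pp_up_none {i j k l : Vtx} (h : adj6 i j = true) (hj : i < j) (hi : i ≤ k)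
    (hl : l ≤ k) (hr : tbl j i k = none) : arr q i j * pp q i k l = 0 := by
  rw [arr_eq_pp_up q h hj, pp_mul_of_none q le_rfl hj.le hi hl hr]

theorem arr_12_mul_151 : arr q v1 v2 * pp q v1 v5 v1 = pp q v2 v6 v1 := by
  rw [arr_mul_pp_up q rfl (by decide) (by decide) (by decide) (r := v6) rfl, tblCoeff,
    if_neg (by decide), one_smul]

theorem arr_14_mul_151 : arr q v1 v4 * pp q v1 v5 v1 = 0 :=
  arr_mul_pp_up_none q rfl (by decide) (by decide) (by decide) rfl

theorem arr_12_mul_141 : arr q v1 v2 * pp q v1 v4 v1 = pp q v2 v5 v1 := by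
  rw [arr_mul_pp_up q rfl (by decide) (by decide) (by decide) (r := v5) rfl, tblCoeff,
    if_neg (by decide), one_smul]

theorem arr_12_mul_131 : arr q v1 v2 * pp q v1 v3 v1 = pp q v2 v5 v1 := by
  rw [arr_mul_pp_up q rfl (by decide) (by decide) (by decide) (r := v5) rfl, tblCoeff,
    if_neg (by decide), one_smul]

/-- The only product of an arrow with a basis element of P(1) that involves q. In A(5) it vanishes
with the level 6, so there q no longer separates (141) from (12321). -/
theorem arr_14_mul_141 : arr q v1 v4 * pp q v1 v4 v1 = q • pp q v4 v6 v1 := by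
  rw [arr_mul_pp_up q rfl (by decide) (by decide) (by decide) (r := v6) rfl, tblCoeff,
    if_pos (by decide)]

theorem arr_14_mul_131 : arr q v1 v4 * pp q v1 v3 v1 = pp q v4 v6 v1 := by
  rw [arr_mul_pp_up q rfl (by decide) (by decide) (by decide) (r := v6) rfl, tblCoeff,
    if_neg (by decide), one_smul]

theorem truncMk_pp_v6 (j i : Vtx) : truncMk K (idem6 q) v5 (pp q j v6 i) = 0 :=
  (basis6 q).truncMk_p v5 (le_v6 j) (le_v6 i) (by decide)

theorem arr_12_eq : arr q v1 v2 = pp q v2 v2 v1 := arr_eq_pp_up q rfl (by decide)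

theorem arr_14_eq : arr q v1 v4 = pp q v4 v4 v1 := arr_eq_pp_up q rfl (by decide)

/-- The element `(14541)` of `A(5)`. -/
noncomputable def socGen₁ : TruncAlg (idem6 q) v5 := truncMk K (idem6 q) v5 (pp q v1 v5 v1)

/-- The element `(141) - (12321)` of `A(5)`. -/
noncomputable def socGen₂ : TruncAlg (idem6 q) v5 :=
  truncMk K (idem6 q) v5 (pp q v1 v4 v1 - pp q v1 v3 v1)

theorem arr_12_mul_socGen₁ : truncMk K (idem6 q) v5 (arr q v1 v2) * socGen₁ q = 0 := by
  rw [socGen₁, ← map_mul, arr_12_mul_151, truncMk_pp_v6]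

theorem arr_14_mul_socGen₁ : truncMk K (idem6 q) v5 (arr q v1 v4) * socGen₁ q = 0 := by
  rw [socGen₁, ← map_mul, arr_14_mul_151, map_zero]

theorem arr_12_mul_socGen₂ : truncMk K (idem6 q) v5 (arr q v1 v2) * socGen₂ q = 0 := by
  rw [socGen₂, ← map_mul, mul_sub, arr_12_mul_141, arr_12_mul_131, sub_self, map_zero]

theorem arr_14_mul_socGen₂ : truncMk K (idem6 q) v5 (arr q v1 v4) * socGen₂ q = 0 := by
  rw [socGen₂, ← map_mul, mul_sub, arr_14_mul_141, arr_14_mul_131, map_sub, map_smul,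
    truncMk_pp_v6, smul_zero, sub_zero]

theorem socGen_linearIndependent : LinearIndependent K ![socGen₁ q, socGen₂ q] := by
  rw [LinearIndependent.pair_iff]
  intro s t h
  rw [socGen₁, socGen₂, ← map_smul, ← map_smul, ← map_add] at h
  have h5 := (basis6 q).coeff_eq_zero_of_truncMk v5 h (j := v1) (k := v5) (i := v1) (by decide)
  have h4 := (basis6 q).coeff_eq_zero_of_truncMk v5 h (j := v1) (k := v4) (i := v1) (by decide)
  have c : ∀ k k' : Vtx, (basis6 q).coeff v1 k' v1 (pp q v1 k v1) = if k' = k then 1 else 0 :=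
    fun k k' => by
      have := (basis6 q).coeff_p (v1_le k) (v1_le k) v1 k' v1
      refine this.trans ?_
      simp
  simp only [map_add, map_smul, map_sub, c] at h5 h4
  exact ⟨by simpa using h5, by simpa using h4⟩

theorem exists_smul_socGen {x : TruncAlg (idem6 q) v5} (h1 : ∃ y, x = truncMk K (idem6 q) v5 y ∧
    idem6 q v1 * y = y) (h12 : truncMk K (idem6 q) v5 (arr q v1 v2) * x = 0)
    (h14 : truncMk K (idem6 q) v5 (arr q v1 v4) * x = 0) (a : TruncAlg (idem6 q) v5) :
    ∃ c : K, a • x = c • x := by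
  obtain ⟨a, rfl⟩ := truncMk_surjective (K := K) (idem6 q) v5 a
  obtain ⟨y, rfl, hy⟩ := h1
  exact ⟨_, smul_of_killed q (truncMk K (idem6 q) v5)
    ((map_mul (truncMk K (idem6 q) v5) _ _).symm.trans (congrArg _ hy)) h12 h14 a⟩

theorem exists_smul_socGen₁ (a : TruncAlg (idem6 q) v5) : ∃ c : K, a • socGen₁ q = c • socGen₁ q :=
  exists_smul_socGen q ⟨_, rfl, idem_mul_pp q (by decide) (by decide)⟩ (arr_12_mul_socGen₁ q)
    (arr_14_mul_socGen₁ q) a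

theorem exists_smul_socGen₂ (a : TruncAlg (idem6 q) v5) : ∃ c : K, a • socGen₂ q = c • socGen₂ q :=
  exists_smul_socGen q ⟨_, rfl, by
    rw [mul_sub, idem_mul_pp q (by decide) (by decide), idem_mul_pp q (by decide) (by decide)]⟩
    (arr_12_mul_socGen₂ q) (arr_14_mul_socGen₂ q) a

theorem socGen₁_mem : socGen₁ q ∈ P (truncIdem K (idem6 q) v5) one5 :=
  Submodule.mem_span_singleton.2 ⟨socGen₁ q, by
    rw [socGen₁, truncIdem, smul_eq_mul, ← map_mul]
    exact congrArg _ (pp_mul_idem q (by decide) (by decide))⟩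

theorem socGen₂_mem : socGen₂ q ∈ P (truncIdem K (idem6 q) v5) one5 :=
  Submodule.mem_span_singleton.2 ⟨socGen₂ q, by
    rw [socGen₂, truncIdem, smul_eq_mul, ← map_mul, sub_mul]
    congr 2 <;> exact pp_mul_idem q (by decide) (by decide)⟩

theorem socGen₁_ne : socGen₁ q ≠ 0 := (socGen_linearIndependent q).ne_zero 0

theorem socGen₂_ne : socGen₂ q ≠ 0 := (socGen_linearIndependent q).ne_zero 1

theorem not_isSimpleModule_soc_trunc : ¬ IsSimpleModule (TruncAlg (idem6 q) v5)
    (soc (TruncAlg (idem6 q) v5) (P (truncIdem K (idem6 q) v5) one5)) := by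
  have simple : ∀ x : P (truncIdem K (idem6 q) v5) one5, (x : TruncAlg (idem6 q) v5) ≠ 0 →
      (∀ a : TruncAlg (idem6 q) v5, ∃ c : K, a • (x : TruncAlg (idem6 q) v5) = c • x.1) →
      IsSimpleModule (TruncAlg (idem6 q) v5) (Submodule.span (TruncAlg (idem6 q) v5) {x}) :=
    fun x hx h => isSimpleModule_span_of_smul (K := K) (fun h0 => hx (by rw [h0]; rfl)) fun a => by
      obtain ⟨c, hc⟩ := h a
      exact ⟨c, Subtype.ext hc⟩
  refine not_isSimpleModule_soc (simple ⟨_, socGen₁_mem q⟩ (socGen₁_ne q) (exists_smul_socGen₁ q))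
    (simple ⟨_, socGen₂_mem q⟩ (socGen₂_ne q) (exists_smul_socGen₂ q)) fun h => ?_
  -- If both generated the same submodule, the first would be a scalar multiple of the second, since
  -- A(5) acts on the latter by scalars.
  have h1 := h ▸ Submodule.mem_span_singleton_self (R := TruncAlg (idem6 q) v5)
    (⟨_, socGen₁_mem q⟩ : P (truncIdem K (idem6 q) v5) one5)
  obtain ⟨a, ha⟩ := Submodule.mem_span_singleton.1 h1
  have h2 : a • socGen₂ q = socGen₁ q := congrArg Subtype.val ha
  obtain ⟨c, hc⟩ := exists_smul_socGen₂ q a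
  rw [hc] at h2
  have h3 := (LinearIndependent.pair_iff.1 (socGen_linearIndependent q)) 1 (-c)
    (by rw [one_smul, neg_smul, h2, add_neg_cancel])
  exact one_ne_zero h3.1

/-- All vertices j are covered, because the definition of 1-quasi-hereditary supplies its own
smallest vertex. -/
theorem not_soc_trunc_equiv (j : {j : Vtx // j ≤ v5}) :
    ¬ Nonempty (soc (TruncAlg (idem6 q) v5) (P (truncIdem K (idem6 q) v5) one5)
      ≃ₗ[TruncAlg (idem6 q) v5] S (truncIdem K (idem6 q) v5) j) := by
  rintro ⟨f⟩
  exact not_isSimpleModule_soc_trunc q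
    (isSimpleModule_congr f ((isBasicAlgebra_trunc q v5).2.2.1 j))

theorem not_isOneQuasiHereditary_trunc_v5 :
    ¬ IsOneQuasiHereditary K (truncIdem K (idem6 q) v5) := by
  rintro ⟨-, b, t, -, -, -, h, -⟩
  exact not_soc_trunc_equiv q b (h one5).1

/-- The statements about the two elements of the socle. -/
theorem socle_trunc (p₁ p₂ : TruncAlg (idem6 q) v5) (h₁ : p₁ = pth5 q [v1, v4, v5, v4, v1])
    (h₂ : p₂ = pth5 q [v1, v4, v1] - pth5 q [v1, v2, v3, v2, v1]) :
    p₁ ∈ P (truncIdem K (idem6 q) v5) one5 ∧ p₂ ∈ P (truncIdem K (idem6 q) v5) one5 ∧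
      LinearIndependent K ![p₁, p₂] ∧
      pth5 q [v1, v2] * p₁ = 0 ∧ pth5 q [v1, v4] * p₁ = 0 ∧
      pth5 q [v1, v2] * p₂ = 0 ∧ pth5 q [v1, v4] * p₂ = 0 ∧
      IsSimpleModule (TruncAlg (idem6 q) v5) (Submodule.span (TruncAlg (idem6 q) v5) {p₁}) ∧
      IsSimpleModule (TruncAlg (idem6 q) v5) (Submodule.span (TruncAlg (idem6 q) v5) {p₂}) := by
  obtain rfl : p₁ = socGen₁ q := by rw [h₁, pth5, pth_14541, socGen₁]
  obtain rfl : p₂ = socGen₂ q := by rw [h₂, pth5, pth5, pth_141, pth_12321, socGen₂, map_sub]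
  rw [pth5, pth5, pth_12, pth_14, ← arr_12_eq, ← arr_14_eq]
  exact ⟨socGen₁_mem q, socGen₂_mem q, socGen_linearIndependent q, arr_12_mul_socGen₁ q,
    arr_14_mul_socGen₁ q, arr_12_mul_socGen₂ q, arr_14_mul_socGen₂ q,
    isSimpleModule_span_of_smul (K := K) (socGen₁_ne q) (exists_smul_socGen₁ q),
    isSimpleModule_span_of_smul (K := K) (socGen₂_ne q) (exists_smul_socGen₂ q)⟩

end SocleTrunc
end OneQH

namespace OneQH
open Vtx

set_option linter.unusedSimpArgs false

/-! ### Vector families adapted to standard and costandard filtrations -/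

section GradedFamilies

variable {K : Type u} [Field K] (q : K) {M : Type*} [AddCommGroup M] [Module K M]
  [Module (Alg6 q) M]

/-- The vectors `w t l` with `l ≤ lab t` form a basis of the submodule `N` such that `w t l` lies at
the vertex `l`; an arrow `i → j` sends `w t i` to `w t j` if `lead i j`, and to `0` otherwise, up to
vectors `w t' j` with `t' < t`. -/
structure GradedFamily (lead : Vtx → Vtx → Bool) (N : Submodule (Alg6 q) M) {r : ℕ}
    (lab : Fin r → Vtx) (w : Fin r → Vtx → M) : Prop where
  wt : ∀ t l, l ≤ lab t → idem6 q l • w t l = w t l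
  -- A functional that separates `w t l` from the other vectors at the same vertex. Its value there
  -- is only required to be nonzero, so no normalization is needed.
  dual : ∀ t l, l ≤ lab t → ∃ φ : M →ₗ[K] K, ∀ t', l ≤ lab t' → (φ (w t' l) = 0 ↔ t' ≠ t)
  mem : ∀ t l, l ≤ lab t → w t l ∈ N
  gen : ∃ G : Set M, N = Submodule.span (Alg6 q) G ∧
    ∀ g ∈ G, g ∈ Submodule.span K {x | ∃ t l, l ≤ lab t ∧ x = w t l}
  -- The list ρ holds explicit corrections. An entry counts only if its layer lies strictly below t
  -- and contains the vertex j, so one list can serve several arrows.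
  act : ∀ t i j, adj6 i j = true → i ≤ lab t → ∃ ρ : List (K × Fin r), arr q i j • w t i =
    (if lead i j = true ∧ j ≤ lab t then w t j else 0) +
      (ρ.map fun x => if x.2 < t ∧ j ≤ lab x.2 then x.1 • w x.2 j else 0).sum

namespace GradedFamily

variable {q} {lead : Vtx → Vtx → Bool} {N : Submodule (Alg6 q) M} {r : ℕ}
  {lab : Fin r → Vtx} {w : Fin r → Vtx → M}

theorem idem_smul_ne (h : GradedFamily q lead N lab w) {t : Fin r} {l : Vtx} (hl : l ≤ lab t)
    {i : Vtx} (hi : i ≠ l) : idem6 q i • w t l = 0 := by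
  rw [← h.wt t l hl, ← mul_smul, idem6_mul_ne q hi, zero_smul]

variable [IsScalarTower K (Alg6 q) M]

theorem linearIndependent (h : GradedFamily q lead N lab w) :
    LinearIndependent K fun x : Σ t, {l : Vtx // l ≤ lab t} => w x.1 x.2 := by
  rw [Fintype.linearIndependent_iff]
  rintro g hg ⟨t, l, hl⟩
  obtain ⟨φ, hφ⟩ := h.dual t l hl
  have h1 := congrArg (fun m => φ (idem6 q l • m)) hg
  simp only [Finset.smul_sum, map_sum, smul_zero, map_zero] at h1
  rw [Finset.sum_eq_single ⟨t, l, hl⟩] at h1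
  · rw [smul_algebra_smul_comm, map_smul, h.wt t l hl, smul_eq_mul, mul_eq_zero] at h1
    exact h1.resolve_right fun h2 => (hφ t hl).1 h2 rfl
  · rintro ⟨t', l', hl'⟩ - hne
    rw [smul_algebra_smul_comm, map_smul]
    by_cases h2 : l = l'
    · subst h2
      rw [h.wt t' l hl', (hφ t' hl').2, smul_zero]
      rintro rfl
      exact hne rfl
    · rw [h.idem_smul_ne hl' h2, map_zero, smul_zero]
  · simp

/-- The span contains the generators of N, and it is stable under vertices and arrows by `act`;
therefore it is all of N. -/
theorem restrictScalars_eq_span (h : GradedFamily q lead N lab w) : N.restrictScalars K =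
    Submodule.span K (Set.range fun x : Σ t, {l : Vtx // l ≤ lab t} => w x.1 x.2) := by
  have hset : (Set.range fun x : Σ t, {l : Vtx // l ≤ lab t} => w x.1 x.2) =
      {x | ∃ t l, l ≤ lab t ∧ x = w t l} := by
    ext x
    constructor
    · rintro ⟨⟨t, l, hl⟩, rfl⟩
      exact ⟨t, l, hl, rfl⟩
    · rintro ⟨t, l, hl, rfl⟩
      exact ⟨⟨t, l, hl⟩, rfl⟩
  rw [hset]
  set U := Submodule.span K {x | ∃ t l, l ≤ lab t ∧ x = w t l} with hU
  have hw : ∀ t l, l ≤ lab t → w t l ∈ U := fun t l hl => Submodule.subset_span ⟨t, l, hl, rfl⟩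
  apply le_antisymm
  · obtain ⟨G, hG, hGU⟩ := h.gen
    have stable : ∀ a : Alg6 q, ∀ x ∈ U, a • x ∈ U := by
      intro a
      have ha : a ∈ Algebra.adjoin K (Set.range (idem6 q) ∪
        {a | ∃ i j, adj6 i j = true ∧ a = arr q i j}) := by rw [alg6_adjoin]; trivial
      induction ha using Algebra.adjoin_induction with
      | mem g hg =>
        intro x hx
        induction hx using Submodule.span_induction with
        | mem x hx =>
          obtain ⟨t, l, hl, rfl⟩ := hx
          rcases hg with ⟨i, rfl⟩ | ⟨i, j, hij, rfl⟩
          · by_cases hi : i = l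
            · subst hi; rw [h.wt t i hl]; exact hw t i hl
            · rw [h.idem_smul_ne hl hi]; exact Submodule.zero_mem _
          · by_cases hi : i = l
            · subst hi
              obtain ⟨ρ, hρ⟩ := h.act t i j hij hl
              rw [hρ]
              refine Submodule.add_mem _ ?_ (list_sum_mem ?_)
              · split_ifs with h1
                · exact hw t j h1.2
                · exact Submodule.zero_mem _
              · intro y hy
                obtain ⟨x, -, rfl⟩ := List.mem_map.1 hy
                split_ifs with h1
                · exact Submodule.smul_mem _ _ (hw _ _ h1.2)
                · exact Submodule.zero_mem _
            · rw [← arr_mul_idem, mul_smul, h.idem_smul_ne hl hi, smul_zero]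
              exact Submodule.zero_mem _
        | zero => rw [smul_zero]; exact Submodule.zero_mem _
        | add x y _ _ hx hy => rw [smul_add]; exact Submodule.add_mem _ hx hy
        | smul c x _ hx => rw [smul_algebra_smul_comm]; exact Submodule.smul_mem _ _ hx
      | algebraMap c => intro x hx; rw [algebraMap_smul]; exact Submodule.smul_mem _ _ hx
      | add a b _ _ ha hb =>
        intro x hx; rw [add_smul]; exact Submodule.add_mem _ (ha x hx) (hb x hx)
      | mul a b _ _ ha hb => intro x hx; rw [mul_smul]; exact ha _ (hb x hx)
    intro x hx
    have hx' : x ∈ Submodule.span (Alg6 q) G := by rw [← hG]; exact hx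
    clear hx
    induction hx' using Submodule.span_induction with
    | mem x hx => exact hGU x hx
    | zero => exact Submodule.zero_mem _
    | add x y _ _ ihx ihy => exact Submodule.add_mem _ ihx ihy
    | smul a x _ ihx => exact stable a x ihx
  · rw [hU, Submodule.span_le]
    rintro _ ⟨t, l, hl, rfl⟩
    exact h.mem t l hl

theorem exists_idem_smul_eq (h : GradedFamily q lead N lab w) {x : M} (hx : x ∈ N) (l : Vtx) :
    ∃ c : Fin r → K, idem6 q l • x = ∑ t, if l ≤ lab t then c t • w t l else 0 := by
  have hx' : x ∈ N.restrictScalars K := hx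
  rw [h.restrictScalars_eq_span] at hx'
  clear hx
  induction hx' using Submodule.span_induction with
  | mem x hx =>
    obtain ⟨⟨t, l', hl'⟩, rfl⟩ := hx
    by_cases h1 : l = l'
    · subst h1
      refine ⟨fun t' => if t' = t then 1 else 0, ?_⟩
      rw [Finset.sum_eq_single t]
      · simp [h.wt t l hl', hl']
      · intro t' _ ht'; simp [ht']
      · simp
    · exact ⟨0, by simp [h.idem_smul_ne hl' h1]⟩
  | zero => exact ⟨0, by simp⟩
  | add x y _ _ ihx ihy =>
    obtain ⟨c, hc⟩ := ihx
    obtain ⟨d, hd⟩ := ihy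
    refine ⟨c + d, ?_⟩
    rw [smul_add, hc, hd, ← Finset.sum_add_distrib]
    refine Finset.sum_congr rfl fun t _ => ?_
    split_ifs
    · rw [Pi.add_apply, add_smul]
    · rw [add_zero]
  | smul c x _ ihx =>
    obtain ⟨d, hd⟩ := ihx
    refine ⟨c • d, ?_⟩
    rw [smul_algebra_smul_comm, hd, Finset.smul_sum]
    refine Finset.sum_congr rfl fun t _ => ?_
    split_ifs
    · rw [Pi.smul_apply, smul_smul, smul_eq_mul]
    · rw [smul_zero]

/-- The condition `act` is the congruence that `HasFiltration.of_family` asks for. It is used with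
the descending arrows as `lead` for Δ and with the ascending ones for ∇. -/
theorem hasFiltration (h : GradedFamily q lead N lab w) {Θ : Vtx → Type*}
    [∀ i, AddCommGroup (Θ i)] [∀ i, Module (Alg6 q) (Θ i)] [∀ i, Module K (Θ i)]
    [∀ i, IsScalarTower K (Alg6 q) (Θ i)] (θ : ∀ k, Module.Basis {m : Vtx // m ≤ k} K (Θ k))
    (hθe : ∀ k i (x y : {m : Vtx // m ≤ k}), (θ k).repr (idem6 q i • θ k x) y =
      if x.1 = i ∧ y.1 = i then 1 else 0)
    (hθa : ∀ k i j, adj6 i j = true → ∀ x y : {m : Vtx // m ≤ k},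
      (θ k).repr (arr q i j • θ k x) y =
        if x.1 = i ∧ y.1 = j ∧ lead i j = true then 1 else 0) :
    HasFiltration (A := Alg6 q) Θ N (fun k => {t | lab t = k}.ncard) := by
  have : Nonempty Vtx := ⟨v1⟩
  refine HasFiltration.of_family (K := K) θ N lab (fun t l => w t l.1) h.linearIndependent
    h.restrictScalars_eq_span _ (alg6_adjoin q) ?_
  rintro g (⟨i, rfl⟩ | ⟨i, j, hij, rfl⟩) t ⟨l, hl⟩
  · simp only [hθe]
    by_cases hi : i = l
    · subst hi
      rw [Finset.sum_eq_single ⟨i, hl⟩]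
      · simp [h.wt t i hl]
      · intro b _ hb
        rw [if_neg, zero_smul]
        exact fun h1 => hb (Subtype.ext h1.2)
      · simp
    · simp [h.idem_smul_ne hl hi, Ne.symm hi]
  · simp only [hθa _ _ _ hij]
    by_cases hi : i = l
    · subst hi
      obtain ⟨ρ, hρ⟩ := h.act t i j hij hl
      have h1 : ∑ m : {m : Vtx // m ≤ lab t}, (if i = i ∧ m.1 = j ∧ lead i j = true then (1 : K)
          else 0) • w t m.1 = if lead i j = true ∧ j ≤ lab t then w t j else 0 := by
        split_ifs with h2
        · rw [Finset.sum_eq_single ⟨j, h2.2⟩]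
          · simp [h2.1]
          · intro b _ hb
            rw [if_neg, zero_smul]
            exact fun h1 => hb (Subtype.ext h1.2.1)
          · simp
        · refine Finset.sum_eq_zero fun m _ => ?_
          rw [if_neg, zero_smul]
          rintro ⟨-, h3, h4⟩
          exact h2 ⟨h4, h3 ▸ m.2⟩
      rw [h1, hρ, add_sub_cancel_left]
      refine list_sum_mem fun y hy => ?_
      obtain ⟨x, -, rfl⟩ := List.mem_map.1 hy
      split_ifs with h2
      · exact Submodule.smul_mem _ _ (Submodule.subset_span ⟨x.2, h2.1, ⟨j, h2.2⟩, rfl⟩)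
      · exact Submodule.zero_mem _
    · rw [← arr_mul_idem, mul_smul, h.idem_smul_ne hl hi, smul_zero]
      simp [Ne.symm hi]

theorem mult_eq (h : GradedFamily q lead N lab w) (j : Vtx) :
    mult K (idem6 q) N j = (Finset.univ.filter fun t => j ≤ lab t).card := by
  let κ := Σ t, {l : Vtx // l ≤ lab t}
  let v : κ → N := fun x => ⟨w x.1 x.2, h.mem _ _ x.2.2⟩
  let L : N →ₗ[K] M := N.subtype.restrictScalars K
  have hli : LinearIndependent K v := LinearIndependent.of_comp L h.linearIndependent
  have hsp : ⊤ ≤ Submodule.span K (Set.range v) := by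
    rintro ⟨x, hx⟩ -
    have hx' : x ∈ N.restrictScalars K := hx
    rw [h.restrictScalars_eq_span] at hx'
    have h1 : (Submodule.span K (Set.range v)).map L =
        Submodule.span K (Set.range fun x : κ => w x.1 x.2) := by
      rw [Submodule.map_span, ← Set.range_comp]
      rfl
    rw [← h1] at hx'
    obtain ⟨y, hy, hyx⟩ := hx'
    have : y = ⟨x, hx⟩ := Subtype.ext hyx
    rwa [← this]
  let b : Module.Basis κ K N := Module.Basis.mk hli hsp
  have hb : ∀ x, b x = v x := Module.Basis.mk_apply hli hsp
  rw [mult_eq_card (idem6 q) b (fun x => x.2.1) j]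
  · rw [← Set.ncard_coe_finset]
    refine Set.ncard_congr (fun x _ => x.1) ?_ ?_ ?_
    · rintro ⟨t, l, hl⟩ (rfl : l = j)
      simpa using hl
    · rintro ⟨t, l, hl⟩ ⟨t', l', hl'⟩ (rfl : l = j) (rfl : l' = l) (rfl : t = t')
      rfl
    · intro t ht
      exact ⟨⟨t, j, by simpa using ht⟩, rfl, rfl⟩
  · rintro ⟨t, l, hl⟩ (rfl : l = j)
    rw [hb]
    exact Subtype.ext (h.wt t l hl)
  · rintro ⟨t, l, hl⟩ (hne : l ≠ j)
    rw [hb]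
    exact Subtype.ext (h.idem_smul_ne hl hne.symm)

end GradedFamily

theorem deltaBasis_repr_idem (k i : Vtx) (x y : {m : Vtx // m ≤ k}) :
    ((basis6 q).deltaBasis k).repr (idem6 q i • (basis6 q).deltaBasis k x) y =
      if x.1 = i ∧ y.1 = i then 1 else 0 := by
  rw [← (basis6 q).p_self, (basis6 q).deltaBasis_repr_smul le_rfl le_rfl]
  simp

theorem nablaBasis_repr_idem (k i : Vtx) (x y : {m : Vtx // m ≤ k}) :
    ((basis6 q).nablaBasis k).repr (idem6 q i • (basis6 q).nablaBasis k x) y =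
      if x.1 = i ∧ y.1 = i then 1 else 0 := by
  rw [← (basis6 q).p_self, (basis6 q).nablaBasis_repr_smul le_rfl le_rfl]
  simp

theorem leB_iff {i j : Vtx} : Vtx.leB i j = true ↔ i ≤ j := Iff.rfl

theorem deltaBasis_repr_arr (k i j : Vtx) (h : adj6 i j = true) (x y : {m : Vtx // m ≤ k}) :
    ((basis6 q).deltaBasis k).repr (arr q i j • (basis6 q).deltaBasis k x) y =
      if x.1 = i ∧ y.1 = j ∧ Vtx.leB j i = true then 1 else 0 := by
  simp only [leB_iff]
  rcases adj6_le i j h with h1 | h1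
  · rw [arr_eq_pp_up q h h1]
    refine ((basis6 q).deltaBasis_repr_smul le_rfl h1.le k x y).trans ?_
    rw [if_neg fun h2 => h1.ne h2.2.1.symm, if_neg fun h2 => not_le_of_gt h1 h2.2.2]
  · rw [arr_eq_pp_dn q h h1]
    refine ((basis6 q).deltaBasis_repr_smul h1.le le_rfl k x y).trans ?_
    simp [h1.le]

theorem nablaBasis_repr_arr (k i j : Vtx) (h : adj6 i j = true) (x y : {m : Vtx // m ≤ k}) :
    ((basis6 q).nablaBasis k).repr (arr q i j • (basis6 q).nablaBasis k x) y =
      if x.1 = i ∧ y.1 = j ∧ Vtx.leB i j = true then 1 else 0 := by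
  simp only [leB_iff]
  rcases adj6_le i j h with h1 | h1
  · rw [arr_eq_pp_up q h h1]
    refine ((basis6 q).nablaBasis_repr_smul le_rfl h1.le k x y).trans ?_
    simp [h1.le]
  · rw [arr_eq_pp_dn q h h1]
    refine ((basis6 q).nablaBasis_repr_smul h1.le le_rfl k x y).trans ?_
    rw [if_neg fun h2 => h1.ne h2.2.1.symm, if_neg fun h2 => not_le_of_gt h1 h2.2.2]

variable [IsScalarTower K (Alg6 q) M]

/-- A criterion for tilting modules. -/
theorem isTilting_of_gradedFamily {i : Vtx} {N : Submodule (Alg6 q) M}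
    (hN : IsIndecomposable (Alg6 q) N) {r r' : ℕ} {lab : Fin r → Vtx} {w : Fin r → Vtx → M}
    (h : GradedFamily q (fun i j => Vtx.leB j i) N lab w) {lab' : Fin r' → Vtx}
    {w' : Fin r' → Vtx → M} (h' : GradedFamily q Vtx.leB N lab' w')
    (hl : (Finset.univ.filter fun t => lab t = i).card = 1) (hl0 : ∀ t, lab t ≤ i)
    (hl' : (Finset.univ.filter fun t => lab' t = i).card = 1) (hl0' : ∀ t, lab' t ≤ i) :
    IsTilting K (idem6 q) i N := by
  have card : ∀ {r : ℕ} {lab : Fin r → Vtx} (j : Vtx),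
      {t | lab t = j}.ncard = (Finset.univ.filter fun t => lab t = j).card := fun j => by
    rw [← Set.ncard_coe_finset]; simp
  have card0 : ∀ {r : ℕ} {lab : Fin r → Vtx}, (∀ t, lab t ≤ i) → ∀ j, ¬ j ≤ i →
      {t | lab t = j}.ncard = 0 := fun h j hj => by
    rw [Set.ncard_eq_zero]
    ext t
    simp only [Set.mem_ofPred_eq, Set.mem_empty_iff_false, iff_false]
    rintro rfl
    exact hj (h t)
  refine ⟨hN, ⟨_, h.hasFiltration (basis6 q).deltaBasis (deltaBasis_repr_idem q)
    (deltaBasis_repr_arr q), (card i).trans hl, card0 hl0⟩,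
    ⟨_, h'.hasFiltration (basis6 q).nablaBasis (nablaBasis_repr_idem q)
    (nablaBasis_repr_arr q), (card i).trans hl', card0 hl0'⟩, ?_, fun j hj => ?_⟩
  · rw [h.mult_eq, ← hl]
    congr 1
    ext t
    simp only [Finset.mem_filter, Finset.mem_univ, true_and]
    exact ⟨fun h1 => le_antisymm (hl0 t) h1, fun h1 => h1.ge⟩
  · rw [h.mult_eq, Finset.card_eq_zero]
    ext t
    simp only [Finset.mem_filter, Finset.mem_univ, true_and, Finset.notMem_empty, iff_false]
    exact fun h1 => hj (h1.trans (hl0 t))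

end GradedFamilies
end OneQH

namespace OneQH
open Vtx

set_option linter.unusedSimpArgs false

/-! ### Computation in P(1) and indecomposability of cyclic modules -/

section ProjectiveOne

variable {K : Type u} [Field K] (q : K)

/-- The basis of `P(1)`. -/
noncomputable def xx (j k : Vtx) : Alg6 q := pp q j k v1

/-- The coordinates of the elements of `P(1)`. -/
noncomputable def cf (j k : Vtx) : Alg6 q →ₗ[K] K := (basis6 q).coeff j k v1

/-- Off the order `upPath` takes its default value `[]`, whose path is 0. This lets the formulas
below hold for all indices. -/
theorem xx_of_not {j k : Vtx} (h : Vtx.leB j k = false) : xx q j k = 0 := by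
  revert h
  cases j <;> cases k <;> intro h <;>
  first
  | exact absurd h (by decide)
  | exact (congrArg (· * _) (map_zero (mk6 q))).trans (zero_mul _)

theorem cf_xx (j k j' k' : Vtx) :
    cf q j k (xx q j' k') = if j = j' ∧ k = k' ∧ Vtx.leB j k = true then 1 else 0 := by
  by_cases h : Vtx.leB j' k' = true
  · refine ((basis6 q).coeff_p h (v1_le k') j k v1).trans ?_
    by_cases h1 : j = j' ∧ k = k'
    · obtain ⟨rfl, rfl⟩ := h1
      simp [h]
    · rw [if_neg fun h2 => h1 ⟨h2.1, h2.2.1⟩, if_neg fun h2 => h1 ⟨h2.1, h2.2.1⟩]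
  · rw [xx_of_not q (by simpa using h), map_zero, if_neg]
    rintro ⟨rfl, rfl, h1⟩
    exact h h1

theorem arr_mul_xx_of_adj {i j : Vtx} (h : adj6 i j = true) (i' k : Vtx) :
    arr q i j * xx q i' k = if i = i' ∧ Vtx.leB i k = true then
      (if Vtx.leB j i = true then xx q j k else
        ((tbl j i k).map fun r => tblCoeff q j i k • xx q j r).getD 0) else 0 := by
  by_cases h1 : Vtx.leB i' k = true
  · by_cases h2 : i = i'
    · subst h2
      rw [if_pos ⟨rfl, h1⟩]
      rcases adj6_le i j h with h3 | h3
      · have h4 : ¬ Vtx.leB j i = true := not_le_of_gt h3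
        rw [if_neg h4]
        cases h5 : tbl j i k with
        | none => exact arr_mul_pp_up_none q h h3 h1 (v1_le k) h5
        | some r => exact arr_mul_pp_up q h h3 h1 (v1_le k) h5
      · rw [if_pos (show Vtx.leB j i = true from h3.le)]
        exact arr_mul_pp_dn q h h3 h1 (v1_le k)
    · rw [if_neg fun h3 => h2 h3.1, ← arr_mul_idem, xx, ← idem_mul_pp q h1 (v1_le k), mul_assoc,
        ← mul_assoc (idem6 q i), idem6_mul_ne q h2, zero_mul, mul_zero]
  · rw [xx_of_not q (by simpa using h1), mul_zero, if_neg]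
    rintro ⟨rfl, h2⟩
    exact h1 h2

theorem arr_of_not {i j : Vtx} (h : adj6 i j = false) : arr q i j = 0 := by
  rw [arr, arrow, dif_neg (by simp [h]), map_zero]

/-- Free of side conditions, this is a rewriting rule that evaluates any arrow on any basis vector.
-/
theorem arr_mul_xx (i j i' k : Vtx) : arr q i j * xx q i' k =
    bif adj6 i j then if i = i' ∧ Vtx.leB i k = true then
      (if Vtx.leB j i = true then xx q j k else
        ((tbl j i k).map fun r => tblCoeff q j i k • xx q j r).getD 0) else 0 else 0 := by
  cases h : adj6 i j
  · rw [arr_of_not q h, zero_mul]; rfl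
  · exact arr_mul_xx_of_adj q h i' k

theorem idem_mul_xx (i j k : Vtx) : idem6 q i * xx q j k = if i = j then xx q j k else 0 := by
  by_cases h : Vtx.leB j k = true
  · split_ifs with h1
    · subst h1; exact idem_mul_pp q h (v1_le k)
    · rw [xx, ← idem_mul_pp q h (v1_le k), ← mul_assoc, idem6_mul_ne q h1, zero_mul]
  · rw [xx_of_not q (by simpa using h), mul_zero, ite_self]

theorem xx_mem (j k : Vtx) : xx q j k ∈ P (idem6 q) v1 := by
  by_cases h : Vtx.leB j k = true
  · exact (basis6 q).p_mem_P h (v1_le k)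
  · rw [xx_of_not q (by simpa using h)]; exact Submodule.zero_mem _

theorem tGen_v1 : tGen q v1 = xx q v1 v6 := pth_1456541 q
theorem tGen_v2 : tGen q v2 = xx q v1 v5 := pth_14541 q
theorem tGen_v3 : tGen q v3 = q • xx q v1 v3 - xx q v1 v4 := by
  rw [tGen, pth_12321, pth_141, xx, xx]
theorem tGen_v4 : tGen q v4 = xx q v1 v4 - xx q v1 v3 := by
  rw [tGen, pth_12321, pth_141, xx, xx]
theorem tGen_v6 : tGen q v6 = xx q v1 v1 := (pp_self q v1).symm

/-- A cyclic module with a generator at the vertex `1` is indecomposable. -/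
theorem isIndecomposable_span {M : Type*} [AddCommGroup M] [Module K M] [Module (Alg6 q) M]
    [IsScalarTower K (Alg6 q) M] {t : M} (ht : t ≠ 0) (h1 : idem6 q v1 • t = t) :
    IsIndecomposable (Alg6 q) (Submodule.span (Alg6 q) {t}) := by
  set T := Submodule.span (Alg6 q) {t} with hT
  let t' : T := ⟨t, Submodule.mem_span_singleton_self t⟩
  have htop : ∀ N : Submodule (Alg6 q) T, t' ∈ N → N = ⊤ := fun N hN => by
    rw [eq_top_iff]
    rintro ⟨x, hx⟩ -
    obtain ⟨a, rfl⟩ := Submodule.mem_span_singleton.1 hx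
    exact N.smul_mem a hN
  have ht' : t' ≠ 0 := fun h => ht (congrArg Subtype.val h)
  have h1' : idem6 q v1 • t' = t' := Subtype.ext h1
  have hchi : ∀ a ∈ P (idem6 q) v1, cf q v1 v1 a ≠ 0 → ∃ b : Alg6 q, b • (a • t') = t' := by
    intro a ha hc
    obtain ⟨b, hb⟩ := Submodule.mem_span_singleton.1 ((basis6 q).e_mem_span ha hc)
    refine ⟨b, ?_⟩
    rw [← mul_smul, ← smul_eq_mul, hb, h1']
  refine ⟨⟨t', 0, ht'⟩, fun N N' hc => ?_⟩
  have hmem : t' ∈ N ⊔ N' := by rw [hc.sup_eq_top]; trivial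
  obtain ⟨y, hy, z, hz, hyz⟩ := Submodule.mem_sup.1 hmem
  have hex : ∀ x : T, ∃ a ∈ P (idem6 q) v1, a • t' = x := by
    rintro ⟨x, hx⟩
    obtain ⟨a, rfl⟩ := Submodule.mem_span_singleton.1 hx
    exact ⟨a * idem6 q v1, Submodule.mem_span_singleton.2 ⟨a, rfl⟩,
      Subtype.ext (by rw [mul_smul, h1']; rfl)⟩
  obtain ⟨a, ha, hay⟩ := hex y
  -- With t = y + z and y = a t one has z = (e_1 - a) t. Either a or e_1 - a has nonzero coefficient
  -- at e_1 and hence generates P(1), so y or z generates the whole module.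
  by_cases hca : cf q v1 v1 a = 0
  · left
    obtain ⟨b, hb⟩ := hchi (idem6 q v1 - a)
      (Submodule.sub_mem _ (e_mem_P (idem6 q) v1) ha) (by
        rw [map_sub, hca, ← pp_self]
        change cf q v1 v1 (xx q v1 v1) - 0 ≠ 0
        simp [cf_xx, Vtx.leB])
    rw [sub_smul, h1', hay, ← hyz, add_sub_cancel_left, hyz] at hb
    have := htop N' (hb ▸ N'.smul_mem b hz)
    rw [this] at hc
    exact eq_bot_of_isCompl_top hc
  · right
    obtain ⟨b, hb⟩ := hchi a ha hca
    rw [hay] at hb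
    have := htop N (hb ▸ N.smul_mem b hy)
    rw [this] at hc
    exact eq_bot_of_top_isCompl hc

end ProjectiveOne
end OneQH

namespace OneQH
open Vtx

set_option linter.unusedSimpArgs false
set_option linter.unnecessarySeqFocus false
set_option linter.unreachableTactic false
set_option linter.unusedTactic false

/-! ### Adapted families for T(1), T(2), T(3), T(4) -/

section Families

variable {K : Type u} [Field K] (q : K)

theorem mem_of_eq_smul {M : Type*} [AddCommGroup M] [Module (Alg6 q) M]
    {N : Submodule (Alg6 q) M} {x y : M} (hx : x ∈ N) (a : Alg6 q) (h : y = a • x) : y ∈ N :=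
  h ▸ N.smul_mem a hx

theorem scalar_smul_mem {M : Type*} [AddCommGroup M] [Module (Alg6 q) M] [Module K M]
    [IsScalarTower K (Alg6 q) M] {N : Submodule (Alg6 q) M} {x : M} (hx : x ∈ N) (c : K) :
    c • x ∈ N := (N.restrictScalars K).smul_mem c hx

/-- Throughout, c is the inverse of q - 1, given by the equation c(q - 1) = 1 so that scalar
identities remain polynomial. -/
theorem scalar_ne {c : K} (hc : c * (q - 1) = 1) : c ≠ 0 ∧ q - 1 ≠ 0 := by
  constructor <;> rintro h <;> simp [h] at hc

theorem deltaFamily_v1 :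
    GradedFamily q (fun i j => Vtx.leB j i) (Submodule.span (Alg6 q) {xx q v1 v6})
      ![v1]
      ![fun _ => xx q v1 v6] where
  wt := by
    intro t l hl
    fin_cases t <;> cases l <;> first
    | exact absurd hl (by decide)
    | simp [idem_mul_xx, smul_eq_mul, mul_sub, mul_smul_comm]
  dual := by
    intro t l hl
    refine ⟨![cf q v1 v6] t, ?_⟩
    fin_cases t <;> cases l <;> first
    | exact absurd hl (by decide)
    | (intro t' hl'
       fin_cases t' <;> first
        | exact absurd hl' (by decide)
        | simp [cf_xx, Vtx.leB])
  mem := by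
    intro t l hl
    fin_cases t <;> cases l <;> first
    | exact absurd hl (by decide)
    | exact Submodule.mem_span_singleton_self _
  gen := ⟨_, rfl, by
    rintro _ rfl
    exact Submodule.subset_span ⟨0, v1, by decide, rfl⟩⟩
  act := by
    intro t i j h hi
    refine ⟨![fun _ _ => []] t i j, ?_⟩
    fin_cases t <;> cases i <;> first
    | exact absurd hi (by decide)
    | (cases j <;> first
       | exact absurd h (by decide)
       | simp [arr_mul_xx, smul_eq_mul, mul_sub, mul_smul_comm, tbl, tblCoeff, Vtx.leB, adj6,
           sub_smul, ← leB_iff])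


theorem nablaFamily_v1 :
    GradedFamily q Vtx.leB (Submodule.span (Alg6 q) {xx q v1 v6})
      ![v1]
      ![fun _ => xx q v1 v6] where
  wt := by
    intro t l hl
    fin_cases t <;> cases l <;> first
    | exact absurd hl (by decide)
    | simp [idem_mul_xx, smul_eq_mul, mul_sub, mul_smul_comm]
  dual := by
    intro t l hl
    refine ⟨![cf q v1 v6] t, ?_⟩
    fin_cases t <;> cases l <;> first
    | exact absurd hl (by decide)
    | (intro t' hl'
       fin_cases t' <;> first
        | exact absurd hl' (by decide)
        | simp [cf_xx, Vtx.leB])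
  mem := by
    intro t l hl
    fin_cases t <;> cases l <;> first
    | exact absurd hl (by decide)
    | exact Submodule.mem_span_singleton_self _
  gen := ⟨_, rfl, by
    rintro _ rfl
    exact Submodule.subset_span ⟨0, v1, by decide, rfl⟩⟩
  act := by
    intro t i j h hi
    refine ⟨![fun _ _ => []] t i j, ?_⟩
    fin_cases t <;> cases i <;> first
    | exact absurd hi (by decide)
    | (cases j <;> first
       | exact absurd h (by decide)
       | simp [arr_mul_xx, smul_eq_mul, mul_sub, mul_smul_comm, tbl, tblCoeff, Vtx.leB, adj6,
           sub_smul, ← leB_iff])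


theorem mem_v2 : xx q v1 v5 ∈ Submodule.span (Alg6 q) {xx q v1 v5} ∧
    xx q v2 v6 ∈ Submodule.span (Alg6 q) {xx q v1 v5} ∧
    xx q v1 v6 ∈ Submodule.span (Alg6 q) {xx q v1 v5} := by
  have h1 := Submodule.mem_span_singleton_self (R := Alg6 q) (xx q v1 v5)
  have h2 := mem_of_eq_smul q (y := xx q v2 v6) h1 (arr q v1 v2)
    (by simp [arr_mul_xx, smul_eq_mul, mul_sub, mul_smul_comm, tbl, tblCoeff, Vtx.leB, adj6,
        sub_smul, ← leB_iff])
  exact ⟨h1, h2, mem_of_eq_smul q h2 (arr q v2 v1) (by simp [arr_mul_xx, smul_eq_mul, mul_sub,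
      mul_smul_comm, tbl, tblCoeff, Vtx.leB, adj6, sub_smul, ← leB_iff])⟩

/-- The bottom layer is Δ(2), spanned by the vectors of level 6; the generator spans Δ(1) on top. -/
theorem deltaFamily_v2 :
    GradedFamily q (fun i j => Vtx.leB j i) (Submodule.span (Alg6 q) {xx q v1 v5})
      ![v2, v1]
      ![fun l => xx q l v6, fun _ => xx q v1 v5] where
  wt := by
    intro t l hl
    fin_cases t <;> cases l <;> first
    | exact absurd hl (by decide)
    | simp [idem_mul_xx, smul_eq_mul, mul_sub, mul_smul_comm]
  dual := by
    intro t l hl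
    refine ⟨![cf q l v6, cf q v1 v5] t, ?_⟩
    fin_cases t <;> cases l <;> first
    | exact absurd hl (by decide)
    | (intro t' hl'
       fin_cases t' <;> first
        | exact absurd hl' (by decide)
        | simp [cf_xx, Vtx.leB])
  mem := by
    intro t l hl
    obtain ⟨h1, h2, h3⟩ := mem_v2 q
    fin_cases t <;> cases l <;> first
    | exact absurd hl (by decide)
    | assumption
    | exact scalar_smul_mem q ‹_› _
  gen := ⟨_, rfl, by
    rintro _ rfl
    exact Submodule.subset_span ⟨1, v1, by decide, rfl⟩⟩
  act := by
    intro t i j h hi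
    refine ⟨![fun _ _ => [], fun _ _ => [(1, 0)]] t i j, ?_⟩
    fin_cases t <;> cases i <;> first
    | exact absurd hi (by decide)
    | (cases j <;> first
       | exact absurd h (by decide)
       | simp [arr_mul_xx, smul_eq_mul, mul_sub, mul_smul_comm, tbl, tblCoeff, Vtx.leB, adj6,
           sub_smul, ← leB_iff])


/-- Now the socle vector is split off as ∇(1), and the generator and its image under 1 → 2 form
∇(2). -/
theorem nablaFamily_v2 :
    GradedFamily q Vtx.leB (Submodule.span (Alg6 q) {xx q v1 v5})
      ![v1, v2]
      ![fun _ => xx q v1 v6, fun l => match l with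
        | v1 => xx q v1 v5
        | _ => xx q v2 v6] where
  wt := by
    intro t l hl
    fin_cases t <;> cases l <;> first
    | exact absurd hl (by decide)
    | simp [idem_mul_xx, smul_eq_mul, mul_sub, mul_smul_comm]
  dual := by
    intro t l hl
    refine ⟨![cf q v1 v6, cf q v1 v5 + cf q v2 v6] t, ?_⟩
    fin_cases t <;> cases l <;> first
    | exact absurd hl (by decide)
    | (intro t' hl'
       fin_cases t' <;> first
        | exact absurd hl' (by decide)
        | simp [cf_xx, Vtx.leB])
  mem := by
    intro t l hl
    obtain ⟨h1, h2, h3⟩ := mem_v2 q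
    fin_cases t <;> cases l <;> first
    | exact absurd hl (by decide)
    | assumption
    | exact scalar_smul_mem q ‹_› _
  gen := ⟨_, rfl, by
    rintro _ rfl
    exact Submodule.subset_span ⟨1, v1, by decide, rfl⟩⟩
  act := by
    intro t i j h hi
    refine ⟨![fun _ _ => [], fun i _ => match i with
      | v2 => [(1, 0)]
      | _ => []] t i j, ?_⟩
    fin_cases t <;> cases i <;> first
    | exact absurd hi (by decide)
    | (cases j <;> first
       | exact absurd h (by decide)
       | simp [arr_mul_xx, smul_eq_mul, mul_sub, mul_smul_comm, tbl, tblCoeff, Vtx.leB, adj6,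
           sub_smul, ← leB_iff])


/-- The generator is chosen so that 1 → 2 kills it; 1 → 4 sends it to q - 1 times a basis vector,
and q - 1 can be inverted. -/
theorem mem_v4 {c : K} (hc : c * (q - 1) = 1) :
    xx q v1 v4 - xx q v1 v3 ∈ Submodule.span (Alg6 q) {xx q v1 v4 - xx q v1 v3} ∧
    xx q v4 v6 ∈ Submodule.span (Alg6 q) {xx q v1 v4 - xx q v1 v3} ∧
    xx q v1 v6 ∈ Submodule.span (Alg6 q) {xx q v1 v4 - xx q v1 v3} := by
  have h1 := Submodule.mem_span_singleton_self (R := Alg6 q) (xx q v1 v4 - xx q v1 v3)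
  have h2 : xx q v4 v6 ∈ Submodule.span (Alg6 q) {xx q v1 v4 - xx q v1 v3} := by
    have h := scalar_smul_mem q (mem_of_eq_smul q (y := (q - 1) • xx q v4 v6) h1 (arr q v1 v4)
      (by simp [arr_mul_xx, smul_eq_mul, mul_sub, mul_smul_comm, tbl, tblCoeff, Vtx.leB, adj6,
          sub_smul, ← leB_iff])) c
    rwa [smul_smul, hc, one_smul] at h
  exact ⟨h1, h2, mem_of_eq_smul q h2 (arr q v4 v1) (by simp [arr_mul_xx, smul_eq_mul, mul_sub,
      mul_smul_comm, tbl, tblCoeff, Vtx.leB, adj6, sub_smul, ← leB_iff])⟩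

theorem deltaFamily_v4 {c : K} (hc : c * (q - 1) = 1) :
    GradedFamily q (fun i j => Vtx.leB j i) (Submodule.span (Alg6 q) {xx q v1 v4 - xx q v1 v3})
      ![v4, v1]
      ![fun l => xx q l v6, fun _ => xx q v1 v4 - xx q v1 v3] where
  wt := by
    intro t l hl
    fin_cases t <;> cases l <;> first
    | exact absurd hl (by decide)
    | simp [idem_mul_xx, smul_eq_mul, mul_sub, mul_smul_comm]
  dual := by
    intro t l hl
    refine ⟨![cf q l v6, cf q v1 v4] t, ?_⟩
    fin_cases t <;> cases l <;> first
    | exact absurd hl (by decide)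
    | (intro t' hl'
       fin_cases t' <;> first
        | exact absurd hl' (by decide)
        | simp [cf_xx, Vtx.leB])
  mem := by
    intro t l hl
    obtain ⟨h1, h2, h3⟩ := mem_v4 q hc
    fin_cases t <;> cases l <;> first
    | exact absurd hl (by decide)
    | assumption
    | exact scalar_smul_mem q ‹_› _
  gen := ⟨_, rfl, by
    rintro _ rfl
    exact Submodule.subset_span ⟨1, v1, by decide, rfl⟩⟩
  act := by
    intro t i j h hi
    refine ⟨![fun _ _ => [], fun _ j => match j with
      | v4 => [(q - 1, 0)]
      | _ => []] t i j, ?_⟩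
    fin_cases t <;> cases i <;> first
    | exact absurd hi (by decide)
    | (cases j <;> first
       | exact absurd h (by decide)
       | simp [arr_mul_xx, smul_eq_mul, mul_sub, mul_smul_comm, tbl, tblCoeff, Vtx.leB, adj6,
           sub_smul, ← leB_iff])


/-- The generator is scaled by c, since 1 → 4 must send it to the next vector of ∇(4) with
coefficient exactly 1. -/
theorem nablaFamily_v4 {c : K} (hc : c * (q - 1) = 1) :
    GradedFamily q Vtx.leB (Submodule.span (Alg6 q) {xx q v1 v4 - xx q v1 v3})
      ![v1, v4]
      ![fun _ => xx q v1 v6, fun l => match l with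
        | v1 => c • (xx q v1 v4 - xx q v1 v3)
        | _ => xx q v4 v6] where
  wt := by
    intro t l hl
    fin_cases t <;> cases l <;> first
    | exact absurd hl (by decide)
    | simp [idem_mul_xx, smul_eq_mul, mul_sub, mul_smul_comm]
  dual := by
    intro t l hl
    refine ⟨![cf q v1 v6, cf q v1 v4 + cf q v4 v6] t, ?_⟩
    fin_cases t <;> cases l <;> first
    | exact absurd hl (by decide)
    | (intro t' hl'
       fin_cases t' <;> first
        | exact absurd hl' (by decide)
        | simp [cf_xx, Vtx.leB, (scalar_ne q hc).1])
  mem := by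
    intro t l hl
    obtain ⟨h1, h2, h3⟩ := mem_v4 q hc
    fin_cases t <;> cases l <;> first
    | exact absurd hl (by decide)
    | assumption
    | exact scalar_smul_mem q ‹_› _
  gen := ⟨_, rfl, by
    rintro _ rfl
    have h := Submodule.smul_mem (Submodule.span K {x | ∃ t l, l ≤ ![v1,
        v4] t ∧ x = ![fun _ => xx q v1 v6, fun l => match l with
        | v1 => c • (xx q v1 v4 - xx q v1 v3)
        | _ => xx q v4 v6] t l})
      (q - 1) (Submodule.subset_span ⟨1, v1, by decide, rfl⟩)
    change (q - 1) • c • _ ∈ _ at h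
    rwa [smul_smul, mul_comm, hc, one_smul] at h⟩
  act := by
    intro t i j h hi
    refine ⟨![fun _ _ => [], fun i _ => match i with
      | v4 => [(1, 0)]
      | _ => []] t i j, ?_⟩
    fin_cases t <;> cases i <;> first
    | exact absurd hi (by decide)
    | (cases j <;> first
       | exact absurd h (by decide)
       | simp [arr_mul_xx, smul_eq_mul, mul_sub, mul_smul_comm, tbl, tblCoeff, Vtx.leB, adj6,
           sub_smul, ← leB_iff])
    all_goals match_scalars
    all_goals linear_combination hc

/-- Here 1 → 4 kills the generator, by q - q = 0, while 1 → 2 multiplies by q - 1. -/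
theorem mem_v3 {c : K} (hc : c * (q - 1) = 1) (N : Submodule (Alg6 q) (Alg6 q))
    (hN : N = Submodule.span (Alg6 q) {q • xx q v1 v3 - xx q v1 v4}) :
    q • xx q v1 v3 - xx q v1 v4 ∈ N ∧ xx q v2 v5 ∈ N ∧ xx q v1 v5 ∈ N ∧ xx q v3 v6 ∈ N ∧
    xx q v2 v6 ∈ N ∧
      xx q v1 v6 ∈ N := by
  subst hN
  have h1 := Submodule.mem_span_singleton_self (R := Alg6 q) (q • xx q v1 v3 - xx q v1 v4)
  have h2 : xx q v2 v5 ∈ Submodule.span (Alg6 q) {q • xx q v1 v3 - xx q v1 v4} := by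
    have h := scalar_smul_mem q (mem_of_eq_smul q (y := (q - 1) • xx q v2 v5) h1 (arr q v1 v2)
      (by simp [arr_mul_xx, smul_eq_mul, mul_sub, mul_smul_comm, tbl, tblCoeff, Vtx.leB, adj6,
          sub_smul, ← leB_iff])) c
    rwa [smul_smul, hc, one_smul] at h
  have h3 := mem_of_eq_smul q (y := xx q v3 v6) h2 (arr q v2 v3) (by simp [arr_mul_xx, smul_eq_mul,
      mul_sub, mul_smul_comm, tbl, tblCoeff, Vtx.leB, adj6, sub_smul, ← leB_iff])
  have h4 := mem_of_eq_smul q (y := xx q v2 v6) h3 (arr q v3 v2) (by simp [arr_mul_xx, smul_eq_mul,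
      mul_sub, mul_smul_comm, tbl, tblCoeff, Vtx.leB, adj6, sub_smul, ← leB_iff])
  exact ⟨h1, h2, mem_of_eq_smul q h2 (arr q v2 v1) (by simp [arr_mul_xx, smul_eq_mul, mul_sub,
      mul_smul_comm, tbl, tblCoeff, Vtx.leB, adj6, sub_smul, ← leB_iff]), h3, h4,
    mem_of_eq_smul q h4 (arr q v2 v1) (by simp [arr_mul_xx, smul_eq_mul, mul_sub, mul_smul_comm,
        tbl, tblCoeff, Vtx.leB, adj6, sub_smul, ← leB_iff])⟩

/-- The layers Δ(3) and Δ(2) are the parts of level 6 and 5; the generator adds Δ(1). -/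
theorem deltaFamily_v3 {c : K} (hc : c * (q - 1) = 1) :
    GradedFamily q (fun i j => Vtx.leB j i) (Submodule.span (Alg6 q) {q • xx q v1 v3 - xx q v1 v4})
      ![v3, v2, v1]
      ![fun l => xx q l v6, fun l => xx q l v5,
        fun _ => q • xx q v1 v3 - xx q v1 v4] where
  wt := by
    intro t l hl
    fin_cases t <;> cases l <;> first
    | exact absurd hl (by decide)
    | simp [idem_mul_xx, smul_eq_mul, mul_sub, mul_smul_comm]
  dual := by
    intro t l hl
    refine ⟨![cf q l v6, cf q l v5, cf q v1 v4] t, ?_⟩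
    fin_cases t <;> cases l <;> first
    | exact absurd hl (by decide)
    | (intro t' hl'
       fin_cases t' <;> first
        | exact absurd hl' (by decide)
        | simp [cf_xx, Vtx.leB])
  mem := by
    intro t l hl
    obtain ⟨h1, h2, h3, h4, h5, h6⟩ := mem_v3 q hc _ rfl
    fin_cases t <;> cases l <;> first
    | exact absurd hl (by decide)
    | assumption
    | exact scalar_smul_mem q ‹_› _
  gen := ⟨_, rfl, by
    rintro _ rfl
    exact Submodule.subset_span ⟨2, v1, by decide, rfl⟩⟩
  act := by
    intro t i j h hi
    refine ⟨![fun _ _ => [], fun i j => match i, j with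
      | v2, v3 => [(1, 0)]
      | v1, v2 => [(1, 0)]
      | _, _ => [], fun _ _ => [(q - 1, 1)]] t i j, ?_⟩
    fin_cases t <;> cases i <;> first
    | exact absurd hi (by decide)
    | (cases j <;> first
       | exact absurd h (by decide)
       | simp [arr_mul_xx, smul_eq_mul, mul_sub, mul_smul_comm, tbl, tblCoeff, Vtx.leB, adj6,
           sub_smul, ← leB_iff])


theorem nablaFamily_v3 {c : K} (hc : c * (q - 1) = 1) :
    GradedFamily q Vtx.leB (Submodule.span (Alg6 q) {q • xx q v1 v3 - xx q v1 v4})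
      ![v1, v2, v3]
      ![fun _ => xx q v1 v6, fun l => match l with
        | v1 => xx q v1 v5
        | _ => xx q v2 v6, fun l => match l with
        | v1 => c • (q • xx q v1 v3 - xx q v1 v4)
        | v2 => xx q v2 v5
        | _ => xx q v3 v6] where
  wt := by
    intro t l hl
    fin_cases t <;> cases l <;> first
    | exact absurd hl (by decide)
    | simp [idem_mul_xx, smul_eq_mul, mul_sub, mul_smul_comm]
  dual := by
    intro t l hl
    refine ⟨![cf q v1 v6, cf q v1 v5 + cf q v2 v6, cf q v1 v4 + cf q v2 v5 + cf q v3 v6] t, ?_⟩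
    fin_cases t <;> cases l <;> first
    | exact absurd hl (by decide)
    | (intro t' hl'
       fin_cases t' <;> first
        | exact absurd hl' (by decide)
        | simp [cf_xx, Vtx.leB, (scalar_ne q hc).1])
  mem := by
    intro t l hl
    obtain ⟨h1, h2, h3, h4, h5, h6⟩ := mem_v3 q hc _ rfl
    fin_cases t <;> cases l <;> first
    | exact absurd hl (by decide)
    | assumption
    | exact scalar_smul_mem q ‹_› _
  gen := ⟨_, rfl, by
    rintro _ rfl
    have h := Submodule.smul_mem (Submodule.span K {x | ∃ t l, l ≤ ![v1, v2,
        v3] t ∧ x = ![fun _ => xx q v1 v6, fun l => match l with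
        | v1 => xx q v1 v5
        | _ => xx q v2 v6, fun l => match l with
        | v1 => c • (q • xx q v1 v3 - xx q v1 v4)
        | v2 => xx q v2 v5
        | _ => xx q v3 v6] t l})
      (q - 1) (Submodule.subset_span ⟨2, v1, by decide, rfl⟩)
    change (q - 1) • c • _ ∈ _ at h
    rwa [smul_smul, mul_comm, hc, one_smul] at h⟩
  act := by
    intro t i j h hi
    refine ⟨![fun _ _ => [], fun i _ => match i with
      | v2 => [(1, 0)]
      | _ => [], fun i _ => match i with
      | v2 => [(1, 1)]
      | v3 => [(1, 1)]
      | _ => []] t i j, ?_⟩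
    fin_cases t <;> cases i <;> first
    | exact absurd hi (by decide)
    | (cases j <;> first
       | exact absurd h (by decide)
       | simp [arr_mul_xx, smul_eq_mul, mul_sub, mul_smul_comm, tbl, tblCoeff, Vtx.leB, adj6,
           sub_smul, ← leB_iff])
    all_goals match_scalars
    all_goals linear_combination hc
end Families
end OneQH

namespace OneQH
open Vtx

set_option linter.unusedSimpArgs false
set_option linter.unnecessarySeqFocus false
set_option linter.unreachableTactic false
set_option linter.unusedTactic false

/-! ### Adapted families for T(6) = P(1) -/

section Families

variable {K : Type u} [Field K] (q : K)

/-- The position in the standard filtration of `P(1)`. -/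
def deltaPos : Vtx → Fin 6
  | v6 => 0 | v5 => 1 | v4 => 2 | v3 => 3 | v2 => 4 | v1 => 5

theorem deltaFamily_v6 :
    GradedFamily q (fun i j => Vtx.leB j i) (P (idem6 q) v1)
      ![v6, v5, v4, v3, v2, v1]
      (fun t l => xx q l (![v6, v5, v4, v3, v2, v1] t)) where
  wt := by
    intro t l hl
    fin_cases t <;> cases l <;> first
    | exact absurd hl (by decide)
    | simp [idem_mul_xx, smul_eq_mul, mul_sub, mul_smul_comm]
  dual := by
    intro t l hl
    refine ⟨cf q l (![v6, v5, v4, v3, v2, v1] t), ?_⟩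
    fin_cases t <;> cases l <;> first
    | exact absurd hl (by decide)
    | (intro t' hl'
       fin_cases t' <;> first
        | exact absurd hl' (by decide)
        | simp [cf_xx, Vtx.leB])
  mem := by
    intro t l hl
    fin_cases t <;> cases l <;> first
    | exact absurd hl (by decide)
    | exact xx_mem q _ _
    | exact scalar_smul_mem q (Submodule.sub_mem _ (xx_mem q _ _) (xx_mem q _ _)) _
    | exact scalar_smul_mem q (Submodule.sub_mem _
        (scalar_smul_mem q (xx_mem q _ _) q) (xx_mem q _ _)) _
  gen := ⟨_, rfl, by
    rintro _ rfl
    exact Submodule.subset_span ⟨5, v1, by decide, (pp_self q v1).symm⟩⟩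
  act := by
    intro t i j h hi
    -- An ascending arrow i → j moves level k to level `tbl j i k`, which comes earlier in the list;
    -- a descending arrow needs no correction.
    refine ⟨(fun t i j =>
      ((tbl j i (![v6, v5, v4, v3, v2, v1] t)).map fun r => (tblCoeff q j i (![v6, v5, v4, v3, v2,
          v1] t), deltaPos r)).toList.filter
        fun _ => !Vtx.leB j i) t i j, ?_⟩
    fin_cases t <;> cases i <;> first
    | exact absurd hi (by decide)
    | (cases j <;> first
       | exact absurd h (by decide)
       | simp [arr_mul_xx, smul_eq_mul, mul_sub, mul_smul_comm, tbl, tblCoeff, Vtx.leB, adj6,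
           sub_smul, ← leB_iff, deltaPos])


/-- Each layer follows the ascending arrows from a vector at the vertex 1: from e_1 for ∇(6), from
(121) for ∇(5). In the plane of (141) and (12321) the vector killed by 1 → 2 starts ∇(4) and the one
killed by 1 → 4 starts ∇(3); these are a basis because q ≠ 1. -/
theorem nablaFamily_v6 {c : K} (hc : c * (q - 1) = 1) :
    GradedFamily q Vtx.leB (P (idem6 q) v1)
      ![v1, v2, v4, v3, v5, v6]
      ![fun _ => xx q v1 v6, fun l => match l with
        | v1 => xx q v1 v5
        | _ => xx q v2 v6, fun l => match l with
        | v1 => c • (xx q v1 v4 - xx q v1 v3)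
        | _ => xx q v4 v6, fun l => match l with
        | v1 => c • (q • xx q v1 v3 - xx q v1 v4)
        | v2 => xx q v2 v5
        | _ => xx q v3 v6, fun l => match l with
        | v1 => xx q v1 v2
        | v2 => xx q v2 v3
        | v3 => xx q v3 v5
        | v4 => xx q v4 v5
        | _ => xx q v5 v6, fun l => xx q l l] where
  wt := by
    intro t l hl
    fin_cases t <;> cases l <;> first
    | exact absurd hl (by decide)
    | simp [idem_mul_xx, smul_eq_mul, mul_sub, mul_smul_comm]
  dual := by
    intro t l hl
    -- On the plane of (141) and (12321) the third functional kills q(12321) - (141) and the fourth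
    -- kills (141) - (12321); each takes the value q - 1 on the other vector.
    refine ⟨![cf q v1 v6, cf q v1 v5 + cf q v2 v6, q • cf q v1 v4 + cf q v1 v3 + cf q v4 v6,
      cf q v1 v3 + cf q v1 v4 + cf q v2 v5 + cf q v3 v6, cf q v1 v2 + cf q v2 v3 + cf q v3 v5 +
      cf q v4 v5 + cf q v5 v6, cf q l l] t, ?_⟩
    fin_cases t <;> cases l <;> first
    | exact absurd hl (by decide)
    | (intro t' hl'
       fin_cases t' <;> first
        | exact absurd hl' (by decide)
        | simp [cf_xx, Vtx.leB, (scalar_ne q hc).1, ← sub_eq_add_neg, (scalar_ne q hc).2])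
  mem := by
    intro t l hl
    fin_cases t <;> cases l <;> first
    | exact absurd hl (by decide)
    | exact xx_mem q _ _
    | exact scalar_smul_mem q (Submodule.sub_mem _ (xx_mem q _ _) (xx_mem q _ _)) _
    | exact scalar_smul_mem q (Submodule.sub_mem _
        (scalar_smul_mem q (xx_mem q _ _) q) (xx_mem q _ _)) _
  gen := ⟨_, rfl, by
    rintro _ rfl
    exact Submodule.subset_span ⟨5, v1, by decide, (pp_self q v1).symm⟩⟩
  act := by
    intro t i j h hi
    refine ⟨![fun _ _ => [], fun i _ => match i with
      | v2 => [(1, 0)]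
      | _ => [], fun i _ => match i with
      | v4 => [(1, 0)]
      | _ => [], fun i _ => match i with
      | v2 => [(1, 1)]
      | v3 => [(1, 1)]
      | _ => [], fun i j => match i, j with
      | v2, v1 => [(1, 2), (1, 3)]
      | v3, v2 => [(1, 3)]
      | v4, v1 => [(1, 1)]
      | v5, v3 => [(1, 3)]
      | v5, v4 => [(1, 2)]
      | _, _ => [], fun i j => match i, j with
      | v4, v1 => [(q, 2), (1, 3)]
      | v2, v1 => [(1, 4)]
      | v3, v2 => [(1, 4)]
      | v5, v3 => [(1, 4)]
      | v5, v4 => [(1, 4)]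
      | v6, v5 => [(1, 4)]
      | _, _ => []] t i j, ?_⟩
    fin_cases t <;> cases i <;> first
    | exact absurd hi (by decide)
    | (cases j <;> first
       | exact absurd h (by decide)
       | simp [arr_mul_xx, smul_eq_mul, mul_sub, mul_smul_comm, tbl, tblCoeff, Vtx.leB, adj6,
           sub_smul, ← leB_iff])
    all_goals match_scalars
    all_goals first
    | ring1
    | linear_combination hc
    | linear_combination -hc
end Families
end OneQH

namespace OneQH
open Vtx

set_option linter.unusedSimpArgs false
set_option linter.unnecessarySeqFocus false
set_option linter.unreachableTactic false
set_option linter.unusedTactic false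

/-! ### Adapted families for T(5) -/

section Families

variable {K : Type u} [Field K] (q : K)

theorem T5_eq : T5 q = Submodule.span (Alg6 q)
    {(xx q v1 v2, xx q v1 v4 - xx q v1 v3), (xx q v1 v4, 0)} := by
  rw [T5, pth_121, pth_141, pth_12321]
  rfl

/-- The coordinates of the first component. -/
noncomputable def cf₁ (j k : Vtx) : Alg6 q × Alg6 q →ₗ[K] K := cf q j k ∘ₗ LinearMap.fst K _ _

/-- The coordinates of the second component. -/
noncomputable def cf₂ (j k : Vtx) : Alg6 q × Alg6 q →ₗ[K] K := cf q j k ∘ₗ LinearMap.snd K _ _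

theorem mul_sub_eq_one {c : K} (hc : c * (q - 1) = 1) : q * c - c = 1 := by linear_combination hc

theorem mul_comm_sub_eq_one {c : K} (hc : c * (q - 1) = 1) : c * q - c = 1 := by linear_combination hc

theorem neg_mul_add_mul_comm (c : K) : -(q * c) + c * q = 0 := by ring

theorem cf₁_mk (j k : Vtx) (x y : Alg6 q) : cf₁ q j k (x, y) = cf q j k x := rfl

theorem cf₂_mk (j k : Vtx) (x y : Alg6 q) : cf₂ q j k (x, y) = cf q j k y := rfl

/-- All these vectors arise from the first generator along arrows. The last one compares two
descents to 1: the one through 4 retains a second component, the one through 3 and 2 does not. -/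
theorem mem_v5 {c : K} (hc : c * (q - 1) = 1) (N : Submodule (Alg6 q) (Alg6 q × Alg6 q))
    (h1 : (xx q v1 v2, xx q v1 v4 - xx q v1 v3) ∈ N) :
    (xx q v2 v3, (0 : Alg6 q)) ∈ N ∧ (xx q v4 v5, (q - 1) • xx q v4 v6) ∈ N ∧
    (xx q v1 v5, (q - 1) • xx q v1 v6) ∈ N ∧ (xx q v1 v3, (0 : Alg6 q)) ∈ N ∧
    (xx q v3 v5, (0 : Alg6 q)) ∈ N ∧ (xx q v2 v5, (0 : Alg6 q)) ∈ N ∧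
    (xx q v1 v5, (0 : Alg6 q)) ∈ N ∧ (xx q v5 v6, (0 : Alg6 q)) ∈ N ∧
    (xx q v4 v6, (0 : Alg6 q)) ∈ N ∧ (xx q v3 v6, (0 : Alg6 q)) ∈ N ∧
    (xx q v2 v6, (0 : Alg6 q)) ∈ N ∧ (xx q v1 v6, (0 : Alg6 q)) ∈ N ∧
    ((0 : Alg6 q), xx q v1 v6) ∈ N := by
  have h2 := mem_of_eq_smul q (y := (xx q v2 v3, 0)) h1 (arr q v1 v2)
    (by simp [arr_mul_xx, smul_eq_mul, mul_sub, mul_smul_comm, tbl, tblCoeff, Vtx.leB, adj6,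
      sub_smul, ← leB_iff, Prod.smul_mk])
  have h3 := mem_of_eq_smul q (y := (xx q v4 v5, (q - 1) • xx q v4 v6)) h1 (arr q v1 v4)
    (by simp [arr_mul_xx, smul_eq_mul, mul_sub, mul_smul_comm, tbl, tblCoeff, Vtx.leB, adj6,
        sub_smul, ← leB_iff, Prod.smul_mk])
  have h4 := mem_of_eq_smul q (y := (xx q v1 v5, (q - 1) • xx q v1 v6)) h3 (arr q v4 v1)
    (by simp [arr_mul_xx, smul_eq_mul, mul_sub, mul_smul_comm, tbl, tblCoeff, Vtx.leB, adj6,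
        sub_smul, ← leB_iff, Prod.smul_mk])
  have h5 := mem_of_eq_smul q (y := (xx q v1 v3, 0)) h2 (arr q v2 v1)
    (by simp [arr_mul_xx, smul_eq_mul, mul_sub, mul_smul_comm, tbl, tblCoeff, Vtx.leB, adj6,
      sub_smul, ← leB_iff, Prod.smul_mk])
  have h6 := mem_of_eq_smul q (y := (xx q v3 v5, 0)) h2 (arr q v2 v3)
    (by simp [arr_mul_xx, smul_eq_mul, mul_sub, mul_smul_comm, tbl, tblCoeff, Vtx.leB, adj6,
      sub_smul, ← leB_iff, Prod.smul_mk])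
  have h7 := mem_of_eq_smul q (y := (xx q v2 v5, 0)) h6 (arr q v3 v2)
    (by simp [arr_mul_xx, smul_eq_mul, mul_sub, mul_smul_comm, tbl, tblCoeff, Vtx.leB, adj6,
      sub_smul, ← leB_iff, Prod.smul_mk])
  have h8 := mem_of_eq_smul q (y := (xx q v1 v5, 0)) h7 (arr q v2 v1)
    (by simp [arr_mul_xx, smul_eq_mul, mul_sub, mul_smul_comm, tbl, tblCoeff, Vtx.leB, adj6,
      sub_smul, ← leB_iff, Prod.smul_mk])
  have h9 := mem_of_eq_smul q (y := (xx q v5 v6, 0)) h6 (arr q v3 v5)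
    (by simp [arr_mul_xx, smul_eq_mul, mul_sub, mul_smul_comm, tbl, tblCoeff, Vtx.leB, adj6,
      sub_smul, ← leB_iff, Prod.smul_mk])
  have h10 := mem_of_eq_smul q (y := (xx q v4 v6, 0)) h9 (arr q v5 v4)
    (by simp [arr_mul_xx, smul_eq_mul, mul_sub, mul_smul_comm, tbl, tblCoeff, Vtx.leB, adj6,
      sub_smul, ← leB_iff, Prod.smul_mk])
  have h11 := mem_of_eq_smul q (y := (xx q v3 v6, 0)) h9 (arr q v5 v3)
    (by simp [arr_mul_xx, smul_eq_mul, mul_sub, mul_smul_comm, tbl, tblCoeff, Vtx.leB, adj6,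
      sub_smul, ← leB_iff, Prod.smul_mk])
  have h12 := mem_of_eq_smul q (y := (xx q v2 v6, 0)) h11 (arr q v3 v2)
    (by simp [arr_mul_xx, smul_eq_mul, mul_sub, mul_smul_comm, tbl, tblCoeff, Vtx.leB, adj6,
      sub_smul, ← leB_iff, Prod.smul_mk])
  have h13 := mem_of_eq_smul q (y := (xx q v1 v6, 0)) h12 (arr q v2 v1)
    (by simp [arr_mul_xx, smul_eq_mul, mul_sub, mul_smul_comm, tbl, tblCoeff, Vtx.leB, adj6,
      sub_smul, ← leB_iff, Prod.smul_mk])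
  refine ⟨h2, h3, h4, h5, h6, h7, h8, h9, h10, h11, h12, h13, ?_⟩
  have h14 := scalar_smul_mem q (Submodule.sub_mem _ h4 h8) c
  rwa [Prod.mk_sub_mk, sub_self, sub_zero, Prod.smul_mk, smul_zero, smul_smul, hc, one_smul] at h14

theorem mem_T5 {c : K} (hc : c * (q - 1) = 1) :
    (xx q v1 v2, xx q v1 v4 - xx q v1 v3) ∈ T5 q ∧ (xx q v1 v4, 0) ∈ T5 q ∧
    (xx q v2 v3, (0 : Alg6 q)) ∈ T5 q ∧ (xx q v4 v5, (q - 1) • xx q v4 v6) ∈ T5 q ∧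
    (xx q v1 v5, (q - 1) • xx q v1 v6) ∈ T5 q ∧ (xx q v1 v3, (0 : Alg6 q)) ∈ T5 q ∧
    (xx q v3 v5, (0 : Alg6 q)) ∈ T5 q ∧ (xx q v2 v5, (0 : Alg6 q)) ∈ T5 q ∧
    (xx q v1 v5, (0 : Alg6 q)) ∈ T5 q ∧ (xx q v5 v6, (0 : Alg6 q)) ∈ T5 q ∧
    (xx q v4 v6, (0 : Alg6 q)) ∈ T5 q ∧ (xx q v3 v6, (0 : Alg6 q)) ∈ T5 q ∧
    (xx q v2 v6, (0 : Alg6 q)) ∈ T5 q ∧ (xx q v1 v6, (0 : Alg6 q)) ∈ T5 q ∧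
    ((0 : Alg6 q), xx q v1 v6) ∈ T5 q ∧
    (c • (xx q v1 v4 - xx q v1 v3), (0 : Alg6 q)) ∈ T5 q ∧
    (c • (q • xx q v1 v3 - xx q v1 v4), (0 : Alg6 q)) ∈ T5 q := by
  have h1 : (xx q v1 v2, xx q v1 v4 - xx q v1 v3) ∈ T5 q := by
    rw [T5_eq]; exact Submodule.subset_span (Or.inl rfl)
  have h2 : (xx q v1 v4, (0 : Alg6 q)) ∈ T5 q := by
    rw [T5_eq]; exact Submodule.subset_span (Or.inr rfl)
  obtain ⟨a1, a2, a3, a4, a5, a6, a7, a8, a9, a10, a11, a12, a13⟩ := mem_v5 q hc _ h1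
  refine ⟨h1, h2, a1, a2, a3, a4, a5, a6, a7, a8, a9, a10, a11, a12, a13, ?_, ?_⟩
  · have h := scalar_smul_mem q (Submodule.sub_mem _ h2 a4) c
    rwa [Prod.mk_sub_mk, sub_self, Prod.smul_mk, smul_zero] at h
  · have h := scalar_smul_mem q (Submodule.sub_mem _ (scalar_smul_mem q a4 q) h2) c
    have h' : c • (q • (xx q v1 v3, (0 : Alg6 q)) - (xx q v1 v4, 0)) =
      (c • (q • xx q v1 v3 - xx q v1 v4), 0) := by simp
    rwa [h'] at h

/-- The second component is what keeps the layers Δ(4) and Δ(3) apart at the vertex 1, where both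
have the same first component. -/
theorem deltaFamily_v5 {c : K} (hc : c * (q - 1) = 1) :
    GradedFamily q (fun i j => Vtx.leB j i) (T5 q)
      ![v5, v4, v3, v2, v1, v1]
      ![fun l => (xx q l v6, 0), fun l => match l with
        | v4 => (xx q v4 v5, (q - 1) • xx q v4 v6)
        | _ => (xx q v1 v5, (q - 1) • xx q v1 v6), fun l => (xx q l v5, 0), fun l => (xx q l v3, 0),
        fun _ => (xx q v1 v2, xx q v1 v4 - xx q v1 v3), fun _ => (xx q v1 v4, 0)] where
  wt := by
    intro t l hl
    fin_cases t <;> cases l <;> first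
    | exact absurd hl (by decide)
    | simp [idem_mul_xx, smul_eq_mul, mul_sub, mul_smul_comm, Prod.smul_mk]
  dual := by
    intro t l hl
    -- The correction `- c • cf₂ q v1 v6` makes the third functional vanish on the Δ(4)-vector at
    -- the vertex 1, since c(q - 1) = 1.
    refine ⟨![cf₁ q l v6, cf₁ q v4 v5 + cf₂ q v1 v6, cf₁ q l v5 - c • cf₂ q v1 v6, cf₁ q l v3,
      cf₁ q v1 v2, cf₁ q v1 v4] t, ?_⟩
    fin_cases t <;> cases l <;> first
    | exact absurd hl (by decide)
    | (intro t' hl'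
       fin_cases t' <;> first
        | exact absurd hl' (by decide)
        | simp [cf₁_mk, cf₂_mk, cf_xx, Vtx.leB, (scalar_ne q hc).1, (scalar_ne q hc).2,
            ← sub_eq_add_neg, hc])
  mem := by
    intro t l hl
    obtain ⟨h1, h2, h3, h4, h5, h6, h7, h8, h9, h10, h11, h12, h13, h14, h15, h16, h17⟩ :=
      mem_T5 q hc
    fin_cases t <;> cases l <;> first
    | exact absurd hl (by decide)
    | assumption
  gen := ⟨_, T5_eq q, by
    rintro _ (rfl | rfl)
    · exact Submodule.subset_span ⟨4, v1, by decide, rfl⟩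
    · exact Submodule.subset_span ⟨5, v1, by decide, rfl⟩⟩
  act := by
    intro t i j h hi
    refine ⟨![fun _ _ => [], fun i j => match i, j with
      | v4, v5 => [(1, 0)]
      | v1, v2 => [(1, 0)]
      | _, _ => [], fun i j => match i, j with
      | v3, v5 => [(1, 0)]
      | v2, v3 => [(1, 0)]
      | v1, v2 => [(1, 0)]
      | _, _ => [], fun i j => match i, j with
      | v2, v3 => [(1, 2)]
      | v1, v2 => [(1, 2)]
      | v1, v4 => [(1, 0)]
      | _, _ => [], fun _ j => match j with
      | v2 => [(1, 3)]
      | _ => [(1, 1)], fun _ j => match j with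
      | v2 => [(1, 2)]
      | _ => [(q, 0)]] t i j, ?_⟩
    fin_cases t <;> cases i <;> first
    | exact absurd hi (by decide)
    | (cases j <;> first
       | exact absurd h (by decide)
       | simp [arr_mul_xx, smul_eq_mul, mul_sub, mul_smul_comm, tbl, tblCoeff, Vtx.leB, adj6,
           sub_smul, ← leB_iff, Prod.smul_mk])


/-- The first generator starts the layer ∇(5). The socle vectors of the two components give two
copies of ∇(1). -/
theorem nablaFamily_v5 {c : K} (hc : c * (q - 1) = 1) :
    GradedFamily q Vtx.leB (T5 q)
      ![v1, v1, v2, v4, v3, v5]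
      ![fun _ => (xx q v1 v6, 0), fun _ => (0, xx q v1 v6), fun l => match l with
        | v1 => (xx q v1 v5, 0)
        | _ => (xx q v2 v6, 0), fun l => match l with
        | v1 => (c • (xx q v1 v4 - xx q v1 v3), 0)
        | _ => (xx q v4 v6, 0), fun l => match l with
        | v1 => (c • (q • xx q v1 v3 - xx q v1 v4), 0)
        | v2 => (xx q v2 v5, 0)
        | _ => (xx q v3 v6, 0), fun l => match l with
        | v1 => (xx q v1 v2, xx q v1 v4 - xx q v1 v3)
        | v2 => (xx q v2 v3, 0)
        | v3 => (xx q v3 v5, 0)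
        | v4 => (xx q v4 v5, (q - 1) • xx q v4 v6)
        | _ => (xx q v5 v6, 0)] where
  wt := by
    intro t l hl
    fin_cases t <;> cases l <;> first
    | exact absurd hl (by decide)
    | simp [idem_mul_xx, smul_eq_mul, mul_sub, mul_smul_comm, Prod.smul_mk]
  dual := by
    intro t l hl
    refine ⟨![cf₁ q v1 v6, cf₂ q v1 v6, cf₁ q v1 v5 + cf₁ q v2 v6,
      q • cf₁ q v1 v4 + cf₁ q v1 v3 + cf₁ q v4 v6,
      cf₁ q v1 v3 + cf₁ q v1 v4 + cf₁ q v2 v5 + cf₁ q v3 v6,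
      cf₁ q v1 v2 + cf₁ q v2 v3 + cf₁ q v3 v5 + cf₁ q v4 v5 + cf₁ q v5 v6] t, ?_⟩
    fin_cases t <;> cases l <;> first
    | exact absurd hl (by decide)
    | (intro t' hl'
       fin_cases t' <;> first
        | exact absurd hl' (by decide)
        | simp [cf₁_mk, cf₂_mk, cf_xx, Vtx.leB, (scalar_ne q hc).1, (scalar_ne q hc).2,
            ← sub_eq_add_neg, mul_sub_eq_one q hc, mul_comm_sub_eq_one q hc,
            neg_mul_add_mul_comm q])
  mem := by
    intro t l hl
    obtain ⟨h1, h2, h3, h4, h5, h6, h7, h8, h9, h10, h11, h12, h13, h14, h15, h16, h17⟩ :=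
      mem_T5 q hc
    fin_cases t <;> cases l <;> first
    | exact absurd hl (by decide)
    | assumption
  gen := ⟨_, T5_eq q, by
    set U := Submodule.span K {x : Alg6 q × Alg6 q | ∃ t l, l ≤ ![v1, v1, v2, v4, v3,
        v5] t ∧ x = ![fun _ => (xx q v1 v6, 0), fun _ => (0, xx q v1 v6), fun l => match l with
        | v1 => (xx q v1 v5, 0)
        | _ => (xx q v2 v6, 0), fun l => match l with
        | v1 => (c • (xx q v1 v4 - xx q v1 v3), 0)
        | _ => (xx q v4 v6, 0), fun l => match l with
        | v1 => (c • (q • xx q v1 v3 - xx q v1 v4), 0)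
        | v2 => (xx q v2 v5, 0)
        | _ => (xx q v3 v6, 0), fun l => match l with
        | v1 => (xx q v1 v2, xx q v1 v4 - xx q v1 v3)
        | v2 => (xx q v2 v3, 0)
        | v3 => (xx q v3 v5, 0)
        | v4 => (xx q v4 v5, (q - 1) • xx q v4 v6)
        | _ => (xx q v5 v6, 0)] t l}
    have h3 : (c • (xx q v1 v4 - xx q v1 v3), (0 : Alg6 q)) ∈ U :=
      Submodule.subset_span ⟨3, v1, by decide, rfl⟩
    have h4 : (c • (q • xx q v1 v3 - xx q v1 v4), (0 : Alg6 q)) ∈ U :=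
      Submodule.subset_span ⟨4, v1, by decide, rfl⟩
    rintro _ (rfl | rfl)
    · exact Submodule.subset_span ⟨5, v1, by decide, rfl⟩
    -- (141) is recovered as q·c((141) - (12321)) + c(q(12321) - (141)).
    · convert Submodule.add_mem _ (Submodule.smul_mem _ q h3) h4 using 1
      rw [Prod.smul_mk, smul_zero, Prod.mk_add_mk, add_zero, Prod.mk.injEq]
      refine ⟨?_, rfl⟩
      match_scalars
      · linear_combination -hc
      · ring⟩
  act := by
    intro t i j h hi
    refine ⟨![fun _ _ => [], fun _ _ => [], fun i _ => match i with
      | v2 => [(1, 0)]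
      | _ => [], fun i _ => match i with
      | v4 => [(1, 0)]
      | _ => [], fun i _ => match i with
      | v2 => [(1, 2)]
      | v3 => [(1, 2)]
      | _ => [], fun i j => match i, j with
      | v2, v1 => [(1, 3), (1, 4)]
      | v3, v2 => [(1, 4)]
      | v4, v1 => [(1, 2), (q - 1, 1)]
      | v5, v3 => [(1, 4)]
      | v5, v4 => [(1, 3)]
      | _, _ => []] t i j, ?_⟩
    fin_cases t <;> cases i <;> first
    | exact absurd hi (by decide)
    | (cases j <;> first
       | exact absurd h (by decide)
       | simp [arr_mul_xx, smul_eq_mul, mul_sub, mul_smul_comm, tbl, tblCoeff, Vtx.leB, adj6,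
           sub_smul, ← leB_iff, Prod.smul_mk])
    all_goals match_scalars
    all_goals first
    | ring1
    | linear_combination hc
    | linear_combination -hc
end Families
end OneQH

namespace OneQH
open Vtx

set_option linter.unusedSimpArgs false

/-! ### The tilting modules; indecomposability of T(5) -/

section TiltingModules

variable {K : Type u} [Field K] (q : K)

theorem xx_ne_zero {j k : Vtx} (h : Vtx.leB j k = true) : xx q j k ≠ 0 := fun h0 => by
  have := congrArg (cf q j k) h0
  simp [cf_xx, h] at this

theorem idem_smul_tGen {i : Vtx} (hi : i ≠ v5) : idem6 q v1 • tGen q i = tGen q i := by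
  cases i
  case v5 => exact absurd rfl hi
  all_goals
    simp [tGen_v1, tGen_v2, tGen_v3, tGen_v4, tGen_v6, idem_mul_xx, smul_eq_mul, mul_sub,
      mul_smul_comm]

theorem tGen_ne_zero {i : Vtx} (hi : i ≠ v5) : tGen q i ≠ 0 := by
  cases i
  case v5 => exact absurd rfl hi
  case v3 =>
    rw [tGen_v3]
    intro h0
    have := congrArg (cf q v1 v4) h0
    simp [cf_xx, Vtx.leB] at this
  case v4 =>
    rw [tGen_v4]
    intro h0
    have := congrArg (cf q v1 v4) h0
    simp [cf_xx, Vtx.leB] at this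
  case v1 => rw [tGen_v1]; exact xx_ne_zero q rfl
  case v2 => rw [tGen_v2]; exact xx_ne_zero q rfl
  case v6 => rw [tGen_v6]; exact xx_ne_zero q rfl

theorem tGen_mem {i : Vtx} (hi : i ≠ v5) : tGen q i ∈ P (idem6 q) v1 := by
  cases i
  case v5 => exact absurd rfl hi
  case v1 => rw [tGen_v1]; exact xx_mem q _ _
  case v2 => rw [tGen_v2]; exact xx_mem q _ _
  case v3 =>
    rw [tGen_v3]
    exact Submodule.sub_mem _ (scalar_smul_mem q (xx_mem q _ _) q) (xx_mem q _ _)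
  case v4 => rw [tGen_v4]; exact Submodule.sub_mem _ (xx_mem q _ _) (xx_mem q _ _)
  case v6 => rw [tGen_v6]; exact xx_mem q _ _

theorem isTilting_span_tGen (hq : q ≠ 1) {i : Vtx} (hi : i ≠ v5) :
    IsTilting K (idem6 q) i (Submodule.span (Alg6 q) {tGen q i}) := by
  have hc : (q - 1)⁻¹ * (q - 1) = 1 := inv_mul_cancel₀ (sub_ne_zero.2 hq)
  have hN := isIndecomposable_span q (tGen_ne_zero q hi) (idem_smul_tGen q hi)
  cases i
  case v5 => exact absurd rfl hi
  case v1 =>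
    rw [tGen_v1] at hN ⊢
    exact isTilting_of_gradedFamily q hN (deltaFamily_v1 q) (nablaFamily_v1 q)
      (by decide) (by decide) (by decide) (by decide)
  case v2 =>
    rw [tGen_v2] at hN ⊢
    exact isTilting_of_gradedFamily q hN (deltaFamily_v2 q) (nablaFamily_v2 q)
      (by decide) (by decide) (by decide) (by decide)
  case v3 =>
    rw [tGen_v3] at hN ⊢
    exact isTilting_of_gradedFamily q hN (deltaFamily_v3 q hc) (nablaFamily_v3 q hc)
      (by decide) (by decide) (by decide) (by decide)
  case v4 =>
    rw [tGen_v4] at hN ⊢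
    exact isTilting_of_gradedFamily q hN (deltaFamily_v4 q hc) (nablaFamily_v4 q hc)
      (by decide) (by decide) (by decide) (by decide)
  case v6 =>
    exact isTilting_of_gradedFamily q hN (deltaFamily_v6 q) (nablaFamily_v6 q hc)
      (by decide) (by decide) (by decide) (by decide)

theorem T5_le : T5 q ≤ (P (idem6 q) v1).prod (P (idem6 q) v1) := by
  rw [T5_eq, Submodule.span_le]
  rintro _ (rfl | rfl)
  · exact ⟨xx_mem q _ _, Submodule.sub_mem _ (xx_mem q _ _) (xx_mem q _ _)⟩
  · exact ⟨xx_mem q _ _, Submodule.zero_mem _⟩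

theorem isIndecomposable_of_forall_le {A M : Type*} [Ring A] [AddCommGroup M] [Module A M]
    (T : Submodule A M) (hT : T ≠ ⊥)
    (h : ∀ N N' : Submodule A M, N ⊓ N' = ⊥ → N ⊔ N' = T → N = ⊥ ∨ N' = ⊥) :
    IsIndecomposable A T := by
  refine ⟨Submodule.nontrivial_iff_ne_bot.2 hT, fun N N' hc => ?_⟩
  have h1 : N.map T.subtype ⊓ N'.map T.subtype = ⊥ := by
    rw [← Submodule.map_inf _ T.injective_subtype, hc.inf_eq_bot, Submodule.map_bot]
  have h2 : N.map T.subtype ⊔ N'.map T.subtype = T := by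
    rw [← Submodule.map_sup, hc.sup_eq_top, Submodule.map_subtype_top]
  have h3 : ∀ L : Submodule A T, L.map T.subtype = ⊥ → L = ⊥ := fun L hL =>
    Submodule.map_injective_of_injective T.injective_subtype (hL.trans (Submodule.map_bot _).symm)
  exact (h _ _ h1 h2).imp (h3 N) (h3 N')

/-- The vertex `5` of `T(5)`. -/
theorem exists_idem5_smul {c : K} (hc : c * (q - 1) = 1) {n : Alg6 q × Alg6 q} (hn : n ∈ T5 q) :
    ∃ a : K, idem6 q v5 • n = a • (xx q v5 v6, (0 : Alg6 q)) := by
  obtain ⟨a, ha⟩ := (deltaFamily_v5 q hc).exists_idem_smul_eq hn v5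
  refine ⟨a 0, ?_⟩
  rw [ha]
  simp [Fin.sum_univ_succ, ← leB_iff, Vtx.leB]

/-- The vertex `1` of `T(5)`. -/
theorem exists_idem1_smul {c : K} (hc : c * (q - 1) = 1) {n : Alg6 q × Alg6 q} (hn : n ∈ T5 q) :
    ∃ a : Fin 6 → K, idem6 q v1 • n = (a 0 • xx q v1 v6 + a 1 • xx q v1 v5 + a 2 • xx q v1 v5 +
      a 3 • xx q v1 v3 + a 4 • xx q v1 v2 + a 5 • xx q v1 v4,
      (a 1 * (q - 1)) • xx q v1 v6 + a 4 • (xx q v1 v4 - xx q v1 v3)) := by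
  obtain ⟨a, ha⟩ := (deltaFamily_v5 q hc).exists_idem_smul_eq hn v1
  refine ⟨a, ?_⟩
  rw [ha]
  simp [Fin.sum_univ_succ, ← leB_iff, Vtx.leB, smul_smul, add_assoc]

/-- A summand N complementary to N' has to avoid everything below the line at the vertex 5. This
confines e_1 N to the two socle vectors. So N' contains the generators up to socle vectors, then the
socle vectors themselves, and thus all of T(5). -/
theorem eq_bot_of_idem5_mem {c : K} (hc : c * (q - 1) = 1)
    {N N' : Submodule (Alg6 q) (Alg6 q × Alg6 q)}
    (hinf : N ⊓ N' = ⊥) (hsup : N ⊔ N' = T5 q) (h : (xx q v5 v6, (0 : Alg6 q)) ∈ N') : N = ⊥ := by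
  have hNT : N ≤ T5 q := hsup ▸ le_sup_left
  have hboth : ∀ x, x ∈ N → x ∈ N' → x = 0 := fun x h1 h2 => by
    have : x ∈ N ⊓ N' := ⟨h1, h2⟩
    rwa [hinf] at this
  have h46 := mem_of_eq_smul q (y := (xx q v4 v6, (0 : Alg6 q))) h (arr q v5 v4)
    (by simp [arr_mul_xx, adj6, Vtx.leB])
  have h36 := mem_of_eq_smul q (y := (xx q v3 v6, (0 : Alg6 q))) h (arr q v5 v3)
    (by simp [arr_mul_xx, adj6, Vtx.leB])
  have h26 := mem_of_eq_smul q (y := (xx q v2 v6, (0 : Alg6 q))) h36 (arr q v3 v2)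
    (by simp [arr_mul_xx, adj6, Vtx.leB])
  have h16 := mem_of_eq_smul q (y := (xx q v1 v6, (0 : Alg6 q))) h26 (arr q v2 v1)
    (by simp [arr_mul_xx, adj6, Vtx.leB])
  have key : ∀ n ∈ N, ∃ a d : K, idem6 q v1 • n = (a • xx q v1 v6, d • xx q v1 v6) := by
    intro n hn
    obtain ⟨a, ha⟩ := exists_idem1_smul q hc (hNT hn)
    set m := idem6 q v1 • n with hm
    have hmN : m ∈ N := N.smul_mem _ hn
    -- An ascending path takes m to a multiple of a vector of N'. The result also lies in N, so the
    -- multiple is 0; the following coefficients are treated in the same way.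
    have f1 : a 4 = 0 := by
      have e1 : arr q v3 v5 • arr q v2 v3 • arr q v1 v2 • m =
          a 4 • (xx q v5 v6, (0 : Alg6 q)) := by
        rw [ha]
        simp [arr_mul_xx, adj6, Vtx.leB, tbl, tblCoeff, mul_add, mul_sub]
      have e2 := hboth _ (N.smul_mem (arr q v3 v5) (N.smul_mem (arr q v2 v3)
        (N.smul_mem (arr q v1 v2) hmN))) (by rw [e1]; exact scalar_smul_mem q h _)
      rw [e1] at e2
      have := congrArg (cf₁ q v5 v6) e2
      simpa [cf₁_mk, cf_xx, Vtx.leB] using this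
    have f2 : a 3 + a 5 * q = 0 := by
      have e1 : arr q v1 v4 • m = (a 3 + a 5 * q) • (xx q v4 v6, (0 : Alg6 q)) := by
        rw [ha, f1]
        simp [arr_mul_xx, adj6, Vtx.leB, tbl, tblCoeff, mul_add, mul_sub, add_smul, smul_smul]
      have e2 := hboth _ (N.smul_mem (arr q v1 v4) hmN) (by rw [e1]; exact scalar_smul_mem q h46 _)
      rw [e1] at e2
      have := congrArg (cf₁ q v4 v6) e2
      simpa [cf₁_mk, cf_xx, Vtx.leB] using this
    have f3 : a 3 + a 5 = 0 := by
      have e1 : arr q v2 v3 • arr q v1 v2 • m = (a 3 + a 5) • (xx q v3 v6, (0 : Alg6 q)) := by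
        rw [ha, f1]
        simp [arr_mul_xx, adj6, Vtx.leB, tbl, tblCoeff, mul_add, mul_sub, add_smul]
      have e2 := hboth _ (N.smul_mem (arr q v2 v3) (N.smul_mem (arr q v1 v2) hmN))
        (by rw [e1]; exact scalar_smul_mem q h36 _)
      rw [e1] at e2
      have := congrArg (cf₁ q v3 v6) e2
      simpa [cf₁_mk, cf_xx, Vtx.leB] using this
    -- Subtracting `f3` from `f2` gives (q - 1) a 5 = 0.
    have f5 : a 5 = 0 := by linear_combination c * f2 - c * f3 - a 5 * hc
    have f3' : a 3 = 0 := by linear_combination f3 - f5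
    have f6 : a 1 + a 2 = 0 := by
      have e1 : arr q v1 v2 • m = (a 1 + a 2) • (xx q v2 v6, (0 : Alg6 q)) := by
        rw [ha, f1, f5, f3']
        simp [arr_mul_xx, adj6, Vtx.leB, tbl, tblCoeff, mul_add, mul_sub, add_smul]
      have e2 := hboth _ (N.smul_mem (arr q v1 v2) hmN)
        (by rw [e1]; exact scalar_smul_mem q h26 _)
      rw [e1] at e2
      have := congrArg (cf₁ q v2 v6) e2
      simpa [cf₁_mk, cf_xx, Vtx.leB] using this
    refine ⟨a 0, a 1 * (q - 1), ?_⟩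
    rw [ha, f1, f5, f3', add_assoc (a 0 • xx q v1 v6), ← add_smul, f6]
    simp
  -- Splitting x along N and N' changes e_1 x only by socle vectors.
  have decomp : ∀ x ∈ T5 q, ∃ a d : K, idem6 q v1 • x - (a • xx q v1 v6, d • xx q v1 v6) ∈ N' ∧
      (a • xx q v1 v6, d • xx q v1 v6) ∈ N := by
    intro x hx
    rw [← hsup] at hx
    obtain ⟨n, hn, n', hn', rfl⟩ := Submodule.mem_sup.1 hx
    obtain ⟨a, d, had⟩ := key n hn
    refine ⟨a, d, ?_, had ▸ N.smul_mem _ hn⟩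
    rw [smul_add, had, add_sub_cancel_left]
    exact N'.smul_mem _ hn'
  obtain ⟨g1, g2, -⟩ := mem_T5 q hc
  have hz : ((0 : Alg6 q), xx q v1 v6) ∈ N' := by
    obtain ⟨a, d, h1, -⟩ := decomp _ g1
    -- Arrows out of 1 kill the unknown socle vectors, so the images of the generator lie in N'
    -- exactly.
    have h2 := mem_of_eq_smul q (y := (xx q v4 v5, (q - 1) • xx q v4 v6)) h1 (arr q v1 v4)
      (by simp [arr_mul_xx, adj6, Vtx.leB, tbl, tblCoeff, mul_sub, idem_mul_xx, sub_smul])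
    have h3 := mem_of_eq_smul q (y := (xx q v2 v3, (0 : Alg6 q))) h1 (arr q v1 v2)
      (by simp [arr_mul_xx, adj6, Vtx.leB, tbl, tblCoeff, mul_sub, idem_mul_xx, sub_smul])
    have h4 := mem_of_eq_smul q (y := (xx q v3 v5, (0 : Alg6 q))) h3 (arr q v2 v3)
      (by simp [arr_mul_xx, adj6, Vtx.leB, tbl, tblCoeff])
    have h5 := mem_of_eq_smul q (y := (xx q v2 v5, (0 : Alg6 q))) h4 (arr q v3 v2)
      (by simp [arr_mul_xx, adj6, Vtx.leB, tbl, tblCoeff])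
    have h6 := mem_of_eq_smul q (y := (xx q v1 v5, (0 : Alg6 q))) h5 (arr q v2 v1)
      (by simp [arr_mul_xx, adj6, Vtx.leB, tbl, tblCoeff])
    have h7 := mem_of_eq_smul q (y := (xx q v1 v5, (q - 1) • xx q v1 v6)) h2 (arr q v4 v1)
      (by simp [arr_mul_xx, adj6, Vtx.leB, tbl, tblCoeff])
    have h8 := scalar_smul_mem q (Submodule.sub_mem _ h7 h6) c
    rwa [Prod.mk_sub_mk, sub_self, sub_zero, Prod.smul_mk, smul_zero, smul_smul, hc,
      one_smul] at h8
  have hT : T5 q ≤ N' := by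
    have hx : ∀ x ∈ T5 q, idem6 q v1 • x = x → x ∈ N' := by
      intro x hx h1
      obtain ⟨a, d, h2, -⟩ := decomp x hx
      have h3 := Submodule.add_mem _ h2 (Submodule.add_mem _ (scalar_smul_mem q h16 a)
        (scalar_smul_mem q hz d))
      simpa [h1] using h3
    rw [T5_eq, Submodule.span_le]
    rintro _ (rfl | rfl)
    · exact hx _ g1 (by simp [idem_mul_xx, mul_sub])
    · exact hx _ g2 (by simp [idem_mul_xx])
  rw [eq_bot_iff, ← hinf]
  exact le_inf le_rfl (hNT.trans hT)

theorem isIndecomposable_T5 {c : K} (hc : c * (q - 1) = 1) : IsIndecomposable (Alg6 q) (T5 q) := by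
  have h56 := (mem_v5 q hc _ (mem_T5 q hc).1).2.2.2.2.2.2.2.1
  have hne : (xx q v5 v6, (0 : Alg6 q)) ≠ 0 := fun h =>
    xx_ne_zero q (by rfl) (congrArg Prod.fst h)
  refine isIndecomposable_of_forall_le _ (fun h => hne (by rwa [h] at h56)) fun N N' h1 h2 => ?_
  have hx := h56
  rw [← h2] at hx
  obtain ⟨n, hn, n', hn', hnn⟩ := Submodule.mem_sup.1 hx
  -- As e_5 T(5) is a line, its generator lies in N if a ≠ 0 and in N' if a = 0.
  obtain ⟨a, ha⟩ := exists_idem5_smul q hc (n := n) (h2 ▸ Submodule.mem_sup_left hn)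
  have ha' := ha ▸ N.smul_mem (idem6 q v5) hn
  by_cases ha0 : a = 0
  · left
    refine eq_bot_of_idem5_mem q hc h1 h2 ?_
    have h3 := congrArg (idem6 q v5 • ·) hnn
    simp only [smul_add, ha, ha0, zero_smul, zero_add] at h3
    rw [show idem6 q v5 • (xx q v5 v6, (0 : Alg6 q)) = (xx q v5 v6, (0 : Alg6 q)) by
      simp [idem_mul_xx]] at h3
    rw [← h3]
    exact N'.smul_mem _ hn'
  · right
    refine eq_bot_of_idem5_mem q hc (by rwa [inf_comm]) (by rwa [sup_comm]) ?_
    have := scalar_smul_mem q ha' a⁻¹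
    rwa [smul_smul, inv_mul_cancel₀ ha0, one_smul] at this

theorem isTilting_T5 (hq : q ≠ 1) : IsTilting K (idem6 q) v5 (T5 q) := by
  have hc : (q - 1)⁻¹ * (q - 1) = 1 := inv_mul_cancel₀ (sub_ne_zero.2 hq)
  exact isTilting_of_gradedFamily q (isIndecomposable_T5 q hc) (deltaFamily_v5 q hc)
    (nablaFamily_v5 q hc) (by decide) (by decide) (by decide) (by decide)

end TiltingModules
end OneQH

namespace OneQH
open Vtx

/-! ### Consequences of filtrations: injectivity of descents, surjectivity of ascents -/

section FiltrationInduction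

variable {A : Type*} [Ring A] {ι : Type*} {Θ : ι → Type*} [∀ i, AddCommGroup (Θ i)]
  [∀ i, Module A (Θ i)] {M : Type*} [AddCommGroup M] [Module A M] {d : ι → ℕ}

/-- Dévissage for kernels: the subquotient puts b x into N, and a(b x) = a x = 0, so the induction
hypothesis applies to b x. The next lemma is the counterpart for images. -/
theorem HasFiltration.smul_eq_zero_of (hM : HasFiltration (A := A) Θ M d) {a b : A} (hab : a * b = a)
    (hb : b * b = b) (h : ∀ k, ∀ x : Θ k, a • x = 0 → b • x = 0) {x : M} (hx : a • x = 0) :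
    b • x = 0 := by
  refine hM.induction (fun N => ∀ x ∈ N, a • x = 0 → b • x = 0) ?_ ?_ x trivial hx
  · rintro x hx -
    rw [(Submodule.mem_bot A).1 hx, smul_zero]
  · intro N N' k φ _ _ _ hφ ih x hx hax
    have h1 : b • x ∈ N := (hφ ⟨b • x, N'.smul_mem b hx⟩).1 (by
      have h2 : a • (⟨x, hx⟩ : N') = 0 := Subtype.ext hax
      have h3 := h k (φ ⟨x, hx⟩) (by rw [← map_smul, h2, map_zero])
      rw [← map_smul] at h3
      exact h3)
    have h2 := ih _ h1 (by rw [← mul_smul, hab, hax])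
    rwa [← mul_smul, hb] at h2

theorem HasFiltration.exists_smul_eq (hM : HasFiltration (A := A) Θ M d) {a b : A} (hba : b * a = a)
    (hb : b * b = b) (h : ∀ k, ∀ y : Θ k, ∃ x : Θ k, a • x = b • y) (y : M) :
    ∃ x : M, a • x = b • y := by
  have key : ∀ y ∈ (⊤ : Submodule A M), ∃ x ∈ (⊤ : Submodule A M), a • x = b • y := by
    refine hM.induction (fun N => ∀ y ∈ N, ∃ x ∈ N, a • x = b • y) ?_ ?_
    · intro y hy
      exact ⟨y, hy, by rw [(Submodule.mem_bot A).1 hy, smul_zero, smul_zero]⟩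
    · intro N N' k φ _ hle hs hφ ih y hy
      obtain ⟨v, hv⟩ := h k (φ ⟨y, hy⟩)
      obtain ⟨x, rfl⟩ := hs v
      have h1 : b • y - a • (x : M) ∈ N := by
        refine (hφ (b • ⟨y, hy⟩ - a • x)).1 ?_
        rw [map_sub, map_smul, map_smul, hv, sub_self]
      obtain ⟨x', hx', hx'y⟩ := ih _ h1
      refine ⟨x' + x, N'.add_mem (hle hx') x.2, ?_⟩
      rw [smul_add, hx'y, smul_sub, ← mul_smul, ← mul_smul, hba, hb, sub_add_cancel]
  obtain ⟨x, -, hx⟩ := key y trivial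
  exact ⟨x, hx⟩

theorem HasFiltration.smul_eq_zero (hM : HasFiltration (A := A) Θ M d) {b : A} (hb : b * b = b)
    (h : ∀ k, d k ≠ 0 → ∀ x : Θ k, b • x = 0) (x : M) : b • x = 0 := by
  refine hM.induction (fun N => ∀ x ∈ N, b • x = 0) ?_ ?_ x trivial
  · intro x hx
    rw [(Submodule.mem_bot A).1 hx, smul_zero]
  · intro N N' k φ hk _ _ hφ ih x hx
    have h1 : b • x ∈ N := (hφ (b • ⟨x, hx⟩)).1 (by rw [map_smul, h k hk])
    have h2 := ih _ h1
    rwa [← mul_smul, hb] at h2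

end FiltrationInduction

section StandardModules

variable {K : Type*} [Field K] {A : Type*} [Ring A] [Algebra K A] {ι : Type*} [Fintype ι]
  [PartialOrder ι] {e : ι → A} (D : TriangularBasis K e)

theorem exists_of_mult_ne_zero {K A ι M : Type*} [Field K] [Ring A] [Algebra K A] {e : ι → A}
    [AddCommGroup M] [Module A M] [Module K M] [IsScalarTower K A M] {j : ι}
    (h : mult K e M j ≠ 0) : ∃ y : M, e j • y ≠ 0 := by
  by_contra! h1
  apply h
  have : LinearMap.range (Algebra.lsmul K K M (e j) : M →ₗ[K] M) = ⊥ := by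
    rw [LinearMap.range_eq_bot]
    exact LinearMap.ext h1
  rw [mult, this, finrank_bot]

theorem basis_repr_smul_eq_sum {M κ : Type*} [AddCommGroup M] [Module K M] [Module A M]
    [IsScalarTower K A M] [Fintype κ] (θ : Module.Basis κ K M) (a : A) (x : M) (y : κ) :
    θ.repr (a • x) y = ∑ z, θ.repr x z * θ.repr (a • θ z) y := by
  conv_lhs => rw [← θ.sum_repr x]
  rw [Finset.smul_sum, map_sum, Finsupp.finsetSum_apply]
  refine Finset.sum_congr rfl fun z _ => ?_
  rw [smul_algebra_smul_comm, map_smul, Finsupp.smul_apply, smul_eq_mul]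

namespace TriangularBasis

open Classical in
theorem deltaBasis_repr_smul' {m' l' m : ι} (hm' : m' ≤ l') (hm : m ≤ l') (k : ι) (x : Delta e k)
    (y : {m : ι // m ≤ k}) : (D.deltaBasis k).repr (D.p m' l' m • x) y =
      if h : m ≤ k ∧ l' = m ∧ y.1 = m' then (D.deltaBasis k).repr x ⟨m, h.1⟩ else 0 := by
  rw [basis_repr_smul_eq_sum]
  simp only [D.deltaBasis_repr_smul hm' hm]
  split_ifs with h
  · rw [Finset.sum_eq_single ⟨m, h.1⟩]
    · simp [h.2.1, h.2.2]
    · intro z _ hz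
      rw [if_neg, mul_zero]
      exact fun h1 => hz (Subtype.ext h1.1)
    · simp
  · refine Finset.sum_eq_zero fun z _ => ?_
    rw [if_neg, mul_zero]
    exact fun h1 => h ⟨h1.1 ▸ z.2, h1.2⟩

open Classical in
theorem nablaBasis_repr_smul' {m' l' m : ι} (hm' : m' ≤ l') (hm : m ≤ l') (k : ι) (x : Nabla K e k)
    (y : {m : ι // m ≤ k}) : (D.nablaBasis k).repr (D.p m' l' m • x) y =
      if h : m ≤ k ∧ l' = m' ∧ y.1 = m' then (D.nablaBasis k).repr x ⟨m, h.1⟩ else 0 := by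
  rw [basis_repr_smul_eq_sum]
  simp only [D.nablaBasis_repr_smul hm' hm]
  split_ifs with h
  · rw [Finset.sum_eq_single ⟨m, h.1⟩]
    · simp [h.2.1, h.2.2]
    · intro z _ hz
      rw [if_neg, mul_zero]
      exact fun h1 => hz (Subtype.ext h1.1)
    · simp
  · refine Finset.sum_eq_zero fun z _ => ?_
    rw [if_neg, mul_zero]
    exact fun h1 => h ⟨h1.1 ▸ z.2, h1.2⟩

theorem delta_ext {k : ι} {x y : Delta e k}
    (h : ∀ m, (D.deltaBasis k).repr x m = (D.deltaBasis k).repr y m) : x = y :=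
  (D.deltaBasis k).repr.injective (Finsupp.ext h)

/-- On the basis of Δ(k) the descending path from j to i maps the vector at j to the vector at i. -/
theorem delta_e_smul_eq_zero {i j k : ι} (hij : i ≤ j) {x : Delta e k}
    (hx : D.p i j j • x = 0) : e j • x = 0 := by
  refine D.delta_ext fun m => ?_
  rw [← D.p_self, D.deltaBasis_repr_smul' le_rfl le_rfl, map_zero, Finsupp.zero_apply]
  split_ifs with h
  · have h1 := D.deltaBasis_repr_smul' hij le_rfl k x ⟨i, hij.trans h.1⟩
    rw [hx, map_zero, Finsupp.zero_apply, dif_pos ⟨h.1, rfl, rfl⟩] at h1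
    exact h1.symm
  · rfl

include D in
theorem delta_e_smul_of_not_le {j k : ι} (hjk : ¬ j ≤ k) (x : Delta e k) : e j • x = 0 := by
  refine D.delta_ext fun m => ?_
  rw [← D.p_self, D.deltaBasis_repr_smul' le_rfl le_rfl, map_zero, Finsupp.zero_apply,
    dif_neg fun h => hjk h.1]

theorem nabla_exists_smul_eq {i j k : ι} (hij : i ≤ j) (y : Nabla K e k) :
    ∃ x : Nabla K e k, D.p j j i • x = e j • y := by
  have ext : ∀ {x y : Nabla K e k},
      (∀ m, (D.nablaBasis k).repr x m = (D.nablaBasis k).repr y m) → x = y := fun h =>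
    (D.nablaBasis k).repr.injective (Finsupp.ext h)
  by_cases hjk : j ≤ k
  · refine ⟨(D.nablaBasis k).repr y ⟨j, hjk⟩ • D.nablaBasis k ⟨i, hij.trans hjk⟩, ext fun m => ?_⟩
    rw [← D.p_self, D.nablaBasis_repr_smul' le_rfl hij, D.nablaBasis_repr_smul' le_rfl le_rfl]
    by_cases hm : m.1 = j
    · rw [dif_pos ⟨hij.trans hjk, rfl, hm⟩, dif_pos ⟨hjk, rfl, hm⟩, map_smul]
      simp
    · rw [dif_neg fun h => hm h.2.2, dif_neg fun h => hm h.2.2]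
  · refine ⟨0, ext fun m => ?_⟩
    rw [← D.p_self, D.nablaBasis_repr_smul' le_rfl le_rfl, smul_zero, map_zero, Finsupp.zero_apply,
      dif_neg fun h => hjk h.1]

variable {M : Type*} [AddCommGroup M] [Module A M] {d : ι → ℕ}

/-- Descending paths act injectively on modules with a standard filtration; the next lemma says that
ascending paths act surjectively in the costandard case. -/
theorem e_smul_eq_zero_of_hasFiltration (hM : HasFiltration (A := A) (Delta e) M d) {i j : ι}
    (hij : i ≤ j) {x : M} (hx : D.p i j j • x = 0) : e j • x = 0 :=
  hM.smul_eq_zero_of (D.p_mul_e hij le_rfl) (D.e_mul_self j)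
    (fun _ _ => D.delta_e_smul_eq_zero hij) hx

theorem exists_smul_eq_of_hasFiltration
    (hM : HasFiltration (A := A) (fun j => Nabla K e j) M d) {i j : ι} (hij : i ≤ j) (y : M) :
    ∃ x : M, D.p j j i • x = e j • y :=
  hM.exists_smul_eq (D.e_mul_p le_rfl hij) (D.e_mul_self j)
    (fun _ => D.nabla_exists_smul_eq hij) y

include D in
theorem e_smul_eq_zero_of_not_le (hM : HasFiltration (A := A) (Delta e) M d) {j : ι}
    (hd : ∀ k, j ≤ k → d k = 0) (x : M) : e j • x = 0 :=
  hM.smul_eq_zero (D.e_mul_self j)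
    (fun k hk => D.delta_e_smul_of_not_le fun h => hk (hd k h)) x

/-- A module with standard and costandard filtrations in which `j` occurs has an element at each
`i ≤ j` that is not killed by the path from `i` to `j` and back. -/
theorem exists_p_smul_ne_zero [Module K M] [IsScalarTower K A M] {d' : ι → ℕ}
    (hM : HasFiltration (A := A) (Delta e) M d)
    (hM' : HasFiltration (A := A) (fun j => Nabla K e j) M d') {i j : ι} (hij : i ≤ j)
    (h : mult K e M j ≠ 0) : ∃ m : M, e i • m = m ∧ D.p i j i • m ≠ 0 := by
  obtain ⟨y, hy⟩ := exists_of_mult_ne_zero h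
  -- Lift y along the ascent from i to j; the descent back to i then cannot kill it.
  obtain ⟨x, hx⟩ := D.exists_smul_eq_of_hasFiltration hM' hij y
  refine ⟨e i • x, by rw [← mul_smul, D.e_mul_self], fun h0 => hy ?_⟩
  rw [← mul_smul, D.p_mul_e hij hij, ← D.p_mul_p_self hij hij, mul_smul, hx] at h0
  have := D.e_smul_eq_zero_of_hasFiltration hM hij h0
  rwa [← mul_smul, D.e_mul_self] at this

end TriangularBasis
end StandardModules
end OneQH

namespace OneQH
open Vtx

/-! ### Elements of arbitrary tilting modules T(6) and T(5) -/

section TiltingElements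

variable {K : Type u} [Field K] (q : K) {M : Type*} [AddCommGroup M] [Module (Alg6 q) M]

/-- The relation between `(21)` and `(41)` on modules with a standard filtration. -/
theorem exists_of_arr_add_eq_zero {d : Vtx → ℕ}
    (hM : HasFiltration (A := Alg6 q) (Delta (idem6 q)) M d) {u v : M} (hu : idem6 q v2 • u = u)
    (hv : idem6 q v4 • v = v) (huv : pp q v1 v2 v2 • u + pp q v1 v4 v4 • v = 0) :
    ∃ w : M, pp q v2 v5 v5 • w = u := by
  let D := basis6 q
  have key : ∀ u ∈ (⊤ : Submodule (Alg6 q) M), ∀ v ∈ (⊤ : Submodule (Alg6 q) M),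
      idem6 q v2 • u = u → idem6 q v4 • v = v →
      pp q v1 v2 v2 • u + pp q v1 v4 v4 • v = 0 → ∃ w ∈ (⊤ : Submodule (Alg6 q) M),
        pp q v2 v5 v5 • w = u := by
    refine hM.induction (fun N => ∀ u ∈ N, ∀ v ∈ N, idem6 q v2 • u = u → idem6 q v4 • v = v →
      pp q v1 v2 v2 • u + pp q v1 v4 v4 • v = 0 → ∃ w ∈ N, pp q v2 v5 v5 • w = u) ?_ ?_
    · intro u hu _ _ _ _ _
      exact ⟨u, hu, by rw [(Submodule.mem_bot _).1 hu, smul_zero]⟩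
    · intro N N' k φ _ hle hs hφ ih u hu v hv hu2 hv4 huv
      have hu' : idem6 q v2 • φ ⟨u, hu⟩ = φ ⟨u, hu⟩ := by
        rw [← map_smul]; exact congrArg φ (Subtype.ext hu2)
      have hv' : idem6 q v4 • φ ⟨v, hv⟩ = φ ⟨v, hv⟩ := by
        rw [← map_smul]; exact congrArg φ (Subtype.ext hv4)
      have huv' : pp q v1 v2 v2 • φ ⟨u, hu⟩ + pp q v1 v4 v4 • φ ⟨v, hv⟩ = 0 := by
        rw [← map_smul, ← map_smul, ← map_add, ← map_zero φ]
        exact congrArg φ (Subtype.ext huv)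
      -- In Δ(k) either 5 ≤ k, and the two vectors are opposite multiples of descents from the
      -- vector at 5, or 2 and 4 are not both below k, and both vectors vanish. The second equation
      -- keeps the relation between u and v intact modulo N, by (5321) = (541).
      suffices hw : ∃ w : Delta (idem6 q) k, pp q v2 v5 v5 • w = φ ⟨u, hu⟩ ∧
          pp q v4 v5 v5 • w = - φ ⟨v, hv⟩ by
        obtain ⟨w, hw1, hw2⟩ := hw
        obtain ⟨w, rfl⟩ := hs w
        have h1 : u - pp q v2 v5 v5 • (w : M) ∈ N := by
          refine (hφ (⟨u, hu⟩ - pp q v2 v5 v5 • w)).1 ?_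
          rw [map_sub, map_smul, hw1, sub_self]
        have h2 : v + pp q v4 v5 v5 • (w : M) ∈ N := by
          refine (hφ (⟨v, hv⟩ + pp q v4 v5 v5 • w)).1 ?_
          rw [map_add, map_smul, hw2, add_neg_cancel]
        obtain ⟨w', hw', hw'u⟩ := ih _ h1 _ h2
          (by rw [smul_sub, hu2, ← mul_smul, idem_mul_pp q (by decide) (by decide)])
          (by rw [smul_add, hv4, ← mul_smul, idem_mul_pp q (by decide) (by decide)])
          (by
            rw [smul_sub, smul_add, ← mul_smul, ← mul_smul, pp_mul_of_some q (r := v5) (by decide)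
              (by decide) (by decide) (by decide) rfl, pp_mul_of_some q (r := v5) (by decide)
              (by decide) (by decide) (by decide) rfl, tblCoeff, tblCoeff, if_neg (by decide),
              if_neg (by decide), sub_add_add_cancel, huv])
        refine ⟨w' + w, N'.add_mem (hle hw') w.2, ?_⟩
        rw [smul_add, hw'u, sub_add_cancel]
      set x := φ ⟨u, hu⟩
      set y := φ ⟨v, hv⟩
      have hx : ∀ m, (D.deltaBasis k).repr x m =
          if h : v2 ≤ k ∧ m.1 = v2 then (D.deltaBasis k).repr x ⟨v2, h.1⟩ else 0 := fun m => by
        conv_lhs => rw [← hu', ← D.p_self, D.deltaBasis_repr_smul' le_rfl le_rfl]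
        by_cases h : v2 ≤ k ∧ m.1 = v2 <;> simp [h]
      have hy : ∀ m, (D.deltaBasis k).repr y m =
          if h : v4 ≤ k ∧ m.1 = v4 then (D.deltaBasis k).repr y ⟨v4, h.1⟩ else 0 := fun m => by
        conv_lhs => rw [← hv', ← D.p_self, D.deltaBasis_repr_smul' le_rfl le_rfl]
        by_cases h : v4 ≤ k ∧ m.1 = v4 <;> simp [h]
      have hxy := congrArg (fun z => (D.deltaBasis k).repr z ⟨v1, v1_le k⟩) huv'
      have e1 := D.deltaBasis_repr_smul' (m' := v1) (l' := v2) (m := v2) (by decide) le_rfl k x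
        ⟨v1, v1_le k⟩
      have e2 := D.deltaBasis_repr_smul' (m' := v1) (l' := v4) (m := v4) (by decide) le_rfl k y
        ⟨v1, v1_le k⟩
      simp only [map_add, Finsupp.add_apply, map_zero, Finsupp.zero_apply] at hxy
      change (D.deltaBasis k).repr (D.p v1 v2 v2 • x) _ + (D.deltaBasis k).repr (D.p v1 v4 v4 • y) _
        = 0 at hxy
      rw [e1, e2] at hxy
      simp only [and_true] at hxy
      by_cases h5 : v5 ≤ k
      · have h2 : v2 ≤ k := le_trans (by decide) h5
        have h4 : v4 ≤ k := le_trans (by decide) h5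
        rw [dif_pos h2, dif_pos h4] at hxy
        refine ⟨(D.deltaBasis k).repr x ⟨v2, h2⟩ • D.deltaBasis k ⟨v5, h5⟩, D.delta_ext fun m => ?_,
          D.delta_ext fun m => ?_⟩
        · refine (D.deltaBasis_repr_smul' (m' := v2) (l' := v5) (m := v5) (by decide) le_rfl k _
            m).trans ?_
          rw [hx m]
          by_cases hm : m.1 = v2 <;> simp [hm, h5, h2]
        · refine (D.deltaBasis_repr_smul' (m' := v4) (l' := v5) (m := v5) (by decide) le_rfl k _
            m).trans ?_
          rw [map_neg, Finsupp.neg_apply, hy m]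
          by_cases hm : m.1 = v4
          · simp [hm, h5, h4, eq_neg_of_add_eq_zero_left hxy]
          · simp [hm]
      · have h24 : ∀ k, ¬ v5 ≤ k → ¬ (v2 ≤ k ∧ v4 ≤ k) := by decide
        have h24 := h24 k h5
        refine ⟨0, D.delta_ext fun m => ?_, D.delta_ext fun m => ?_⟩
        · rw [smul_zero, map_zero, Finsupp.zero_apply, hx m]
          split_ifs with h
          · rw [dif_pos h.1, dif_neg fun h4 => h24 ⟨h.1, h4⟩, add_zero] at hxy
            exact hxy.symm
          · rfl
        · rw [smul_zero, map_zero, Finsupp.zero_apply, map_neg, Finsupp.neg_apply, hy m]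
          split_ifs with h
          · rw [dif_pos h.1, dif_neg fun h2 => h24 ⟨h2, h.1⟩, zero_add] at hxy
            rw [hxy, neg_zero]
          · rw [neg_zero]
  obtain ⟨w, -, hw⟩ := key u trivial v trivial hu hv huv
  exact ⟨w, hw⟩

variable [Module K M] [IsScalarTower K (Alg6 q) M]

theorem idem_smul_eq_zero {i j : Vtx} (hM : IsTilting K (idem6 q) i M) (hj : ¬ j ≤ i) (x : M) :
    idem6 q j • x = 0 := by
  obtain ⟨-, ⟨d, hd, -, hd0⟩, -⟩ := hM
  exact (basis6 q).e_smul_eq_zero_of_not_le hd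
    (fun k hk => hd0 k fun h => hj (hk.trans h)) x

/-- `T(6)` is free of rank one over `P(1)`. -/
theorem exists_generator_v6 (hq : q ≠ 1) (hM : IsTilting K (idem6 q) v6 M) :
    ∃ m : M, idem6 q v1 • m = m ∧ (∀ a ∈ P (idem6 q) v1, a • m = 0 → a = 0) ∧
      ∀ x : M, ∃ a ∈ P (idem6 q) v1, a • m = x := by
  obtain ⟨⟨hnt, hind⟩, ⟨d, hd, -, -⟩, ⟨d', hd', -, -⟩, hmult, -⟩ := hM
  obtain ⟨m, hm, hpm⟩ := (basis6 q).exists_p_smul_ne_zero hd hd' (v1_le v6)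
    (by rw [hmult]; exact one_ne_zero)
  have F := isFrobenius6 q hq
  have hfin : Module.Finite K (Alg6 q) := (basis6 q).isBasicAlgebra.1
  let lam : P (idem6 q) v1 →ₗ[Alg6 q] M :=
    LinearMap.toSpanSingleton (Alg6 q) M m ∘ₗ (P (idem6 q) v1).subtype
  have hlam : ∀ a, lam a = a.1 • m := fun a => rfl
  -- A functional that is nonzero on the socle vector of the submodule generated by m induces Φ from
  -- M to I(1).
  obtain ⟨ψ, hψ⟩ := Module.Projective.exists_dual_ne_zero K hpm
  let f : M → DualReg K (Alg6 q) := fun x =>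
    (ψ ∘ₗ (LinearMap.toSpanSingleton (Alg6 q) M x).restrictScalars K ∘ₗ
      LinearMap.mulLeft K (idem6 q v1) : Alg6 q →ₗ[K] K)
  have hf : ∀ x a, (f x).ev a = ψ ((idem6 q v1 * a) • x) := fun x a => rfl
  let Φ : M →ₗ[Alg6 q] I K (idem6 q) v1 :=
    { toFun := fun x => ⟨f x, fun a => by rw [hf, hf, ← mul_assoc, idem6_mul_self]⟩
      map_add' := fun x y => Subtype.ext (DualReg.ext K _ fun a => by
        change (f (x + y)).ev a = (f x + f y).ev a
        rw [DualReg.ev_add, hf, hf, hf, smul_add, map_add])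
      map_smul' := fun b x => Subtype.ext (DualReg.ext K _ fun a => by
        change (f (b • x)).ev a = (b • f x).ev a
        rw [DualReg.ev_smul, hf, hf, ← mul_smul, mul_assoc]) }
  -- A nonzero kernel would contain the socle of P(1), on which the evaluation at 1 gives ψ at that
  -- socle vector.
  have hinj : Function.Injective (Φ ∘ₗ lam) := by
    rw [← LinearMap.ker_eq_bot]
    by_contra hne
    have h1 : (LinearMap.ker (Φ ∘ₗ lam)).map (P (idem6 q) v1).subtype ≠ ⊥ := fun h =>
      hne (Submodule.map_injective_of_injective (P (idem6 q) v1).injective_subtype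
        (h.trans (Submodule.map_bot _).symm))
    obtain ⟨x, hx, hxp⟩ := F.socle_mem (Submodule.map_subtype_le _ _) h1
    have h2 : Φ (lam x) = 0 := hx
    have h3 : (f (lam x)).ev 1 = 0 := congrArg (fun g => g.1.ev 1) h2
    rw [hf, hlam, mul_one] at h3
    change x.1 = pp q v1 v6 v1 at hxp
    rw [hxp, ← mul_smul, idem_mul_pp q (v1_le _) (v1_le _)] at h3
    exact hψ h3
  have hfinP : Module.Finite K (P (idem6 q) v1) :=
    Module.Finite.of_injective ((P (idem6 q) v1).subtype.restrictScalars K)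
      (P (idem6 q) v1).injective_subtype
  let tI := (TriangularBasis.IsFrobenius.toI (basis6 q) v1 v6 v1).restrictScalars K
  have htI : Function.Surjective tI := F.toI_surjective v1
  have hfinI : Module.Finite K (I K (idem6 q) v1) := Module.Finite.of_surjective tI htI
  -- I(1) is a quotient of P(1), so its dimension is not larger and injectivity suffices.
  have hsurj : Function.Surjective (Φ ∘ₗ lam) := by
    have h1 := LinearMap.finrank_le_finrank_of_injective (f := (Φ ∘ₗ lam).restrictScalars K) hinj
    have h2 := LinearMap.finrank_le_finrank_of_surjective (f := tI) htI
    exact (LinearMap.injective_iff_surjective_of_finrank_eq_finrank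
      (f := (Φ ∘ₗ lam).restrictScalars K) (le_antisymm h1 h2)).1 hinj
  -- Φ splits off the image of P(1) as a direct summand, and M is indecomposable.
  have hc : IsCompl (LinearMap.range lam) (LinearMap.ker Φ) := by
    constructor
    · rw [Submodule.disjoint_def]
      rintro _ ⟨a, rfl⟩ ha
      have : a = 0 := hinj ((show Φ (lam a) = 0 from ha).trans (map_zero (Φ ∘ₗ lam)).symm)
      rw [this, map_zero]
    · rw [codisjoint_iff, eq_top_iff]
      intro x _
      obtain ⟨a, ha⟩ := hsurj (Φ x)
      refine Submodule.mem_sup.2 ⟨lam a, ⟨a, rfl⟩, x - lam a, ?_, by abel⟩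
      rw [LinearMap.mem_ker, map_sub, sub_eq_zero]
      exact ha.symm
  have hlne : LinearMap.range lam ≠ ⊥ := fun h => by
    have h1 : lam ⟨idem6 q v1, e_mem_P _ _⟩ = 0 := by
      have : lam ⟨idem6 q v1, e_mem_P _ _⟩ ∈ LinearMap.range lam := ⟨_, rfl⟩
      rwa [h] at this
    rw [hlam, hm] at h1
    rw [h1, smul_zero] at hpm
    exact hpm rfl
  have hker := (hind _ _ hc).resolve_left hlne
  rw [hker] at hc
  have hrange := eq_top_of_isCompl_bot hc
  refine ⟨m, hm, fun a ha h => ?_, fun x => ?_⟩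
  · have h1 : (Φ ∘ₗ lam) ⟨a, ha⟩ = 0 := by
      rw [LinearMap.comp_apply, hlam, h, map_zero]
    exact congrArg Subtype.val (hinj (h1.trans (map_zero (Φ ∘ₗ lam)).symm))
  · have : x ∈ LinearMap.range lam := by rw [hrange]; trivial
    obtain ⟨a, rfl⟩ := this
    exact ⟨a.1, a.2, rfl⟩

/-- Two elements of `T(5)` that are killed by the arrows. -/
theorem exists_socle_v5 (hM : IsTilting K (idem6 q) v5 M) :
    ∃ σ τ : M, LinearIndependent K ![σ, τ] ∧
      (idem6 q v1 • σ = σ ∧ arr q v1 v2 • σ = 0 ∧ arr q v1 v4 • σ = 0) ∧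
      idem6 q v1 • τ = τ ∧ arr q v1 v2 • τ = 0 ∧ arr q v1 v4 • τ = 0 := by
  have h6 := idem_smul_eq_zero q hM (j := v6) (by decide)
  obtain ⟨-, ⟨d, hd, -, -⟩, ⟨d', hd', -, -⟩, hmult, -⟩ := hM
  obtain ⟨m, hm, hpm⟩ := (basis6 q).exists_p_smul_ne_zero hd hd' (v1_le v5)
    (by rw [hmult]; exact one_ne_zero)
  -- The vertex 6 does not occur in T(5), so every path through it acts as 0.
  have hp6 : ∀ j i, ∀ x : M, pp q j v6 i • x = 0 := fun j i x => by
    have : pp q j v6 i = pp q j v6 v6 * idem6 q v6 * pp q v6 v6 i := by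
      rw [pp_mul_idem q (le_v6 j) le_rfl]
      exact ((basis6 q).p_mul_p_self (le_v6 j) (le_v6 i)).symm
    rw [this, mul_smul, mul_smul, h6, smul_zero]
  -- Otherwise (141) - (12321) - c(14541) kills m. This is a relation between (21) and (41), so the
  -- vector at 2 would come down from 5.
  have key : ∀ c : K, (pp q v1 v4 v1 - pp q v1 v3 v1) • m ≠ c • pp q v1 v5 v1 • m := by
    intro c hc
    obtain ⟨w, hw⟩ := exists_of_arr_add_eq_zero q hd
      (u := -(pp q v2 v3 v1 • m) - c • pp q v2 v5 v1 • m) (v := pp q v4 v4 v1 • m)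
      (by rw [smul_sub, smul_neg, smul_algebra_smul_comm, ← mul_smul, ← mul_smul,
        idem_mul_pp q (by decide) (by decide), idem_mul_pp q (by decide) (by decide)])
      (by rw [← mul_smul, idem_mul_pp q (by decide) (by decide)])
      (by
        rw [smul_sub, smul_neg, smul_algebra_smul_comm, ← mul_smul, ← mul_smul, ← mul_smul,
          pp_mul_of_some q (r := v3) (by decide) (by decide) (by decide) (by decide) rfl,
          pp_mul_of_some q (r := v5) (by decide) (by decide) (by decide) (by decide) rfl,
          pp_mul_of_some q (r := v4) (by decide) (by decide) (by decide) (by decide) rfl,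
          tblCoeff, tblCoeff, tblCoeff, if_neg (by decide), if_neg (by decide),
          if_neg (by decide), one_smul, one_smul, one_smul, ← hc, sub_smul]
        abel)
    -- On a descent from 5 to 2 the path 2 → 3 → 2 → 1 passes through 6 and gives 0; on the vector
    -- at 2 it gives, up to sign, (14541) m, which is not 0.
    have h1 := congrArg (pp q v1 v3 v2 • ·) hw
    simp only [smul_sub, smul_neg] at h1
    rw [smul_algebra_smul_comm c (pp q v1 v3 v2), ← mul_smul, ← mul_smul, ← mul_smul,
      pp_mul_of_some q (r := v6) (by decide) (by decide) (by decide) (by decide) rfl,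
      pp_mul_of_some q (r := v5) (by decide) (by decide) (by decide) (by decide) rfl,
      pp_mul_of_some q (r := v6) (by decide) (by decide) (by decide) (by decide) rfl,
      smul_assoc, smul_assoc, smul_assoc, hp6, hp6, smul_zero, smul_zero, sub_zero,
      tblCoeff, if_neg (by decide), one_smul, eq_comm, neg_eq_zero] at h1
    exact hpm h1
  refine ⟨pp q v1 v5 v1 • m, (pp q v1 v4 v1 - pp q v1 v3 v1) • m, ?_, ⟨?_, ?_, ?_⟩, ?_, ?_, ?_⟩
  · rw [LinearIndependent.pair_iff]
    intro s t h
    have ht : t = 0 := by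
      by_contra ht
      refine key (-(t⁻¹ * s)) ?_
      have h1 := congrArg (t⁻¹ • ·) h
      simp only [smul_add, smul_smul, inv_mul_cancel₀ ht, one_smul, smul_zero] at h1
      rw [neg_smul]
      exact eq_neg_of_add_eq_zero_right h1
    rw [ht, zero_smul, add_zero] at h
    exact ⟨(smul_eq_zero.1 h).resolve_right hpm, ht⟩
  · rw [← mul_smul, idem_mul_pp q (by decide) (by decide)]
  · rw [← mul_smul, arr_12_mul_151, hp6]
  · rw [← mul_smul, arr_14_mul_151, zero_smul]
  · rw [← mul_smul, mul_sub, idem_mul_pp q (by decide) (by decide),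
      idem_mul_pp q (by decide) (by decide)]
  · rw [← mul_smul, mul_sub, arr_12_mul_141, arr_12_mul_131, sub_self, zero_smul]
  · rw [← mul_smul, mul_sub, arr_14_mul_141, arr_14_mul_131, sub_smul, smul_assoc, hp6, smul_zero,
      sub_zero]

end TiltingElements
end OneQH

namespace OneQH
open Vtx

/-! ### Radicals of projectives and homomorphisms as elements of the Ringel dual -/

section Jacobson

/-- Quasi-regularity: if a maximal N missed y, then e_i = u + r y with u in N, and s e_i u = e_i
would put the generator into N. -/
theorem mem_jacobson_of_forall {R ι : Type*} [Ring R] {e : ι → R} {i : ι} (he : e i * e i = e i)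
    (y : P e i) (h : ∀ r : R, ∃ s : R, s * (e i - e i * (r * y)) = e i) :
    y ∈ Module.jacobson R (P e i) := by
  rw [Module.jacobson, Submodule.mem_sInf]
  intro N (hN : IsCoatom N)
  by_contra hy
  have hlt : N < N ⊔ Submodule.span R {y} := lt_of_le_of_ne le_sup_left fun h1 => hy (by
    rw [h1]; exact Submodule.mem_sup_right (Submodule.mem_span_singleton_self y))
  have htop := hN.2 _ hlt
  have hmem : (⟨e i, e_mem_P e i⟩ : P e i) ∈ N ⊔ Submodule.span R {y} := by rw [htop]; trivial
  obtain ⟨u, hu, z, hz, huz⟩ := Submodule.mem_sup.1 hmem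
  obtain ⟨r, rfl⟩ := Submodule.mem_span_singleton.1 hz
  obtain ⟨s, hs⟩ := h r
  have h1 : s • e i • u = ⟨e i, e_mem_P e i⟩ := Subtype.ext (by
    have h2 : (u : R) = e i - r * y := eq_sub_of_add_eq (congrArg Subtype.val huz)
    change s * (e i * u.1) = e i
    rw [h2, mul_sub, he, hs])
  have h2 : (⟨e i, e_mem_P e i⟩ : P e i) ∈ N := h1 ▸ N.smul_mem s (N.smul_mem _ hu)
  refine hN.1 (eq_top_iff.2 ?_)
  rintro ⟨x, hx⟩ -
  obtain ⟨a, rfl⟩ := Submodule.mem_span_singleton.1 hx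
  exact N.smul_mem a h2

end Jacobson

section RingelHom

variable (A : Type*) [Ring A] {ι : Type*} [DecidableEq ι] (T : ι → Type*)
  [∀ i, AddCommGroup (T i)] [∀ i, Module A (T i)]

variable {A T} in
/-- A homomorphism between two summands as an element of the endomorphism ring. -/
def ringelHom {i j : ι} (g : T i →ₗ[A] T j) : RingelDual A T :=
  MulOpposite.op (LinearMap.single A T j ∘ₗ g ∘ₗ LinearMap.proj i)

theorem ringelIdem_eq (i : ι) : ringelIdem A T (OrderDual.toDual i) =
    ringelHom (LinearMap.id : T i →ₗ[A] T i) := rfl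

variable {A T} {i j l : ι}

/-- The opposite ring reverses composition: the left factor acts first. -/
theorem ringelHom_mul_ringelHom (g : T i →ₗ[A] T j) (h : T j →ₗ[A] T l) :
    ringelHom g * ringelHom h = ringelHom (h ∘ₗ g) := by
  refine MulOpposite.unop_injective (LinearMap.ext fun x => ?_)
  change Pi.single l (h ((Pi.single j (g (x i)) : ∀ i, T i) j)) = Pi.single l (h (g (x i)))
  rw [Pi.single_eq_same]

theorem idem_mul_ringelHom (g : T i →ₗ[A] T j) :
    ringelIdem A T (OrderDual.toDual i) * ringelHom g = ringelHom g := by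
  rw [ringelIdem_eq, ringelHom_mul_ringelHom, LinearMap.comp_id]

theorem ringelHom_mul_idem (g : T i →ₗ[A] T j) :
    ringelHom g * ringelIdem A T (OrderDual.toDual j) = ringelHom g := by
  rw [ringelIdem_eq, ringelHom_mul_ringelHom, LinearMap.id_comp]

theorem ringelHom_mem_P (g : T i →ₗ[A] T j) :
    ringelHom g ∈ P (ringelIdem A T) (OrderDual.toDual j) :=
  Submodule.mem_span_singleton.2 ⟨ringelHom g, ringelHom_mul_idem g⟩

theorem ringelHom_sub (g h : T i →ₗ[A] T j) :
    ringelHom (g - h) = ringelHom g - ringelHom h := by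
  refine MulOpposite.unop_injective (LinearMap.ext fun x => ?_)
  change Pi.single j (g (x i) - h (x i)) = Pi.single j (g (x i)) - Pi.single j (h (x i))
  rw [Pi.single_sub]

theorem ringelHom_injective :
    Function.Injective (ringelHom : (T i →ₗ[A] T j) → RingelDual A T) := by
  intro g h hgh
  refine LinearMap.ext fun x => ?_
  have h1 := congrFun (LinearMap.congr_fun (MulOpposite.op_injective hgh) (Pi.single i x)) j
  change (Pi.single j (g ((Pi.single i x : ∀ i, T i) i)) : ∀ i, T i) j =
    (Pi.single j (h ((Pi.single i x : ∀ i, T i) i)) : ∀ i, T i) j at h1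
  simpa using h1

/-- The component `T i → T j` of an element of the endomorphism ring. -/
def ringelComp (r : RingelDual A T) (i j : ι) : T i →ₗ[A] T j :=
  LinearMap.proj j ∘ₗ r.unop ∘ₗ LinearMap.single A T i

theorem ringelHom_ringelComp (r : RingelDual A T) (i j : ι) :
    ringelHom (ringelComp r i j) = ringelIdem A T (OrderDual.toDual i) * r *
      ringelIdem A T (OrderDual.toDual j) := rfl

theorem idem_mul_mul_ringelHom (r : RingelDual A T) (g : T i →ₗ[A] T j) (l : ι) :
    ringelIdem A T (OrderDual.toDual l) * (r * ringelHom g) = ringelHom (g ∘ₗ ringelComp r l i) :=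
  rfl

variable {K : Type*} [Field K] [Algebra K A] [∀ i, Module K (T i)] [∀ i, IsScalarTower K A (T i)]

theorem smul_ringelHom (c : K) (g : T i →ₗ[A] T j) :
    c • ringelHom g = ringelHom (c • g) := by
  refine MulOpposite.unop_injective (LinearMap.ext fun x => ?_)
  change c • Pi.single j (g (x i)) = Pi.single j (c • g (x i))
  rw [Pi.single_smul]

/-- Only the components of r with values in T(i), the source of g, contribute to the product. -/
theorem mul_ringelHom_eq_smul [Fintype ι] (r : RingelDual A T) (g : T i →ₗ[A] T j) (c : K)
    (h : g ∘ₗ ringelComp r i i = c • g) (h' : ∀ l, l ≠ i → g ∘ₗ ringelComp r l i = 0) :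
    r * ringelHom g = c • ringelHom g := by
  rw [smul_ringelHom]
  refine MulOpposite.unop_injective (LinearMap.ext fun x => ?_)
  change Pi.single j (g (r.unop x i)) = Pi.single j (c • g (x i))
  congr 1
  have h1 : r.unop x i = ∑ l, ringelComp r l i (x l) := by
    conv_lhs => rw [← Finset.univ_sum_single x, map_sum, Finset.sum_apply]
    rfl
  rw [h1, map_sum, Finset.sum_eq_single i]
  · exact LinearMap.congr_fun h (x i)
  · intro l _ hl
    exact LinearMap.congr_fun (h' l hl) (x l)
  · simp

end RingelHom
end OneQH

namespace OneQH
open Vtx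

/-! ### The Ringel dual is not 1-quasi-hereditary -/

section RingelDual

variable {K : Type u} [Field K] (q : K)

/-- This coefficient is the character by which A acts on the socle line of P(1), and so it is
multiplicative. -/
theorem coeff_v1_mul (hq : q ≠ 1) (a b : Alg6 q) :
    (basis6 q).coeff v1 v1 v1 (a * b) =
      (basis6 q).coeff v1 v1 v1 a * (basis6 q).coeff v1 v1 v1 b := by
  have F := isFrobenius6 q hq
  have h := F.mul_socle v1 (a * b)
  rw [mul_assoc, F.mul_socle v1 b, mul_smul_comm, F.mul_socle v1 a, smul_smul] at h
  rw [mul_comm]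
  exact (smul_left_injective K (F.p_socle_ne v1) h).symm

theorem coeff_v1_idem : (basis6 q).coeff v1 v1 v1 (idem6 q v1) = 1 := by
  rw [← (basis6 q).p_self, (basis6 q).coeff_p_self le_rfl le_rfl]

section Free

variable {M : Type*} [AddCommGroup M] [Module (Alg6 q) M] {m : M}

theorem exists_hom (hm : idem6 q v1 • m = m) (hfree : ∀ a ∈ P (idem6 q) v1, a • m = 0 → a = 0)
    (hgen : ∀ x : M, ∃ a ∈ P (idem6 q) v1, a • m = x) {X : Type*} [AddCommGroup X]
    [Module (Alg6 q) X] {x : X} (hx : idem6 q v1 • x = x) :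
    ∃ g : M →ₗ[Alg6 q] X, g m = x := by
  let lam : P (idem6 q) v1 →ₗ[Alg6 q] M :=
    LinearMap.toSpanSingleton (Alg6 q) M m ∘ₗ (P (idem6 q) v1).subtype
  have hinj : Function.Injective lam := (injective_iff_map_eq_zero lam).2 fun a ha =>
    Subtype.ext (hfree a.1 a.2 ha)
  have hsurj : Function.Surjective lam := fun x => by
    obtain ⟨a, ha, h⟩ := hgen x
    exact ⟨⟨a, ha⟩, h⟩
  let E := LinearEquiv.ofBijective lam ⟨hinj, hsurj⟩
  refine ⟨(LinearMap.toSpanSingleton (Alg6 q) X x ∘ₗ (P (idem6 q) v1).subtype) ∘ₗ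
    E.symm.toLinearMap, ?_⟩
  have h : E.symm m = ⟨idem6 q v1, e_mem_P _ _⟩ := E.symm_apply_eq.2 hm.symm
  change (E.symm m).1 • x = x
  rw [h, hx]

theorem hom_ext_generator (hgen : ∀ x : M, ∃ a ∈ P (idem6 q) v1, a • m = x) {X : Type*}
    [AddCommGroup X] [Module (Alg6 q) X] {g h : M →ₗ[Alg6 q] X} (hgh : g m = h m) : g = h := by
  refine LinearMap.ext fun x => ?_
  obtain ⟨a, -, rfl⟩ := hgen x
  rw [map_smul, map_smul, hgh]

/-- The map 1 - νθ sends m to (e_1 - b a) m, where e_1 - b a has coefficient 1 at e_1. Hence d(e_1 -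
b a) = e_1 for some d, and δ is given by m ↦ e_1 d m. -/
theorem exists_right_inverse (hq : q ≠ 1) (hm : idem6 q v1 • m = m)
    (hfree : ∀ a ∈ P (idem6 q) v1, a • m = 0 → a = 0)
    (hgen : ∀ x : M, ∃ a ∈ P (idem6 q) v1, a • m = x) {ν : M →ₗ[Alg6 q] M} {a : Alg6 q}
    (ha : a ∈ P (idem6 q) v1) (hν : ν m = a • m) (h0 : (basis6 q).coeff v1 v1 v1 a = 0)
    (θ : M →ₗ[Alg6 q] M) :
    ∃ δ : M →ₗ[Alg6 q] M, (LinearMap.id - ν ∘ₗ θ) ∘ₗ δ = LinearMap.id := by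
  obtain ⟨b, -, hb⟩ := hgen (θ m)
  have hc : idem6 q v1 - b * a ∈ P (idem6 q) v1 :=
    Submodule.sub_mem _ (e_mem_P _ _) (Submodule.smul_mem _ b ha)
  have hχ : (basis6 q).coeff v1 v1 v1 (idem6 q v1 - b * a) ≠ 0 := by
    rw [map_sub, coeff_v1_mul q hq, h0, coeff_v1_idem, mul_zero, sub_zero]
    exact one_ne_zero
  obtain ⟨d, hd⟩ := Submodule.mem_span_singleton.1 ((basis6 q).e_mem_span hc hχ)
  have he : idem6 q v1 * idem6 q v1 = idem6 q v1 := ((basis6 q).isBasicAlgebra.2.1.idem v1)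
  obtain ⟨δ, hδ⟩ := exists_hom q hm hfree hgen (x := (idem6 q v1 * d) • m)
    (by rw [← mul_smul, ← mul_assoc, he])
  refine ⟨δ, hom_ext_generator q hgen ?_⟩
  have h1 : (LinearMap.id - ν ∘ₗ θ : M →ₗ[Alg6 q] M) m = (idem6 q v1 - b * a) • m := by
    change m - ν (θ m) = _
    rw [← hb, map_smul, hν, sub_smul, hm, mul_smul]
  rw [LinearMap.comp_apply, hδ, map_smul, h1, ← mul_smul, mul_assoc]
  rw [smul_eq_mul] at hd
  rw [hd, he, hm, LinearMap.id_apply]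

end Free

variable {T : Vtx → Type v} [∀ i, AddCommGroup (T i)] [∀ i, Module (Alg6 q) (T i)] {m : T v6}

theorem ringelHom_mem_jacobson (hq : q ≠ 1) (hm : idem6 q v1 • m = m)
    (hfree : ∀ a ∈ P (idem6 q) v1, a • m = 0 → a = 0)
    (hgen : ∀ x : T v6, ∃ a ∈ P (idem6 q) v1, a • m = x) {ν : T v6 →ₗ[Alg6 q] T v6} {a : Alg6 q}
    (ha : a ∈ P (idem6 q) v1) (hν : ν m = a • m) (h0 : (basis6 q).coeff v1 v1 v1 a = 0) :
    (⟨ringelHom ν, ringelHom_mem_P ν⟩ : P (ringelIdem (Alg6 q) T) (OrderDual.toDual v6)) ∈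
      Module.jacobson (RingelDual (Alg6 q) T)
        (P (ringelIdem (Alg6 q) T) (OrderDual.toDual v6)) := by
  refine mem_jacobson_of_forall (idem_mul_ringelHom LinearMap.id) _ fun r => ?_
  obtain ⟨δ, hδ⟩ := exists_right_inverse q hq hm hfree hgen ha hν h0 (ringelComp r v6 v6)
  refine ⟨ringelHom δ, ?_⟩
  rw [idem_mul_mul_ringelHom, ringelIdem_eq, ← ringelHom_sub, ringelHom_mul_ringelHom, hδ]

variable [∀ i, Module K (T i)] [∀ i, IsScalarTower K (Alg6 q) (T i)]

/-- The e_6-part of the simple module at 6 is a line over K: an endomorphism of T(6) is a scalar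
plus one whose coefficient at e_1 is 0, and the latter is radical. -/
theorem exists_idem_smul_eq (hq : q ≠ 1) (hm : idem6 q v1 • m = m)
    (hfree : ∀ a ∈ P (idem6 q) v1, a • m = 0 → a = 0)
    (hgen : ∀ x : T v6, ∃ a ∈ P (idem6 q) v1, a • m = x)
    (x : S (ringelIdem (Alg6 q) T) (OrderDual.toDual v6)) :
    ∃ c : K, ringelIdem (Alg6 q) T (OrderDual.toDual v6) • x =
      algebraMap K (RingelDual (Alg6 q) T) c • Submodule.Quotient.mk
        ⟨ringelIdem (Alg6 q) T (OrderDual.toDual v6), e_mem_P _ _⟩ := by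
  obtain ⟨x, rfl⟩ := Submodule.Quotient.mk_surjective _ x
  obtain ⟨x, hx⟩ := x
  obtain ⟨r, rfl⟩ := Submodule.mem_span_singleton.1 hx
  obtain ⟨a, ha, hη⟩ := hgen (ringelComp r v6 v6 m)
  set χ := (basis6 q).coeff v1 v1 v1
  refine ⟨χ a, ?_⟩
  rw [← Submodule.Quotient.mk_smul, ← Submodule.Quotient.mk_smul, Submodule.Quotient.eq]
  have h := ringelHom_mem_jacobson q hq hm hfree hgen
    (ν := ringelComp r v6 v6 - χ a • LinearMap.id) (a := a - χ a • idem6 q v1)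
    (Submodule.sub_mem _ ha (scalar_smul_mem q (e_mem_P _ _) _))
    (by rw [LinearMap.sub_apply, LinearMap.smul_apply, ← hη, LinearMap.id_apply, sub_smul,
          smul_assoc, hm])
    (by rw [map_sub, map_smul, coeff_v1_idem, smul_eq_mul, mul_one, sub_self])
  convert h using 1
  refine Subtype.ext ?_
  change ringelIdem (Alg6 q) T (OrderDual.toDual v6) *
      (r * ringelIdem (Alg6 q) T (OrderDual.toDual v6)) -
    algebraMap K (RingelDual (Alg6 q) T) (χ a) * ringelIdem (Alg6 q) T (OrderDual.toDual v6) =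
      ringelHom (ringelComp r v6 v6 - χ a • LinearMap.id)
  rw [ringelHom_sub, ringelHom_ringelComp, ← smul_ringelHom, ← ringelIdem_eq, mul_assoc,
    Algebra.smul_def]

/-- Such a g factors through the head of T(6), so endomorphisms of T(6) act on it by scalars, and it
remains to see that maps from the other T(l) land in the radical of T(6). -/
theorem exists_mul_ringelHom_eq (hT : ∀ i, IsTilting K (idem6 q) i (T i))
    (hm : idem6 q v1 • m = m)
    (hfree : ∀ a ∈ P (idem6 q) v1, a • m = 0 → a = 0)
    (hgen : ∀ x : T v6, ∃ a ∈ P (idem6 q) v1, a • m = x) {j : Vtx} {g : T v6 →ₗ[Alg6 q] T j}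
    (h12 : arr q v1 v2 • g m = 0) (h14 : arr q v1 v4 • g m = 0) (r : RingelDual (Alg6 q) T) :
    ∃ c : K, r * ringelHom g = c • ringelHom g := by
  have hg : ∀ a : Alg6 q, g (a • m) = (basis6 q).coeff v1 v1 v1 a • g m := fun a => by
    rw [map_smul]
    exact smul_of_killed q (AlgHom.id K _) (by simp [← map_smul, hm]) h12 h14 a
  obtain ⟨a, ha, hη⟩ := hgen (ringelComp r v6 v6 m)
  refine ⟨_, mul_ringelHom_eq_smul r g ((basis6 q).coeff v1 v1 v1 a)
    (hom_ext_generator q hgen ?_) fun l hl => LinearMap.ext fun z => ?_⟩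
  · rw [LinearMap.comp_apply, ← hη, hg, LinearMap.smul_apply]
  · obtain ⟨b, hb, hbz⟩ := hgen (ringelComp r l v6 z)
    rw [LinearMap.comp_apply, ← hbz, hg, LinearMap.zero_apply]
    by_cases h0 : (basis6 q).coeff v1 v1 v1 b = 0
    · rw [h0, zero_smul]
    -- Otherwise the generator m would be in the image of T(l), which has no part at the vertex 6;
    -- but the path from 1 to 6 does not kill m.
    exfalso
    obtain ⟨d, hd⟩ := Submodule.mem_span_singleton.1 ((basis6 q).e_mem_span hb h0)
    have h1 : m = ringelComp r l v6 (d • z) := by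
      rw [map_smul, ← hbz, ← mul_smul, ← smul_eq_mul, hd, hm]
    have h2 : xx q v6 v6 • m = 0 := by
      have h3 : xx q v6 v6 = idem6 q v6 * xx q v6 v6 :=
        (idem_mul_pp q le_rfl (v1_le v6)).symm
      rw [h1, h3, mul_smul, ← map_smul, ← map_smul,
        idem_smul_eq_zero q (hT l) (fun h => hl (le_antisymm (le_v6 l) h)), map_zero]
    exact xx_ne_zero q (by decide) (hfree _ (xx_mem q _ _) h2)

/-- Both vectors of `exists_socle_v5` give maps T(6) → T(5) in the e_6-part of the socle at 5,
whereas an isomorphism with the simple module at 6 leaves only a line. -/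
theorem not_isOneQuasiHereditary_ringelDual (hq : q ≠ 1)
    (hT : ∀ i, IsTilting K (idem6 q) i (T i)) :
    ¬ IsOneQuasiHereditary K (ringelIdem (Alg6 q) T) := by
  rintro ⟨-, b, -, hb, -, -, hsoc, -⟩
  -- In the opposite order 6 is the smallest vertex.
  obtain rfl : b = OrderDual.toDual v6 :=
    le_antisymm (hb _) (OrderDual.toDual_le.2 (le_v6 (OrderDual.ofDual b)))
  obtain ⟨⟨f⟩, -⟩ := hsoc (OrderDual.toDual v5)
  obtain ⟨m, hm, hfree, hgen⟩ := exists_generator_v6 q hq (hT v6)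
  obtain ⟨σ, τ, hli, ⟨hσ1, hσ2, hσ4⟩, hτ1, hτ2, hτ4⟩ := exists_socle_v5 q (hT v5)
  have hne : σ ≠ 0 := hli.ne_zero 0
  have hne' : τ ≠ 0 := hli.ne_zero 1
  have key : ∀ x : T v5, x ≠ 0 → idem6 q v1 • x = x → arr q v1 v2 • x = 0 → arr q v1 v4 • x = 0 →
      ∃ (g : T v6 →ₗ[Alg6 q] T v5) (y : soc (RingelDual (Alg6 q) T)
        (P (ringelIdem (Alg6 q) T) (OrderDual.toDual v5))) (c : K), g m = x ∧
        (y : P (ringelIdem (Alg6 q) T) (OrderDual.toDual v5)).1 = ringelHom g ∧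
        f y = algebraMap K (RingelDual (Alg6 q) T) c • Submodule.Quotient.mk
        ⟨ringelIdem (Alg6 q) T (OrderDual.toDual v6), e_mem_P _ _⟩ := by
    intro x hx h1 h2 h4
    obtain ⟨g, rfl⟩ := exists_hom q hm hfree hgen h1
    let y : P (ringelIdem (Alg6 q) T) (OrderDual.toDual v5) := ⟨ringelHom g, ringelHom_mem_P g⟩
    have hy : y ≠ 0 := fun h => hx (by
      have : g = 0 := ringelHom_injective ((congrArg Subtype.val h).trans (by
        simp [ringelHom]))
      rw [this, LinearMap.zero_apply])
    have hs : IsSimpleModule (RingelDual (Alg6 q) T)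
        (Submodule.span (RingelDual (Alg6 q) T) {y}) :=
      isSimpleModule_span_of_smul (K := K) hy fun r => by
        obtain ⟨c, hc⟩ := exists_mul_ringelHom_eq q hT hm hfree hgen h2 h4 r
        exact ⟨c, Subtype.ext hc⟩
    have hmem : y ∈ soc (RingelDual (Alg6 q) T)
        (P (ringelIdem (Alg6 q) T) (OrderDual.toDual v5)) :=
      (le_sSup hs : Submodule.span (RingelDual (Alg6 q) T) {y} ≤ _)
        (Submodule.mem_span_singleton_self y)
    obtain ⟨c, hc⟩ := exists_idem_smul_eq q hq hm hfree hgen (f ⟨y, hmem⟩)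
    refine ⟨g, ⟨y, hmem⟩, c, rfl, rfl, ?_⟩
    rw [← hc, ← map_smul]
    exact congrArg f (Subtype.ext (Subtype.ext (idem_mul_ringelHom g).symm))
  obtain ⟨g, y, c, hg, hy, hfy⟩ := key σ hne hσ1 hσ2 hσ4
  obtain ⟨g', y', c', hg', hy', hfy'⟩ := key τ hne' hτ1 hτ2 hτ4
  -- The images c and c' on the line satisfy c' y = c y', hence c' σ = c τ. Independence gives c =
  -- 0, so y = 0 and σ = 0, a contradiction.
  have h1 : algebraMap K (RingelDual (Alg6 q) T) c' • y =
      algebraMap K (RingelDual (Alg6 q) T) c • y' := by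
    apply f.injective
    rw [map_smul, map_smul, hfy, hfy', ← mul_smul, ← mul_smul, ← map_mul, ← map_mul, mul_comm]
  have h2 : c' • g = c • g' := by
    apply ringelHom_injective
    rw [← smul_ringelHom, ← smul_ringelHom, Algebra.smul_def, Algebra.smul_def, ← hy, ← hy']
    exact congrArg (fun z => z.1.1) h1
  have h3 : c' • σ - c • τ = 0 := by
    rw [← hg, ← hg', sub_eq_zero]
    exact LinearMap.congr_fun h2 m
  have h4 := LinearIndependent.pair_iff.1 hli c' (-c) (by rw [neg_smul, ← sub_eq_add_neg, h3])
  have hc : c = 0 := neg_eq_zero.1 h4.2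
  rw [hc, map_zero, zero_smul] at hfy
  have hy0 : y = 0 := f.injective (hfy.trans (map_zero f).symm)
  apply hne
  rw [← hg]
  have : g = 0 := ringelHom_injective (hy.symm.trans (by rw [hy0]; simp [ringelHom]))
  rw [this, LinearMap.zero_apply]

end RingelDual
end OneQH

theorem mainTheorem7 {K : Type u} [Field K] [IsAlgClosed K] (q : K) (hq : q ≠ 1) :
    -- `A` is 1-quasi-hereditary
    (IsBasicAlgebra K (idem6 q) ∧ IsOneQuasiHereditary K (idem6 q)) ∧
    -- the factor algebras `A(i)` with `i ≠ 5` are 1-quasi-hereditary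
    ((∀ i : Vtx, IsBasicAlgebra K (truncIdem K (idem6 q) i)) ∧
      (∀ i : Vtx, i ≠ v5 → IsOneQuasiHereditary K (truncIdem K (idem6 q) i)) ∧
      Nonempty (TruncAlg (idem6 q) v1 ≃ₐ[K] AuslanderAlgebra K 1) ∧
      Nonempty (TruncAlg (idem6 q) v2 ≃ₐ[K] AuslanderAlgebra K 2) ∧
      Nonempty (TruncAlg (idem6 q) v3 ≃ₐ[K] AuslanderAlgebra K 3) ∧
      Nonempty (TruncAlg (idem6 q) v4 ≃ₐ[K] AuslanderAlgebra K 2)) ∧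
    -- the socle of `P(1)` over `A(5)` and the elements `p₁ = (14541)`, `p₂ = (141) - (12321)`
    (∀ p₁ p₂ : TruncAlg (idem6 q) v5,
      p₁ = pth5 q [v1, v4, v5, v4, v1] →
      p₂ = pth5 q [v1, v4, v1] - pth5 q [v1, v2, v3, v2, v1] →
        p₁ ∈ P (truncIdem K (idem6 q) v5) one5 ∧ p₂ ∈ P (truncIdem K (idem6 q) v5) one5 ∧
        LinearIndependent K ![p₁, p₂] ∧
        pth5 q [v1, v2] * p₁ = 0 ∧ pth5 q [v1, v4] * p₁ = 0 ∧
        pth5 q [v1, v2] * p₂ = 0 ∧ pth5 q [v1, v4] * p₂ = 0 ∧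
        IsSimpleModule (TruncAlg (idem6 q) v5) (Submodule.span (TruncAlg (idem6 q) v5) {p₁}) ∧
        IsSimpleModule (TruncAlg (idem6 q) v5) (Submodule.span (TruncAlg (idem6 q) v5) {p₂})) ∧
    ¬ IsSimpleModule (TruncAlg (idem6 q) v5)
        (soc (TruncAlg (idem6 q) v5) (P (truncIdem K (idem6 q) v5) one5)) ∧
    ¬ Nonempty (soc (TruncAlg (idem6 q) v5) (P (truncIdem K (idem6 q) v5) one5)
        ≃ₗ[TruncAlg (idem6 q) v5] S (truncIdem K (idem6 q) v5) one5) ∧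
    ¬ IsOneQuasiHereditary K (truncIdem K (idem6 q) v5) ∧
    -- generators of the summands `T(i)` of the characteristic tilting module
    (∀ i : Vtx, i ≠ v5 → tGen q i ∈ P (idem6 q) v1 ∧
      IsTilting K (idem6 q) i (Submodule.span (Alg6 q) {tGen q i})) ∧
    (T5 q ≤ (P (idem6 q) v1).prod (P (idem6 q) v1) ∧ IsTilting K (idem6 q) v5 (T5 q)) ∧
    -- the Ringel dual of `A`, with the opposite order, is not 1-quasi-hereditary
    (∀ (T : Vtx → Type v) [∀ i, AddCommGroup (T i)] [∀ i, Module K (T i)]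
      [∀ i, Module (Alg6 q) (T i)] [∀ i, IsScalarTower K (Alg6 q) (T i)],
      (∀ i, IsTilting K (idem6 q) i (T i)) →
        ¬ IsOneQuasiHereditary K (ringelIdem (Alg6 q) T)) := by
  exact ⟨⟨(basis6 q).isBasicAlgebra, (isFrobenius6 q hq).isOneQuasiHereditary⟩,
    ⟨isBasicAlgebra_trunc q, fun i hi => isOneQuasiHereditary_trunc q hq hi, trunc_v1_equiv q,
      trunc_v2_equiv q, trunc_v3_equiv q, trunc_v4_equiv q⟩,
    socle_trunc q, not_isSimpleModule_soc_trunc q, not_soc_trunc_equiv q one5,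
    not_isOneQuasiHereditary_trunc_v5 q,
    fun i hi => ⟨tGen_mem q hi, isTilting_span_tGen q hq hi⟩, ⟨T5_le q, isTilting_T5 q hq⟩,
    fun _ _ _ _ _ hT => not_isOneQuasiHereditary_ringelDual q hq hT⟩
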